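/- Let $G$ be a homogeneous Lie group of dimension $n$: a (connected, simply connected) Lie group with an expanding one-parameter group of automorphisms $h_s=e^{sD}$, where the derivation $D$ of the Lie algebra $\mathfrak g$ is diagonalizable with positive eigenvalues $d_1,\dots,d_n$. We use global coordinates $G\simeq\mathbb R^n$ centred at the neutral element (for instance exponential coordinates in an eigenbasis of $D$) in which the group operations are smooth and $h_s(x)=(e^{sd_1}x_1,\dots,e^{sd_n}x_n)$. Let $T=\operatorname{trace}(D)=\sum_i d_i$. An element $\varphi\in\Lambda^k\mathfrak g^*$ has weight $w$ if $h_s^*\varphi=e^{sw}\varphi$ for all $s$; this gives a finite decomposition $\Lambda^k\mathfrak g^*=\bigoplus_w\Lambda^{k,w}\mathfrak g^*$, preserved by the exterior derivative of left-invariant forms, and hence a decomposition $H^k(\mathfrak g)=\bigoplus_w H^{k,w}(\mathfrak g)$ of Lie algebra cohomology. Let $w_{\min}(k)$ and $w_{\max}(k)$ be the smallest and the largest $w$ with $H^{k,w}(\mathfrak g)\neq0$. A differential $k$-form on $G\setminus\{1\}$ has weight $\ge w$ if its value at every point, translated to the neutral element by left translation, lies in $\bigoplus_{v\ge w}\Lambda^{k,v}\mathfrak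 g^*$. A smooth form $\alpha$ on $G\setminus\{1\}$ is homogeneous of degree $\lambda$ if $h_s^*\alpha=e^{s\lambda}\alpha$ for all $s\in\mathbb R$. For forms $\beta,\beta'$ on $G\setminus\{1\}$ of complementary degrees, homogeneous of degrees $\lambda$ and $-\lambda$, put $I(\beta,\beta')=\int_\Sigma\iota_\xi(\beta\wedge\beta')$, where $\xi$ is the vector field generating $s\mapsto h_s$ and $\Sigma$ is the Euclidean unit sphere of the coordinates, which is a smooth hypersurface transverse to $\xi$ bounding a domain that contains $1$. For $k=1,\dots,n$, let $ws_G(k)$ be the maximum of the numbers $w+w'-T$, where $w$ is a weight of $\Lambda^k\mathfrak g^*$ and $w'$ a weight of $\Lambda^{n-k+1}\mathfrak g^*$, such that for a dense set of real numbers $\lambda$ there exist a $(k-1)$-form $\alpha$ on $G\setminus\{1\}$, homogeneous of degree $\lambda$, with $d\alpha$ of weight $\ge w$, and an $(n-k)$-form $\alpha'$ on $G\setminus\{1\}$, homogeneous of degree $-\lambda$, with $d\alpha'$ of weight $\ge w'$, such that $I(d\alpha,\alpha')\neq0$. **Proposition.** For every $k=1,\dots,n$ this maximum exists, and $$ws_G(k)\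 \ge\ \max\Bigl\{\min_i d_i,\ w_{\min}(k)-w_{\max}(k-1)\Bigr\}.$$ In particular, if $D$ is normalized so that all its eigenvalues are at least $1$ (for instance if they are positive integers, as on a Carnot group), then $$ws_G(k)\ \ge\ \max\{1,\ w_{\min}(k)-w_{\max}(k-1)\}.$$ -/

import Mathlib

open scoped ContDiff

noncomputable section

namespace HomGroup

/-- Coordinate space `ℝⁿ` with its Euclidean structure. -/
abbrev E (n : ℕ) : Type := EuclideanSpace ℝ (Fin n)

/-- Alternating `k`-linear forms on `ℝⁿ`. -/
abbrev Alt (n k : ℕ) : Type := E n [⋀^Fin k]→L[ℝ] ℝ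

/-- Differential `k`-forms on `ℝⁿ`. A form on the complement of the origin is represented by any
extension; its value at the origin is never used. -/
abbrev Form (n k : ℕ) : Type := E n → Alt n k

/-- The diagonal linear map `x ↦ (c₁ x₁, …, cₙ xₙ)`. -/
def diagMap {n : ℕ} (c : Fin n → ℝ) : E n →L[ℝ] E n :=
  Matrix.toEuclideanCLM (n := Fin n) (𝕜 := ℝ) (Matrix.diagonal c)

theorem diagMap_apply {n : ℕ} (c : Fin n → ℝ) (x : E n) (i : Fin n) :
    diagMap c x i = c i * x i := by
  simp [diagMap, Matrix.ofLp_toEuclideanCLM, Matrix.mulVec_diagonal]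

/-- A homogeneous Lie group: a smooth group law on `ℝⁿ` with neutral element `0`, together with
the expanding one-parameter group `h_s = exp (s D)`, `D = diag (wt 1, …, wt n)` with
`wt i > 0`, acting by automorphisms. -/
structure HomogeneousLieGroup (n : ℕ) where
  mul : E n → E n → E n
  inv : E n → E n
  mul_assoc : ∀ x y z, mul (mul x y) z = mul x (mul y z)
  zero_mul : ∀ x, mul 0 x = x
  mul_zero : ∀ x, mul x 0 = x
  inv_mul : ∀ x, mul (inv x) x = 0
  contDiff_mul : ContDiff ℝ ∞ (fun p : E n × E n => mul p.1 p.2)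
  contDiff_inv : ContDiff ℝ ∞ inv
  /-- The eigenvalues of the derivation `D`. -/
  wt : Fin n → ℝ
  wt_pos : ∀ i, 0 < wt i
  dil_mul : ∀ (s : ℝ) (x y : E n),
    diagMap (fun i => Real.exp (s * wt i)) (mul x y) =
      mul (diagMap (fun i => Real.exp (s * wt i)) x) (diagMap (fun i => Real.exp (s * wt i)) y)

namespace HomogeneousLieGroup

variable {n : ℕ} (G : HomogeneousLieGroup n)

/-- The dilation `h_s = exp (s D)`. -/
def dil (s : ℝ) : E n →L[ℝ] E n := diagMap (fun i => Real.exp (s * G.wt i))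

/-- The vector field `ξ` generating `s ↦ h_s`, that is `ξ(x) = D x`. -/
def xi (x : E n) : E n := diagMap G.wt x

/-- The homogeneous dimension `T = trace D`. -/
def homDim : ℝ := ∑ i, G.wt i

/-! ### Weights of left-invariant forms and Lie algebra cohomology

The Lie algebra `𝔤` is the tangent space at the neutral element `0`, so `Alt n k` is
`Λᵏ 𝔤*`. -/

/-- `Λ^{k,w} 𝔤*`: the alternating forms of weight `w`. -/
def weightSpace (k : ℕ) (w : ℝ) : Submodule ℝ (Alt n k) where
  carrier := {φ | ∀ s : ℝ, φ.compContinuousLinearMap (G.dil s) = Real.exp (s * w) • φ}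
  zero_mem' := by intro s; ext v; simp
  add_mem' := by
    intro a b ha hb s
    have h1 := ha s
    have h2 := hb s
    ext v
    have h1' := congrArg (fun f => f v) h1
    have h2' := congrArg (fun f => f v) h2
    simp only [ContinuousAlternatingMap.compContinuousLinearMap_apply,
      ContinuousAlternatingMap.smul_apply, ContinuousAlternatingMap.add_apply] at h1' h2' ⊢
    rw [h1', h2', smul_add]
  smul_mem' := by
    intro c a ha s
    have h1 := ha s
    ext v
    have h1' := congrArg (fun f => f v) h1
    simp only [ContinuousAlternatingMap.compContinuousLinearMap_apply,
      ContinuousAlternatingMap.smul_apply] at h1' ⊢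
    rw [h1', smul_comm]

/-- `⨁_{v ≥ w} Λ^{k,v} 𝔤*`: the alternating forms of weight at least `w`. -/
def weightSpaceGE (k : ℕ) (w : ℝ) : Submodule ℝ (Alt n k) :=
  ⨆ v : Set.Ici w, G.weightSpace k v

/-- The finitely many weights occurring in `Λᵏ 𝔤*`. -/
def weights (k : ℕ) : Set ℝ := {w | G.weightSpace k w ≠ ⊥}

/-- The left-invariant form on `G` with value `φ` at the neutral element: at `x` it is the
pull-back of `φ` by left translation by `x⁻¹`. -/
def leftInvariant {k : ℕ} (φ : Alt n k) : Form n k :=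
  fun x => φ.compContinuousLinearMap (fderiv ℝ (G.mul (G.inv x)) x)

theorem differentiable_leftInvariant {k : ℕ} (φ : Alt n k) :
    Differentiable ℝ (G.leftInvariant φ) := by
  have h : ContDiff ℝ ∞ (fun p : E n × E n => G.mul (G.inv p.1) p.2) :=
    G.contDiff_mul.comp ((G.contDiff_inv.comp contDiff_fst).prodMk contDiff_snd)
  have h' : ContDiff ℝ 1 (fun x => fderiv ℝ (G.mul (G.inv x)) x) :=
    ContDiff.fderiv (f := fun x y => G.mul (G.inv x) y) (m := ∞) h contDiff_id (by
      exact right_eq_inf.mp rfl)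
  have h'' := h'.differentiable one_ne_zero
  intro x
  exact ((hasFDerivAt_const φ x).continuousAlternatingMapCompContinuousLinearMap
    (h'' x).hasFDerivAt).differentiableAt

/-- The Lie algebra (Chevalley–Eilenberg) differential on `Λᵏ 𝔤*`: the exterior derivative of
left-invariant forms, read at the neutral element. -/
def d₀ (k : ℕ) : Alt n k →ₗ[ℝ] Alt n (k + 1) where
  toFun φ := extDeriv (G.leftInvariant φ) 0
  map_add' a b := by
    rw [← extDeriv_add (G.differentiable_leftInvariant a 0) (G.differentiable_leftInvariant b 0)]
    rfl
  map_smul' c a := by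
    rw [RingHom.id_apply, ← extDeriv_smul]
    rfl

/-- Cocycles of degree `k` and weight `w`. -/
def cocycles (k : ℕ) (w : ℝ) : Submodule ℝ (Alt n k) :=
  G.weightSpace k w ⊓ LinearMap.ker (G.d₀ k)

/-- Coboundaries of degree `k` and weight `w`. -/
def coboundaries : (k : ℕ) → (w : ℝ) → Submodule ℝ (Alt n k)
  | 0, _ => ⊥
  | k + 1, w => (G.weightSpace k w).map (G.d₀ k)

/-- `H^{k,w}(𝔤)`: cocycles modulo coboundaries, as the image of the space of cocycles in the
quotient of `Λᵏ 𝔤*` by the coboundaries of weight `w`. -/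
def cohomology (k : ℕ) (w : ℝ) : Submodule ℝ (Alt n k ⧸ G.coboundaries k w) :=
  (G.cocycles k w).map (G.coboundaries k w).mkQ

/-- The weights `w` such that `H^{k,w}(𝔤) ≠ 0`. -/
def cohomologyWeights (k : ℕ) : Set ℝ := {w | G.cohomology k w ≠ ⊥}

/-- The smallest weight of `Hᵏ(𝔤)`. -/
def wMin (k : ℕ) : ℝ := sInf (G.cohomologyWeights k)

/-- The largest weight of `Hᵏ(𝔤)`. -/
def wMax (k : ℕ) : ℝ := sSup (G.cohomologyWeights k)

/-! ### Homogeneous forms on the complement of the neutral element -/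

/-- `α` is a smooth form on `G ∖ {1}` with `h_s^* α = e^{sλ} α` for all `s`. -/
def IsHomogeneous {k : ℕ} (lam : ℝ) (α : Form n k) : Prop :=
  ContDiffOn ℝ ∞ α {0}ᶜ ∧
    ∀ (s : ℝ) (x : E n), x ≠ 0 →
      (α (G.dil s x)).compContinuousLinearMap (G.dil s) = Real.exp (s * lam) • α x

/-- The form `β` on `G ∖ {1}` has weight at least `w`: its components in a left-invariant frame
have weights at least `w`, i.e. for every `x` the pull-back of `β x` to `𝔤` by left translation
by `x` has weight at least `w`. -/
def HasWeightGE {k : ℕ} (w : ℝ) (β : Form n k) : Prop :=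
  ∀ x : E n, x ≠ 0 →
    (β x).compContinuousLinearMap (fderiv ℝ (G.mul x) 0) ∈ G.weightSpaceGE k w

end HomogeneousLieGroup

/-! ### The pairing `I` -/

/-- The exterior product (sum over shuffles with signs). -/
def wedge {n p q : ℕ} (a : Alt n p) (b : Alt n q) : E n [⋀^Fin (p + q)]→ₗ[ℝ] ℝ :=
  ((LinearMap.mul' ℝ ℝ).compAlternatingMap
    (AlternatingMap.domCoprod a.toAlternatingMap b.toAlternatingMap)).domDomCongr finSumFinEquiv

/-- Integral of an `(n-1)`-form `η` over the unit sphere, oriented as the boundary of the unit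
ball of `ℝⁿ`: if `η = ∑ i, (-1)^i F_i dx₀ ∧ … (omit dx_i) … ∧ dx_r`, it is the flux
`∫ F · x dσ(x)` with respect to the surface measure `σ`. -/
def sphereIntegral {n r : ℕ} (hr : r + 1 = n) (η : E n → E n [⋀^Fin r]→ₗ[ℝ] ℝ) : ℝ :=
  ∫ x : Metric.sphere (0 : E n) 1,
    (∑ i : Fin (r + 1), (-1 : ℝ) ^ (i : ℕ) * (x : E n) (Fin.cast hr i) *
      η x (fun j : Fin r => EuclideanSpace.single (Fin.cast hr (i.succAbove j)) (1 : ℝ)))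
    ∂(MeasureTheory.volume : MeasureTheory.Measure (E n)).toSphere

namespace HomogeneousLieGroup

variable {n : ℕ} (G : HomogeneousLieGroup n)

/-- `I(β, β') = ∫_Σ ι_ξ (β ∧ β')` for forms of complementary degrees. The hypersurface `Σ` is the
Euclidean unit sphere. It bounds a domain containing the neutral element and is transverse to
`ξ`, and it is the level set `ρ = 1` of a homogeneous function `ρ` of degree one, smooth and
positive away from the neutral element. -/
def pairing {p q r : ℕ} (h : p + q = r + 1) (hr : r + 1 = n) (β : Form n p) (β' : Form n q) : ℝ :=
  sphereIntegral hr fun x =>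
    ((wedge (β x) (β' x)).domDomCongr (finCongr h)).curryLeft (G.xi x)

/-- The set of real numbers `w + w' - T`, with `w` a weight of `k`-forms and `w'` a weight of
`(n-k+1)`-forms, such that for a dense set of `λ` there are a form `α` of degree `a = k - 1`,
homogeneous of degree `λ`, and a form `α'` of degree `b = n - k`, homogeneous of degree `-λ`,
on `G ∖ {1}`, with `dα` of weight `≥ w`, `dα'` of weight `≥ w'` and `I(dα, α') ≠ 0`. -/
def wsSet (k : ℕ) : Set ℝ :=
  {t | ∃ (a b : ℕ) (_ : a + 1 = k) (hn : (a + b) + 1 = n),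
    ∃ w ∈ G.weights (a + 1), ∃ w' ∈ G.weights (b + 1), t = w + w' - G.homDim ∧
      Dense {lam : ℝ | ∃ (α : Form n a) (α' : Form n b),
        G.IsHomogeneous lam α ∧ G.IsHomogeneous (-lam) α' ∧
        G.HasWeightGE w (extDeriv α) ∧ G.HasWeightGE w' (extDeriv α') ∧
        G.pairing (Nat.add_right_comm a 1 b) hn (extDeriv α) α' ≠ 0}}

/-- The numerical invariant `ws_G(k)`, the maximum of `wsSet k`. -/
def ws (k : ℕ) : ℝ := sSup (G.wsSet k)

end HomogeneousLieGroup

end HomGroup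

end

/-! Write `k = a + 1`, `b = n - k`, `u = wMin k`. The proof constructs a pair `α`, `α'` for all but
finitely many degrees `λ`, with `dα` of weight `≥ u` and `dα'` of weight at least both `T - u + min
wt` and `T - wMax a`. Adding the weights and subtracting `T` gives the two terms of the bound.

The engine is weight raising. In the left-invariant frame the leading weight part of `d` is the
algebraic differential `d₀`; the remaining terms differentiate coefficients and gain at least `min
wt` (`toFrame_extDeriv_sub_mem`). The lowest part of a closed form is therefore `d₀`-closed. If its
weight carries no cohomology, a dilation-equivariant partial inverse `δ` of `d₀` removes it by
subtracting an exact form. Finitely many steps clear every weight below the first cohomological one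
(`toFrame_liftStep_iterate_mem`), and each step is a differential operator that preserves
homogeneity.

For `α`, take a cocycle `φ` of weight `u` that is not exact, and a dual cocycle `ψ` of weight `T -
u` with `φ ∧ ψ ≠ 0` (`exists_dual_cocycle`). The left-invariant form of `φ` is `d` of its
contraction with `ξ` divided by `u`, by Cartan's formula. Multiplying this primitive by `e^{μρ}`,
with `ρ` a logarithmic gauge, gives every degree; weight raising is then applied to the
differential. At a fixed point the result is `e^{μρ}` times a polynomial in `μ`. At `μ = 0` nothing
is changed and the product with `ψ` is nonzero, so it is nonzero for all but finitely many `μ`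
(`exists_form_weight_wMin`).

For `α'`, multiply the left-invariant form of `ψ` by a function `g` proportional, with a positive
factor, to the coefficient of `dα ∧ ψ`, so that the integrand of the pairing is a nonnegative
square. Since `ψ` is closed, `d(gψ)` already has weight `≥ T - u + min wt`; weight raising brings it
to `≥ T - wMax a`, where Poincaré duality locates the lowest cohomology in degree `b + 1`. The
correction has weight `≥ T - u + min wt`, hence its product with `dα` vanishes and the pairing is
unaffected (`exists_dual_form`).

The extremal weights are meaningful because cohomology is nonzero in every degree up to `n`:
otherwise weight raising would give a support-preserving primitive of a bump form, against Stokes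
(`cohomologyWeights_succ_nonempty`). The maximum exists because only finitely many weights occur. -/

noncomputable section

namespace HomGroup

variable {n : ℕ}

/-! ### Components of alternating forms -/

/-- The tuple of standard basis vectors with indices `I`. -/
def basisTuple {k : ℕ} (I : Fin k → Fin n) : Fin k → E n :=
  fun j => EuclideanSpace.single (I j) (1 : ℝ)

theorem Alt.ext_basisTuple {k : ℕ} {φ ψ : Alt n k}
    (h : ∀ I : Fin k → Fin n, φ (basisTuple I) = ψ (basisTuple I)) : φ = ψ := by
  apply ContinuousAlternatingMap.toAlternatingMap_injective
  refine Module.Basis.ext_alternating (EuclideanSpace.basisFun (Fin n) ℝ).toBasis fun I _ => ?_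
  simpa using! h I

/-- The components of an alternating form in the standard basis. -/
def components (n k : ℕ) : Alt n k →ₗ[ℝ] ((Fin k → Fin n) → ℝ) where
  toFun φ I := φ (basisTuple I)
  map_add' _ _ := rfl
  map_smul' _ _ := rfl

theorem components_injective (n k : ℕ) : Function.Injective (components n k) :=
  fun _ _ h => Alt.ext_basisTuple fun I => congrFun h I

instance instFiniteDimensionalAlt (n k : ℕ) : FiniteDimensional ℝ (Alt n k) :=
  Module.Finite.of_injective (components n k) (components_injective n k)

theorem exists_components_leftInverse (n k : ℕ) :
    ∃ r : ((Fin k → Fin n) → ℝ) →L[ℝ] Alt n k, ∀ φ, r (components n k φ) = φ := by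
  obtain ⟨r, hr⟩ := (components n k).exists_leftInverse_of_injective
    (LinearMap.ker_eq_bot.2 (components_injective n k))
  exact ⟨LinearMap.toContinuousLinearMap r, fun φ => congrArg (fun f => f φ) hr⟩

theorem contDiffOn_alt {F : Type*} [NormedAddCommGroup F] [NormedSpace ℝ F] {k : ℕ} {m : ℕ∞ω}
    {α : F → Alt n k} {s : Set F}
    (h : ∀ I : Fin k → Fin n, ContDiffOn ℝ m (fun x => α x (basisTuple I)) s) :
    ContDiffOn ℝ m α s := by
  obtain ⟨r, hr⟩ := exists_components_leftInverse n k
  have h1 : ContDiffOn ℝ m (fun x => components n k (α x)) s := contDiffOn_pi.2 h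
  have h2 := r.contDiff.comp_contDiffOn h1
  refine h2.congr fun x _ => ?_
  exact (hr _).symm

/-- A vector is encoded as the linear map `ℝ → E n` that it spans. Evaluation then becomes pull-back
along a tuple of linear maps, which is multilinear in the tuple and therefore smooth. -/
theorem contDiffOn_alt_apply {F : Type*} [NormedAddCommGroup F] [NormedSpace ℝ F] {k : ℕ}
    {m : ℕ∞ω} {α : F → Alt n k} {v : Fin k → F → E n} {s : Set F} (hα : ContDiffOn ℝ m α s)
    (hv : ∀ i, ContDiffOn ℝ m (v i) s) : ContDiffOn ℝ m (fun x => α x (fun i => v i x)) s := by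
  have h1 : ContDiffOn ℝ m (fun x =>
      ContinuousMultilinearMap.compContinuousLinearMapContinuousMultilinear
      ℝ (fun _ : Fin k => ℝ) (fun _ => E n) ℝ
      (fun i => ContinuousLinearMap.toSpanSingleton ℝ (v i x))) s := by
    refine ContinuousMultilinearMap.contDiff _ |>.comp_contDiffOn ?_
    refine contDiffOn_pi.2 fun i => ?_
    exact (ContinuousLinearMap.toSpanSingletonCLE (𝕜 := ℝ) (E := E n)).contDiff.comp_contDiffOn
      (hv i)
  have h2 : ContDiffOn ℝ m (fun x => (α x).toContinuousMultilinearMap) s :=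
    (ContinuousAlternatingMap.toContinuousMultilinearMapCLM ℝ (𝕜 := ℝ) (E := E n) (F := ℝ)
      (ι := Fin k)).contDiff.comp_contDiffOn hα
  have h3 := (h1.clm_apply h2)
  have h4 := (ContinuousMultilinearMap.apply ℝ (fun _ : Fin k => ℝ) ℝ (fun _ => 1)).contDiff.comp_contDiffOn
    h3
  refine h4.congr fun x _ => ?_
  simp [Function.comp]

theorem contDiffOn_alt_comp {F : Type*} [NormedAddCommGroup F] [NormedSpace ℝ F] {k p : ℕ}
    {m : ℕ∞ω} {α : F → Alt n k} {g : F → (E p →L[ℝ] E n)} {s : Set F} (hα : ContDiffOn ℝ m α s)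
    (hg : ContDiffOn ℝ m g s) :
    ContDiffOn ℝ m (fun x => (α x).compContinuousLinearMap (g x)) s :=
  contDiffOn_alt fun I => contDiffOn_alt_apply (v := fun i x => g x (basisTuple I i)) hα
    fun _ => hg.clm_apply contDiffOn_const

theorem alternatingMap_expand {k : ℕ} (f : E n [⋀^Fin k]→ₗ[ℝ] ℝ) (v : Fin k → E n) :
    f v = ∑ I : Fin k → Fin n, (∏ j, v j (I j)) * f (basisTuple I) := by
  have h : v = fun j => ∑ i : Fin n, v j i • EuclideanSpace.single i (1 : ℝ) := by
    funext j
    conv_lhs => rw [← (EuclideanSpace.basisFun (Fin n) ℝ).sum_repr (v j)]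
    simp
  conv_lhs => rw [h]
  have h1 := f.toMultilinearMap.map_sum
    (fun (j : Fin k) (i : Fin n) => v j i • (EuclideanSpace.single i (1 : ℝ) : E n))
  refine h1.trans (Finset.sum_congr rfl fun I _ => ?_)
  exact f.toMultilinearMap.map_smul_univ (fun j => v j (I j)) (basisTuple I)

theorem continuous_alternatingMap {k : ℕ} (f : E n [⋀^Fin k]→ₗ[ℝ] ℝ) : Continuous f := by
  have : (f : (Fin k → E n) → ℝ) =
      fun v => ∑ I : Fin k → Fin n, (∏ j, v j (I j)) * f (basisTuple I) :=
    funext (alternatingMap_expand f)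
  rw [this]
  fun_prop

/-- An alternating map on a finite-dimensional space, as a continuous one. -/
def toAlt {k : ℕ} (f : E n [⋀^Fin k]→ₗ[ℝ] ℝ) : Alt n k :=
  { f with cont := continuous_alternatingMap f }

@[simp]
theorem toAlt_apply {k : ℕ} (f : E n [⋀^Fin k]→ₗ[ℝ] ℝ) (v : Fin k → E n) : toAlt f v = f v := rfl

theorem alternatingMap_comp_top {k : ℕ} (h : k = n) (f : E n [⋀^Fin k]→ₗ[ℝ] ℝ)
    (M : E n →ₗ[ℝ] E n) :
    f.compLinearMap M (basisTuple (Fin.cast h)) =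
      LinearMap.det M * f (basisTuple (Fin.cast h)) := by
  subst h
  have h1 := f.eq_smul_basis_det (EuclideanSpace.basisFun (Fin k) ℝ).toBasis
  have h2 : (basisTuple (Fin.cast rfl) : Fin k → E k) =
      (EuclideanSpace.basisFun (Fin k) ℝ).toBasis := by
    funext i; simp [basisTuple]
  rw [h2]
  rw [AlternatingMap.compLinearMap_apply]
  conv_lhs => rw [h1]
  rw [AlternatingMap.smul_apply, smul_eq_mul, mul_comm]
  congr 1
  have h3 := (EuclideanSpace.basisFun (Fin k) ℝ).toBasis.det_comp M
    (EuclideanSpace.basisFun (Fin k) ℝ).toBasis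
  rwa [Module.Basis.det_self, mul_one] at h3

namespace HomogeneousLieGroup

variable {n : ℕ} (G : HomogeneousLieGroup n)

/-! ### Weight decomposition -/

/-- The weight of a multi-index. -/
def mwt {k : ℕ} (I : Fin k → Fin n) : ℝ := ∑ j, G.wt (I j)

theorem dil_single (s : ℝ) (i : Fin n) :
    G.dil s (EuclideanSpace.single i (1 : ℝ)) =
      Real.exp (s * G.wt i) • EuclideanSpace.single i (1 : ℝ) := by
  ext j
  rw [dil, diagMap_apply]
  by_cases h : j = i
  · subst h; simp
  · simp [h]

theorem dil_basisTuple (s : ℝ) {k : ℕ} (I : Fin k → Fin n) :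
    (fun j => G.dil s (basisTuple I j)) =
      fun j => Real.exp (s * G.wt (I j)) • basisTuple I j := by
  funext j
  exact G.dil_single s (I j)

/-- Pull-back of alternating forms by the dilation `h_s`. -/
def dilPull (k : ℕ) (s : ℝ) : Alt n k →ₗ[ℝ] Alt n k :=
  ContinuousAlternatingMap.compContinuousLinearMapₗ (G.dil s)

@[simp]
theorem dilPull_apply {k : ℕ} (s : ℝ) (φ : Alt n k) :
    G.dilPull k s φ = φ.compContinuousLinearMap (G.dil s) := rfl

theorem exp_sum_wt {k : ℕ} (s : ℝ) (I : Fin k → Fin n) :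
    ∏ j, Real.exp (s * G.wt (I j)) = Real.exp (s * G.mwt I) := by
  rw [← Real.exp_sum, mwt, Finset.mul_sum]

theorem comp_dil_basisTuple {k : ℕ} (s : ℝ) (f : E n [⋀^Fin k]→ₗ[ℝ] ℝ) (I : Fin k → Fin n) :
    f (fun j => G.dil s (basisTuple I j)) = Real.exp (s * G.mwt I) * f (basisTuple I) := by
  rw [dil_basisTuple, ← G.exp_sum_wt]
  exact f.toMultilinearMap.map_smul_univ _ _

theorem dilPull_basisTuple {k : ℕ} (s : ℝ) (φ : Alt n k) (I : Fin k → Fin n) :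
    φ.compContinuousLinearMap (G.dil s) (basisTuple I) =
      Real.exp (s * G.mwt I) * φ (basisTuple I) :=
  G.comp_dil_basisTuple s φ.toAlternatingMap I

/-- Coordinate monomials diagonalize the dilations, so questions about weights become questions
about multi-indices. The single time `s = 1` already separates weights, `exp` being injective. -/
theorem mem_weightSpace_iff {k : ℕ} {w : ℝ} {φ : Alt n k} :
    φ ∈ G.weightSpace k w ↔ ∀ I : Fin k → Fin n, φ (basisTuple I) ≠ 0 → G.mwt I = w := by
  constructor
  · intro h I hI
    have h1 := congrArg (fun f => f (basisTuple I)) (h 1)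
    simp only [dilPull_basisTuple, ContinuousAlternatingMap.smul_apply, smul_eq_mul, one_mul] at h1
    exact Real.exp_injective (mul_right_cancel₀ hI h1)
  · intro h s
    refine Alt.ext_basisTuple fun I => ?_
    rw [dilPull_basisTuple, ContinuousAlternatingMap.smul_apply, smul_eq_mul]
    by_cases hI : φ (basisTuple I) = 0
    · simp [hI]
    · rw [h I hI]

/-- The finitely many weights of multi-indices of length `k`. -/
def weightFinset (k : ℕ) : Finset ℝ := Finset.univ.image fun I : Fin k → Fin n => G.mwt I

theorem mwt_mem_weightFinset {k : ℕ} (I : Fin k → Fin n) : G.mwt I ∈ G.weightFinset k :=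
  Finset.mem_image_of_mem _ (Finset.mem_univ _)

open Classical in
/-- The projection to the forms of weight `w`. -/
def proj (k : ℕ) (w : ℝ) : Alt n k →ₗ[ℝ] Alt n k :=
  if w ∈ G.weightFinset k then
    -- Pull-back by `h_1` has eigenvalue `e^v` on weight `v`; the Lagrange polynomial with these
    -- nodes is `1` at `e^w` and `0` at the others.
    Polynomial.aeval (G.dilPull k 1) (Lagrange.basis (G.weightFinset k) Real.exp w)
  else 0

theorem aeval_dilPull_basisTuple {k : ℕ} (p : Polynomial ℝ) (φ : Alt n k) (I : Fin k → Fin n) :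
    Polynomial.aeval (G.dilPull k 1) p φ (basisTuple I) =
      p.eval (Real.exp (G.mwt I)) * φ (basisTuple I) := by
  induction p using Polynomial.induction_on generalizing φ with
  | C a => simp
  | add p q hp hq => simp [hp, hq, add_mul]
  | monomial m a h =>
    rw [pow_succ, ← _root_.mul_assoc, map_mul, Module.End.mul_apply, h, Polynomial.aeval_X,
      dilPull_apply,
      dilPull_basisTuple]
    simp only [Polynomial.eval_mul, Polynomial.eval_C, Polynomial.eval_pow, Polynomial.eval_X,
      one_mul]
    ring

open Classical in
theorem proj_basisTuple {k : ℕ} (w : ℝ) (φ : Alt n k) (I : Fin k → Fin n) :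
    G.proj k w φ (basisTuple I) = if G.mwt I = w then φ (basisTuple I) else 0 := by
  by_cases hw : w ∈ G.weightFinset k
  · rw [proj, if_pos hw, aeval_dilPull_basisTuple]
    split_ifs with h
    · rw [← h, Lagrange.eval_basis_self Real.exp_injective.injOn (G.mwt_mem_weightFinset I),
        one_mul]
    · rw [Lagrange.eval_basis_of_ne (fun h' => h h'.symm) (G.mwt_mem_weightFinset I),
        MulZeroClass.zero_mul]
  · rw [proj, if_neg hw, if_neg]
    · rfl
    · rintro rfl; exact hw (G.mwt_mem_weightFinset I)

theorem proj_mem {k : ℕ} (w : ℝ) (φ : Alt n k) : G.proj k w φ ∈ G.weightSpace k w := by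
  classical
  rw [mem_weightSpace_iff]
  intro I hI
  rw [proj_basisTuple] at hI
  by_contra h
  simp [h] at hI

theorem proj_of_mem {k : ℕ} {w : ℝ} {φ : Alt n k} (h : φ ∈ G.weightSpace k w) :
    G.proj k w φ = φ := by
  classical
  refine Alt.ext_basisTuple fun I => ?_
  rw [proj_basisTuple]
  rw [mem_weightSpace_iff] at h
  split_ifs with hI
  · rfl
  · by_contra h'
    exact hI (h I (Ne.symm h'))

theorem proj_of_mem_of_ne {k : ℕ} {v w : ℝ} {φ : Alt n k} (h : φ ∈ G.weightSpace k w)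
    (hv : v ≠ w) : G.proj k v φ = 0 := by
  classical
  refine Alt.ext_basisTuple fun I => ?_
  rw [proj_basisTuple]
  rw [mem_weightSpace_iff] at h
  split_ifs with hI
  · by_contra h'
    exact hv (hI.symm.trans (h I h'))
  · rfl

theorem proj_eq_zero_of_notMem {k : ℕ} {w : ℝ} (h : w ∉ G.weightFinset k) : G.proj k w = 0 := by
  rw [proj, if_neg h]

theorem sum_proj {k : ℕ} (φ : Alt n k) : ∑ w ∈ G.weightFinset k, G.proj k w φ = φ := by
  classical
  refine Alt.ext_basisTuple fun I => ?_
  rw [ContinuousAlternatingMap.sum_apply]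
  simp [proj_basisTuple, G.mwt_mem_weightFinset I]

theorem mem_weightSpaceGE_iff {k : ℕ} {w : ℝ} {φ : Alt n k} :
    φ ∈ G.weightSpaceGE k w ↔ ∀ I : Fin k → Fin n, φ (basisTuple I) ≠ 0 → w ≤ G.mwt I := by
  constructor
  · intro h
    induction h using Submodule.iSup_induction' with
    | mem v x hx =>
      intro I hI
      rw [(G.mem_weightSpace_iff.1 hx) I hI]
      exact v.2
    | zero => intro I hI; exact absurd rfl hI
    | add x y _ _ hx hy =>
      intro I hI
      by_cases h : x (basisTuple I) = 0
      · refine hy I fun h' => hI ?_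
        rw [ContinuousAlternatingMap.add_apply, h, h', add_zero]
      · exact hx I h
  · intro h
    rw [← G.sum_proj φ]
    refine Submodule.sum_mem _ fun v _ => ?_
    by_cases hv : w ≤ v
    · exact Submodule.mem_iSup_of_mem (p := fun v : Set.Ici w => G.weightSpace k v) ⟨v, hv⟩
        (G.proj_mem v φ)
    · have : G.proj k v φ = 0 := by
        classical
        refine Alt.ext_basisTuple fun I => ?_
        rw [proj_basisTuple]
        split_ifs with hI
        · by_contra h'
          exact hv (hI ▸ h I h')
        · rfl
      rw [this]
      exact Submodule.zero_mem _

theorem weightSpace_le_weightSpaceGE {k : ℕ} {v w : ℝ} (h : w ≤ v) :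
    G.weightSpace k v ≤ G.weightSpaceGE k w := fun _ hφ =>
  G.mem_weightSpaceGE_iff.2 fun I hI => h.trans_eq (G.mem_weightSpace_iff.1 hφ I hI).symm

theorem weightSpaceGE_antitone {k : ℕ} {v w : ℝ} (h : w ≤ v) :
    G.weightSpaceGE k v ≤ G.weightSpaceGE k w := fun _ hφ =>
  G.mem_weightSpaceGE_iff.2 fun I hI => h.trans (G.mem_weightSpaceGE_iff.1 hφ I hI)

theorem proj_eq_zero_of_mem_GE {k : ℕ} {v w : ℝ} {φ : Alt n k} (h : φ ∈ G.weightSpaceGE k w)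
    (hv : v < w) : G.proj k v φ = 0 := by
  classical
  refine Alt.ext_basisTuple fun I => ?_
  rw [proj_basisTuple]
  split_ifs with hI
  · by_contra h'
    exact absurd (G.mem_weightSpaceGE_iff.1 h I h') (by rw [hI]; exact not_le.2 hv)
  · rfl

theorem mem_weightSpaceGE_of_proj {k : ℕ} {w : ℝ} {φ : Alt n k}
    (h : ∀ v < w, G.proj k v φ = 0) : φ ∈ G.weightSpaceGE k w := by
  classical
  rw [mem_weightSpaceGE_iff]
  intro I hI
  by_contra hw
  have h1 := congrArg (fun f => f (basisTuple I)) (h _ (not_le.1 hw))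
  simp only [proj_basisTuple, if_true] at h1
  exact hI h1

/-- Linear maps commuting with the dilations commute with the weight projections. -/
theorem proj_comm {k l : ℕ} (f : Alt n k →ₗ[ℝ] Alt n l)
    (hf : ∀ (s : ℝ) (φ : Alt n k), f (φ.compContinuousLinearMap (G.dil s)) =
      (f φ).compContinuousLinearMap (G.dil s)) (w : ℝ) (φ : Alt n k) :
    f (G.proj k w φ) = G.proj l w (f φ) := by
  have key : ∀ (v : ℝ) {ψ : Alt n k}, ψ ∈ G.weightSpace k v → f ψ ∈ G.weightSpace l v := by
    intro v ψ hψ s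
    rw [← hf, hψ s, map_smul]
  conv_rhs => rw [← G.sum_proj φ, map_sum, map_sum]
  by_cases hw : w ∈ G.weightFinset k
  · rw [Finset.sum_eq_single w]
    · exact (G.proj_of_mem (key w (G.proj_mem w φ))).symm
    · intro v _ hv
      exact G.proj_of_mem_of_ne (key v (G.proj_mem v φ)) hv.symm
    · exact fun h => absurd hw h
  · rw [G.proj_eq_zero_of_notMem hw, LinearMap.zero_apply, map_zero, Finset.sum_eq_zero]
    intro v hv
    exact G.proj_of_mem_of_ne (key v (G.proj_mem v φ)) fun h => hw (h ▸ hv)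

theorem mem_weights_iff {k : ℕ} {w : ℝ} :
    w ∈ G.weights k ↔ ∃ φ : Alt n k, φ ∈ G.weightSpace k w ∧ φ ≠ 0 :=
  Submodule.ne_bot_iff _

theorem weights_subset_weightFinset (k : ℕ) : G.weights k ⊆ G.weightFinset k := by
  intro w hw
  obtain ⟨φ, hφ, h0⟩ := G.mem_weights_iff.1 hw
  by_contra h
  refine h0 ?_
  rw [← G.proj_of_mem hφ, G.proj_eq_zero_of_notMem h, LinearMap.zero_apply]

theorem finite_weights (k : ℕ) : (G.weights k).Finite :=
  (G.weightFinset k).finite_toSet.subset (G.weights_subset_weightFinset k)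

theorem mem_weights_of_apply_ne_zero {k : ℕ} {φ : Alt n k} {I : Fin k → Fin n}
    (h : φ (basisTuple I) ≠ 0) : G.mwt I ∈ G.weights k := by
  classical
  refine G.mem_weights_iff.2 ⟨G.proj k (G.mwt I) φ, G.proj_mem _ _, fun h0 => h ?_⟩
  have h1 := congrArg (fun f => f (basisTuple I)) h0
  simpa [proj_basisTuple] using! h1

theorem mwt_of_bijective {k : ℕ} {I : Fin k → Fin n} (h : Function.Bijective I) :
    G.mwt I = G.homDim :=
  Function.Bijective.sum_comp h G.wt

theorem injective_of_apply_ne_zero {k : ℕ} {f : E n [⋀^Fin k]→ₗ[ℝ] ℝ} {I : Fin k → Fin n}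
    (h : f (basisTuple I) ≠ 0) : Function.Injective I := by
  by_contra hI
  refine h (f.map_eq_zero_of_not_injective _ fun h' => hI fun i j hij => h' ?_)
  simp [basisTuple, hij]

end HomogeneousLieGroup

namespace HomogeneousLieGroup

variable {n : ℕ} (G : HomogeneousLieGroup n)

theorem minSmoothness_two_le : minSmoothness ℝ 2 ≤ (∞ : ℕ∞ω) := by
  rw [minSmoothness_of_isRCLikeNormedField]
  exact ENat.LEInfty.out

/-! ### Left translations and left-invariant frames -/

theorem inv_mul_cancel_left (x y : E n) : G.mul (G.inv x) (G.mul x y) = y := by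
  rw [← G.mul_assoc, G.inv_mul, G.zero_mul]

theorem mul_inv (x : E n) : G.mul x (G.inv x) = 0 := by
  have h := G.inv_mul_cancel_left (G.inv x) (G.mul x (G.inv x))
  rw [← G.mul_assoc (G.inv x), G.inv_mul, G.zero_mul, G.inv_mul] at h
  exact h.symm

theorem mul_inv_cancel_left (x y : E n) : G.mul x (G.mul (G.inv x) y) = y := by
  rw [← G.mul_assoc, G.mul_inv, G.zero_mul]

theorem contDiff_mul_left (x : E n) : ContDiff ℝ ∞ (G.mul x) :=
  G.contDiff_mul.comp (contDiff_const.prodMk contDiff_id)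

theorem differentiable_mul_left (x : E n) : Differentiable ℝ (G.mul x) :=
  (G.contDiff_mul_left x).differentiable (by simp)

/-- The differential at the neutral element of the left translation by `x`. -/
def leftDiff (x : E n) : E n →L[ℝ] E n := fderiv ℝ (G.mul x) 0

/-- The inverse of `leftDiff`: the differential at `x` of the left translation by `x⁻¹`. -/
def leftDiffInv (x : E n) : E n →L[ℝ] E n := fderiv ℝ (G.mul (G.inv x)) x

theorem leftDiffInv_comp_leftDiff (x : E n) :
    (G.leftDiffInv x).comp (G.leftDiff x) = ContinuousLinearMap.id ℝ (E n) := by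
  have h1 : HasFDerivAt (G.mul (G.inv x)) (G.leftDiffInv x) (G.mul x 0) := by
    rw [G.mul_zero]; exact (G.differentiable_mul_left _ x).hasFDerivAt
  have h2 := h1.comp 0 (G.differentiable_mul_left x 0).hasFDerivAt
  have h3 : G.mul (G.inv x) ∘ G.mul x = id := funext (G.inv_mul_cancel_left x)
  rw [h3] at h2
  exact h2.unique (hasFDerivAt_id 0)

theorem leftDiff_comp_leftDiffInv (x : E n) :
    (G.leftDiff x).comp (G.leftDiffInv x) = ContinuousLinearMap.id ℝ (E n) := by
  have h1 : HasFDerivAt (G.mul x) (G.leftDiff x) (G.mul (G.inv x) x) := by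
    rw [G.inv_mul]; exact (G.differentiable_mul_left _ 0).hasFDerivAt
  have h2 := h1.comp x (G.differentiable_mul_left (G.inv x) x).hasFDerivAt
  have h3 : G.mul x ∘ G.mul (G.inv x) = id := funext (G.mul_inv_cancel_left x)
  rw [h3] at h2
  exact h2.unique (hasFDerivAt_id x)

theorem leftDiff_mul (x y : E n) :
    G.leftDiff (G.mul x y) = (fderiv ℝ (G.mul x) y).comp (G.leftDiff y) := by
  have h1 : HasFDerivAt (G.mul x) (fderiv ℝ (G.mul x) y) (G.mul y 0) := by
    rw [G.mul_zero]; exact (G.differentiable_mul_left _ y).hasFDerivAt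
  have h2 := h1.comp 0 (G.differentiable_mul_left y 0).hasFDerivAt
  have h3 : G.mul x ∘ G.mul y = G.mul (G.mul x y) := funext fun z => (G.mul_assoc x y z).symm
  rw [h3] at h2
  exact h2.fderiv

theorem leftDiff_zero : G.leftDiff 0 = ContinuousLinearMap.id ℝ (E n) := by
  have : G.mul 0 = id := funext G.zero_mul
  rw [leftDiff, this, fderiv_id]

theorem leftDiffInv_zero : G.leftDiffInv 0 = ContinuousLinearMap.id ℝ (E n) := by
  have := G.leftDiffInv_comp_leftDiff 0
  rwa [leftDiff_zero, ContinuousLinearMap.comp_id] at this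

theorem contDiff_leftDiff : ContDiff ℝ ∞ G.leftDiff :=
  ContDiff.fderiv (f := fun x y => G.mul x y) (m := ∞) (n := ∞) G.contDiff_mul contDiff_const
    (by exact right_eq_inf.mp rfl)

theorem contDiff_leftDiffInv : ContDiff ℝ ∞ G.leftDiffInv :=
  ContDiff.fderiv (f := fun x y => G.mul (G.inv x) y) (m := ∞) (n := ∞)
    (G.contDiff_mul.comp ((G.contDiff_inv.comp contDiff_fst).prodMk contDiff_snd)) contDiff_id
    (by exact right_eq_inf.mp rfl)

theorem dil_mul' (s : ℝ) (x y : E n) :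
    G.dil s (G.mul x y) = G.mul (G.dil s x) (G.dil s y) := G.dil_mul s x y

theorem leftDiff_dil (s : ℝ) (x : E n) :
    (G.leftDiff (G.dil s x)).comp (G.dil s) = (G.dil s).comp (G.leftDiff x) := by
  have h1 : HasFDerivAt (G.mul (G.dil s x)) (G.leftDiff (G.dil s x)) (G.dil s 0) := by
    rw [map_zero]; exact (G.differentiable_mul_left _ 0).hasFDerivAt
  have h2 := h1.comp 0 (G.dil s).hasFDerivAt
  have h3 : G.mul (G.dil s x) ∘ G.dil s = G.dil s ∘ G.mul x :=
    funext fun z => (G.dil_mul' s x z).symm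
  rw [h3] at h2
  exact h2.unique ((G.dil s).hasFDerivAt.comp 0 (G.differentiable_mul_left x 0).hasFDerivAt)

theorem leftDiffInv_dil (s : ℝ) (x : E n) :
    (G.leftDiffInv (G.dil s x)).comp (G.dil s) = (G.dil s).comp (G.leftDiffInv x) := by
  calc (G.leftDiffInv (G.dil s x)).comp (G.dil s)
      = (G.leftDiffInv (G.dil s x)).comp ((G.dil s).comp
          ((G.leftDiff x).comp (G.leftDiffInv x))) := by
        rw [leftDiff_comp_leftDiffInv, ContinuousLinearMap.comp_id]
    _ = ((G.leftDiffInv (G.dil s x)).comp ((G.dil s).comp (G.leftDiff x))).comp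
          (G.leftDiffInv x) := rfl
    _ = (((G.leftDiffInv (G.dil s x)).comp (G.leftDiff (G.dil s x))).comp (G.dil s)).comp
          (G.leftDiffInv x) := by rw [← leftDiff_dil]; rfl
    _ = (G.dil s).comp (G.leftDiffInv x) := by
        rw [leftDiffInv_comp_leftDiff, ContinuousLinearMap.id_comp]

/-- The coefficients of a form in the left-invariant frame. -/
def toFrame {k : ℕ} (α : Form n k) (x : E n) : Alt n k :=
  (α x).compContinuousLinearMap (G.leftDiff x)

/-- The form with given coefficients in the left-invariant frame. -/
def ofFrame {k : ℕ} (a : E n → Alt n k) : Form n k :=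
  fun x => (a x).compContinuousLinearMap (G.leftDiffInv x)

theorem comp_comp_alt {k : ℕ} (φ : Alt n k) (f g : E n →L[ℝ] E n) :
    (φ.compContinuousLinearMap f).compContinuousLinearMap g =
      φ.compContinuousLinearMap (f.comp g) := rfl

theorem comp_id_alt {k : ℕ} (φ : Alt n k) :
    φ.compContinuousLinearMap (ContinuousLinearMap.id ℝ (E n)) = φ := rfl

theorem toFrame_ofFrame {k : ℕ} (a : E n → Alt n k) : G.toFrame (G.ofFrame a) = a := by
  funext x
  rw [toFrame, ofFrame, comp_comp_alt, leftDiffInv_comp_leftDiff, comp_id_alt]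

theorem ofFrame_toFrame {k : ℕ} (α : Form n k) : G.ofFrame (G.toFrame α) = α := by
  funext x
  change ((α x).compContinuousLinearMap (G.leftDiff x)).compContinuousLinearMap
    (G.leftDiffInv x) = α x
  rw [comp_comp_alt, leftDiff_comp_leftDiffInv, comp_id_alt]

theorem leftInvariant_eq_ofFrame {k : ℕ} (φ : Alt n k) :
    G.leftInvariant φ = G.ofFrame fun _ => φ := rfl

theorem toFrame_leftInvariant {k : ℕ} (φ : Alt n k) (x : E n) :
    G.toFrame (G.leftInvariant φ) x = φ := congrFun (G.toFrame_ofFrame fun _ => φ) x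

theorem contDiffOn_toFrame {k : ℕ} {α : Form n k} {s : Set (E n)} (h : ContDiffOn ℝ ∞ α s) :
    ContDiffOn ℝ ∞ (G.toFrame α) s := contDiffOn_alt_comp h G.contDiff_leftDiff.contDiffOn

theorem contDiffOn_ofFrame {k : ℕ} {a : E n → Alt n k} {s : Set (E n)}
    (h : ContDiffOn ℝ ∞ a s) : ContDiffOn ℝ ∞ (G.ofFrame a) s :=
  contDiffOn_alt_comp h G.contDiff_leftDiffInv.contDiffOn

theorem contDiffOn_leftInvariant {k : ℕ} (φ : Alt n k) (s : Set (E n)) :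
    ContDiffOn ℝ ∞ (G.leftInvariant φ) s := G.contDiffOn_ofFrame contDiffOn_const

theorem toFrame_differentiableAt {k : ℕ} {α : Form n k} {x : E n} (h : DifferentiableAt ℝ α x) :
    DifferentiableAt ℝ (G.toFrame α) x :=
  h.continuousAlternatingMapCompContinuousLinearMap
    (G.contDiff_leftDiff.differentiable (by simp) x)

/-- The exterior derivative in the left-invariant frame. -/
theorem toFrame_extDeriv {k : ℕ} {α : Form n k} {x : E n} (hα : DifferentiableAt ℝ α x) :
    G.toFrame (extDeriv α) x = G.d₀ k (G.toFrame α x) +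
      ContinuousAlternatingMap.alternatizeUncurryFin
        (fderiv ℝ (fun y => G.toFrame α (G.mul x y)) 0) := by
  have hx : G.mul x 0 = x := G.mul_zero x
  have h1 := extDeriv_pullback (f := G.mul x) (x := 0)
    (show DifferentiableAt ℝ α (G.mul x 0) by rwa [hx])
    (G.contDiff_mul_left x).contDiffAt minSmoothness_two_le
  rw [hx] at h1
  -- Pulling back by the left translation by `x` moves the computation to the origin: the
  -- coefficients are translated and the frame is unchanged. The product rule at `0` then splits
  -- into the derivative of the frame, which is `d₀`, and the derivative of the coefficients.
  have h2 : (fun y => (α (G.mul x y)).compContinuousLinearMap (fderiv ℝ (G.mul x) y)) =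
      fun y => (G.toFrame α (G.mul x y)).compContinuousLinearMap (G.leftDiffInv y) := by
    funext y
    rw [toFrame, leftDiff_mul, comp_comp_alt, ContinuousLinearMap.comp_assoc,
      leftDiff_comp_leftDiffInv, ContinuousLinearMap.comp_id]
  rw [h2] at h1
  have hQ : DifferentiableAt ℝ G.leftDiffInv 0 := G.contDiff_leftDiffInv.differentiable (by simp) 0
  have hA : DifferentiableAt ℝ (fun y => G.toFrame α (G.mul x y)) 0 := by
    refine DifferentiableAt.comp (f := G.mul x) (g := G.toFrame α) 0 ?_
      (G.differentiable_mul_left x 0)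
    rw [hx]; exact G.toFrame_differentiableAt hα
  have h3 := fderiv_continuousAlternatingMapCompContinuousLinearMap hA hQ
  have h4 := fderiv_continuousAlternatingMapCompContinuousLinearMap
    (differentiableAt_const (𝕜 := ℝ) (x := (0 : E n)) (G.toFrame α x)) hQ
  change _ = (extDeriv α x).compContinuousLinearMap (G.leftDiff x) at h1
  rw [toFrame, ← h1, extDeriv, h3]
  change _ = extDeriv (G.leftInvariant (G.toFrame α x)) 0 + _
  have h5 : fderiv ℝ (G.leftInvariant (G.toFrame α x)) 0 = _ := h4
  rw [extDeriv, h5, ← ContinuousAlternatingMap.alternatizeUncurryFin_add]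
  congr 1
  rw [leftDiffInv_zero, hx]
  simp only [fderiv_fun_const, Pi.zero_apply, ContinuousLinearMap.comp_zero, zero_add]
  rw [add_comm]
  congr 1

/-- The Lie algebra differential commutes with dilations. -/
theorem d₀_dil {k : ℕ} (s : ℝ) (φ : Alt n k) :
    G.d₀ k (φ.compContinuousLinearMap (G.dil s)) =
      (G.d₀ k φ).compContinuousLinearMap (G.dil s) := by
  have h1 := extDeriv_pullback (f := G.dil s) (x := 0)
    (G.differentiable_leftInvariant φ _) (G.dil s).contDiff.contDiffAt minSmoothness_two_le
  rw [map_zero, (G.dil s).fderiv] at h1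
  refine Eq.trans ?_ h1
  change extDeriv _ 0 = _
  congr 1
  funext x
  rw [(G.dil s).fderiv, leftInvariant_eq_ofFrame, leftInvariant_eq_ofFrame, ofFrame, ofFrame,
    comp_comp_alt, comp_comp_alt, leftDiffInv_dil]

theorem d₀_proj {k : ℕ} (w : ℝ) (φ : Alt n k) :
    G.d₀ k (G.proj k w φ) = G.proj (k + 1) w (G.d₀ k φ) :=
  G.proj_comm (G.d₀ k) G.d₀_dil w φ

theorem d₀_mem_weightSpace {k : ℕ} {w : ℝ} {φ : Alt n k} (h : φ ∈ G.weightSpace k w) :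
    G.d₀ k φ ∈ G.weightSpace (k + 1) w := by
  rw [← G.proj_of_mem h, d₀_proj]
  exact G.proj_mem _ _

theorem d₀_mem_weightSpaceGE {k : ℕ} {w : ℝ} {φ : Alt n k} (h : φ ∈ G.weightSpaceGE k w) :
    G.d₀ k φ ∈ G.weightSpaceGE (k + 1) w := by
  refine G.mem_weightSpaceGE_of_proj fun v hv => ?_
  rw [← d₀_proj, G.proj_eq_zero_of_mem_GE h hv, map_zero]

/-! ### Weight gain of the exterior derivative beyond its algebraic part -/

/-- The smallest weight of the Lie algebra. -/
def minWt : ℝ := ⨅ i, G.wt i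

theorem minWt_le (i : Fin n) : G.minWt ≤ G.wt i :=
  ciInf_le (Set.finite_range _).bddBelow i

theorem minWt_pos (hn : 0 < n) : 0 < G.minWt := by
  have : Nonempty (Fin n) := ⟨⟨0, hn⟩⟩
  obtain ⟨i, hi⟩ := exists_eq_ciInf_of_finite (f := G.wt)
  rw [minWt, ← hi]
  exact G.wt_pos i

theorem mwt_eq_add_removeNth {k : ℕ} (I : Fin (k + 1) → Fin n) (i : Fin (k + 1)) :
    G.mwt I = G.wt (I i) + G.mwt (i.removeNth I) := by
  rw [mwt, Fin.sum_univ_succAbove _ i]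
  rfl

/-- Each term of the alternatization uses one extra index, and that index has weight at least
`minWt`. -/
theorem alternatizeUncurryFin_mem_weightSpaceGE {k : ℕ} {w : ℝ} {A : E n →L[ℝ] Alt n k}
    (h : ∀ v, A v ∈ G.weightSpaceGE k w) :
    ContinuousAlternatingMap.alternatizeUncurryFin A ∈ G.weightSpaceGE (k + 1) (w + G.minWt) := by
  rw [mem_weightSpaceGE_iff]
  intro I hI
  rw [ContinuousAlternatingMap.alternatizeUncurryFin_apply] at hI
  obtain ⟨i, _, hi⟩ := Finset.exists_ne_zero_of_sum_ne_zero hI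
  have h1 := right_ne_zero_of_smul hi
  have h2 := G.mem_weightSpaceGE_iff.1 (h (basisTuple I i)) (i.removeNth I) h1
  rw [G.mwt_eq_add_removeNth I i]
  linarith [G.minWt_le (I i)]

/-- Every linear functional annihilating `S` is constantly zero along `a`, hence kills the
derivative; in finite dimension these functionals cut out `S`. -/
theorem fderiv_apply_mem {F : Type*} [NormedAddCommGroup F] [NormedSpace ℝ F]
    {V : Type*} [NormedAddCommGroup V] [NormedSpace ℝ V] [FiniteDimensional ℝ V]
    {a : F → V} {x : F} {S : Submodule ℝ V}
    (h : ∀ᶠ y in nhds x, a y ∈ S) (v : F) : fderiv ℝ a x v ∈ S := by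
  by_cases hd : DifferentiableAt ℝ a x
  · rw [← Subspace.dualAnnihilator_dualCoannihilator_eq (W := S), Submodule.mem_dualCoannihilator]
    intro f hf
    have h1 := ((LinearMap.toContinuousLinearMap f).hasFDerivAt.comp x hd.hasFDerivAt)
    have h2 : LinearMap.toContinuousLinearMap f ∘ a =ᶠ[nhds x] fun _ => 0 := by
      filter_upwards [h] with y hy
      exact (Submodule.mem_dualAnnihilator f).1 hf _ hy
    have h3 := (h1.congr_of_eventuallyEq h2.symm).unique (hasFDerivAt_const 0 x)
    exact congrArg (fun g => g v) h3
  · rw [fderiv_zero_of_not_differentiableAt hd]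
    exact S.zero_mem

/-- The exterior derivative of a form of weight at least `w` is given, up to terms of weight at
least `w + min wt`, by the Lie algebra differential. -/
theorem toFrame_extDeriv_sub_mem {k : ℕ} {α : Form n k} {x : E n} {w : ℝ}
    (hα : DifferentiableAt ℝ α x)
    (hw : ∀ᶠ y in nhds x, G.toFrame α y ∈ G.weightSpaceGE k w) :
    G.toFrame (extDeriv α) x - G.d₀ k (G.toFrame α x) ∈
      G.weightSpaceGE (k + 1) (w + G.minWt) := by
  rw [G.toFrame_extDeriv hα, add_sub_cancel_left]
  refine G.alternatizeUncurryFin_mem_weightSpaceGE fun v => ?_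
  refine fderiv_apply_mem ?_ v
  refine (G.differentiable_mul_left x 0).continuousAt.eventually
    (p := fun z => G.toFrame α z ∈ _) ?_
  rwa [G.mul_zero]

end HomogeneousLieGroup

/-! ### Antisymmetrization -/

section AltSum

variable {X ι κ : Type*} [Fintype ι] [DecidableEq ι] [Fintype κ] [DecidableEq κ]

/-- The antisymmetrization of a function of several variables. -/
def altSum (F : (ι → X) → ℝ) (v : ι → X) : ℝ :=
  ∑ σ : Equiv.Perm ι, ((Equiv.Perm.sign σ : ℤ) : ℝ) * F (v ∘ σ)

theorem sign_cast_mul_self (σ : Equiv.Perm ι) :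
    ((Equiv.Perm.sign σ : ℤ) : ℝ) * ((Equiv.Perm.sign σ : ℤ) : ℝ) = 1 := by
  rw [← Int.cast_mul, Int.units_coe_mul_self, Int.cast_one]

theorem altSum_comp_perm (F : (ι → X) → ℝ) (v : ι → X) (ρ : Equiv.Perm ι) :
    altSum F (v ∘ ρ) = ((Equiv.Perm.sign ρ : ℤ) : ℝ) * altSum F v := by
  rw [altSum, altSum, Finset.mul_sum]
  refine Fintype.sum_equiv (Equiv.mulLeft ρ) _ _ fun σ => ?_
  simp only [Equiv.coe_mulLeft, Equiv.Perm.sign_mul, Units.val_mul, Int.cast_mul]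
  rw [← mul_assoc, ← mul_assoc, sign_cast_mul_self, one_mul]
  rfl

theorem altSum_perm_comp (F : (ι → X) → ℝ) (v : ι → X) (ρ : Equiv.Perm ι) :
    altSum (fun w => F (w ∘ ρ)) v = ((Equiv.Perm.sign ρ : ℤ) : ℝ) * altSum F v := by
  rw [altSum, altSum, Finset.mul_sum]
  refine Fintype.sum_equiv (Equiv.mulRight ρ) _ _ fun σ => ?_
  simp only [Equiv.coe_mulRight, Equiv.Perm.sign_mul, Units.val_mul, Int.cast_mul]
  rw [mul_comm ((Equiv.Perm.sign σ : ℤ) : ℝ) ((Equiv.Perm.sign ρ : ℤ) : ℝ),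
    ← mul_assoc, ← mul_assoc, sign_cast_mul_self, one_mul]
  rfl

theorem altSum_reindex (e : ι ≃ κ) (F : (κ → X) → ℝ) (v : κ → X) :
    altSum F v = altSum (fun w : ι → X => F (w ∘ e.symm)) (v ∘ e) := by
  rw [altSum, altSum]
  refine Fintype.sum_equiv e.permCongr.symm _ _ fun σ => ?_
  rw [Equiv.permCongr_symm, Equiv.Perm.sign_permCongr]
  congr 2
  funext j
  simp [Equiv.permCongr_apply]

/-- Up to sign, antisymmetrization does not depend on the labelling of the variables. -/
theorem altSum_relabel {μ : Type*} [Fintype μ] (e : ι ≃ μ) (e' : κ ≃ μ) (g : ι ≃ κ) :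
    ∃ ε : ℝ, ε * ε = 1 ∧ ∀ (F : (ι → X) → ℝ) (u : μ → X),
      altSum (fun w : κ → X => F (w ∘ g)) (u ∘ e') = ε * altSum F (u ∘ e) := by
  refine ⟨((Equiv.Perm.sign ((g.trans e').trans e.symm) : ℤ) : ℝ), sign_cast_mul_self _,
    fun F u => ?_⟩
  rw [altSum_reindex g, ← altSum_comp_perm]
  congr 1
  · funext w; congr 1; funext i; simp
  · funext i; simp

theorem altSum_of_alternating {E' : Type*} [AddCommGroup E'] [Module ℝ E']
    (f : E' [⋀^ι]→ₗ[ℝ] ℝ) (v : ι → E') :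
    altSum f v = (Fintype.card ι).factorial * f v := by
  have : ∀ σ : Equiv.Perm ι, ((Equiv.Perm.sign σ : ℤ) : ℝ) * f (v ∘ σ) = f v := by
    intro σ
    rw [f.map_perm, Units.smul_def, zsmul_eq_mul, ← mul_assoc, sign_cast_mul_self, one_mul]
  rw [altSum, Finset.sum_congr rfl fun σ _ => this σ, Finset.sum_const, Finset.card_univ,
    Fintype.card_perm, nsmul_eq_mul]

theorem altSum_sum {A : Type*} (s : Finset A) (F : A → (ι → X) → ℝ) (v : ι → X) :
    altSum (fun w => ∑ a ∈ s, F a w) v = ∑ a ∈ s, altSum (F a) v := by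
  simp only [altSum, Finset.mul_sum]
  exact Finset.sum_comm

theorem altSum_add (F F' : (ι → X) → ℝ) (v : ι → X) :
    altSum (fun w => F w + F' w) v = altSum F v + altSum F' v := by
  simp only [altSum, mul_add, Finset.sum_add_distrib]

theorem altSum_mul (c : ℝ) (F : (ι → X) → ℝ) (v : ι → X) :
    altSum (fun w => c * F w) v = c * altSum F v := by
  simp only [altSum, Finset.mul_sum, mul_left_comm c]

/-- A permutation of the first block can be absorbed into the outer antisymmetrization, where its
sign cancels, so all inner terms contribute equally. -/
theorem altSum_altSum_inl (f : (ι → X) → ℝ) (g : (κ → X) → ℝ) (v : ι ⊕ κ → X) :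
    altSum (fun w : ι ⊕ κ → X => altSum f (w ∘ Sum.inl) * g (w ∘ Sum.inr)) v =
      (Fintype.card ι).factorial * altSum (fun w => f (w ∘ Sum.inl) * g (w ∘ Sum.inr)) v := by
  have h : ∀ τ : Equiv.Perm ι,
      altSum (fun w : ι ⊕ κ → X =>
        ((Equiv.Perm.sign τ : ℤ) : ℝ) * f (w ∘ Sum.inl ∘ τ) * g (w ∘ Sum.inr)) v =
      altSum (fun w => f (w ∘ Sum.inl) * g (w ∘ Sum.inr)) v := by
    intro τ
    have h1 := altSum_perm_comp (fun w : ι ⊕ κ → X => f (w ∘ Sum.inl) * g (w ∘ Sum.inr)) v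
      (Equiv.Perm.sumCongr τ 1)
    rw [Equiv.Perm.sign_sumCongr, Equiv.Perm.sign_one,
        mul_one] at h1
    simp only [mul_assoc]
    rw [altSum_mul]
    refine Eq.trans (congrArg _ h1) ?_
    rw [← mul_assoc, sign_cast_mul_self, one_mul]
  have h0 : (fun w : ι ⊕ κ → X => altSum f (w ∘ Sum.inl) * g (w ∘ Sum.inr)) =
      fun w => ∑ τ : Equiv.Perm ι,
        ((Equiv.Perm.sign τ : ℤ) : ℝ) * f (w ∘ Sum.inl ∘ τ) * g (w ∘ Sum.inr) := by
    funext w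
    rw [altSum, Finset.sum_mul]
    rfl
  rw [h0, altSum_sum]
  refine (Finset.sum_congr rfl fun τ _ => h τ).trans ?_
  rw [Finset.sum_const, Finset.card_univ, Fintype.card_perm, nsmul_eq_mul]

theorem altSum_altSum_inr (f : (ι → X) → ℝ) (g : (κ → X) → ℝ) (v : ι ⊕ κ → X) :
    altSum (fun w : ι ⊕ κ → X => f (w ∘ Sum.inl) * altSum g (w ∘ Sum.inr)) v =
      (Fintype.card κ).factorial * altSum (fun w => f (w ∘ Sum.inl) * g (w ∘ Sum.inr)) v := by
  rw [altSum_reindex (Equiv.sumComm κ ι), altSum_reindex (Equiv.sumComm κ ι)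
    (fun w => f (w ∘ Sum.inl) * g (w ∘ Sum.inr))]
  have := altSum_altSum_inl g f (v ∘ Equiv.sumComm κ ι)
  simp only [mul_comm (f _)]
  exact this

/-- Expansion along the first argument: permutations are sorted by the image `i` of `0`. The swap of
`0` and `i` leaves the other variables out of order, and `Fin.cycleRange` restores the order, which
turns the sign `-1` of the swap into `(-1)^i`. -/
theorem altSum_fin_succ {m : ℕ} (F : (Fin (m + 1) → X) → ℝ) (v : Fin (m + 1) → X) :
    altSum F v = ∑ i : Fin (m + 1), (-1 : ℝ) ^ (i : ℕ) *
      altSum (fun w : Fin m → X => F (Fin.cons (v i) w)) (i.removeNth v) := by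
  rw [altSum, Finset.univ_perm_fin_succ, ← Finset.univ_product_univ]
  simp only [Finset.sum_map, Equiv.toEmbedding_apply, Finset.sum_product]
  refine Finset.sum_congr rfl fun i _ => ?_
  have hv : ∀ σ : Equiv.Perm (Fin m), v ∘ Equiv.Perm.decomposeFin.symm (i, σ) =
      Fin.cons (v i) (fun j => v (Equiv.swap 0 i (σ j).succ)) := by
    intro σ
    funext j
    refine Fin.cases ?_ (fun j => ?_) j
    · simp
    · simp
  simp only [hv]
  refine Fin.cases ?_ (fun i => ?_) i
  · simp only [Equiv.Perm.decomposeFin.symm_sign, if_true, one_mul, Fin.val_zero, pow_zero,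
      Equiv.swap_self, Equiv.refl_apply, altSum]
    rfl
  · have h1 : (-1 : ℝ) ^ ((i.succ : Fin (m + 1)) : ℕ) =
        -((Equiv.Perm.sign i.cycleRange : ℤ) : ℝ) := by
      rw [Fin.sign_cycleRange, Fin.val_succ, pow_succ]
      simp
    rw [h1, neg_mul, ← altSum_comp_perm, altSum, ← Finset.sum_neg_distrib]
    refine Finset.sum_congr rfl fun σ _ => ?_
    rw [Equiv.Perm.decomposeFin.symm_sign, if_neg (Fin.succ_ne_zero i)]
    have h2 : (fun j => v (Equiv.swap 0 i.succ (σ j).succ)) =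
        ((i.succ.removeNth v) ∘ i.cycleRange) ∘ σ := by
      funext j
      simp only [Function.comp_apply, Fin.removeNth, Fin.succAbove_cycleRange]
    rw [h2]
    simp

end AltSum

/-! ### The wedge product as an antisymmetrization -/

variable {n : ℕ}

/-- Summing over all permutations counts each shuffle `p! q!` times. From here on identities for
`wedge` are proved by manipulating full antisymmetrizations. -/
theorem wedge_eq_altSum {p q : ℕ} (a : Alt n p) (b : Alt n q) (v : Fin (p + q) → E n) :
    (p.factorial * q.factorial : ℝ) * wedge a b v =
      altSum (fun w : Fin p ⊕ Fin q → E n => a (w ∘ Sum.inl) * b (w ∘ Sum.inr))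
        (v ∘ finSumFinEquiv) := by
  have h := MultilinearMap.domCoprod_alternization_eq a.toAlternatingMap b.toAlternatingMap
  have h1 := congrArg (fun f => (LinearMap.mul' ℝ ℝ) (f (v ∘ finSumFinEquiv))) h
  simp only [Fintype.card_fin, AlternatingMap.smul_apply] at h1
  rw [LinearMap.map_smul_of_tower, nsmul_eq_mul] at h1
  have h2 : wedge a b v = (LinearMap.mul' ℝ ℝ)
    ((a.toAlternatingMap.domCoprod b.toAlternatingMap) (v ∘ finSumFinEquiv)) := rfl
  rw [h2]
  push_cast at h1
  rw [← h1, MultilinearMap.alternatization_apply, map_sum, altSum]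
  refine Finset.sum_congr rfl fun σ _ => ?_
  rw [Units.smul_def, map_zsmul, zsmul_eq_mul]
  rfl

theorem factorial_mul_ne_zero (p q : ℕ) : (p.factorial * q.factorial : ℝ) ≠ 0 :=
  mul_ne_zero (Nat.cast_ne_zero.2 p.factorial_ne_zero) (Nat.cast_ne_zero.2 q.factorial_ne_zero)

theorem wedge_add_left {p q : ℕ} (a a' : Alt n p) (b : Alt n q) (v : Fin (p + q) → E n) :
    wedge (a + a') b v = wedge a b v + wedge a' b v := by
  refine mul_left_cancel₀ (factorial_mul_ne_zero p q) ?_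
  rw [mul_add, wedge_eq_altSum, wedge_eq_altSum, wedge_eq_altSum, ← altSum_add]
  simp only [ContinuousAlternatingMap.add_apply, add_mul]

theorem wedge_add_right {p q : ℕ} (a : Alt n p) (b b' : Alt n q) (v : Fin (p + q) → E n) :
    wedge a (b + b') v = wedge a b v + wedge a b' v := by
  refine mul_left_cancel₀ (factorial_mul_ne_zero p q) ?_
  rw [mul_add, wedge_eq_altSum, wedge_eq_altSum, wedge_eq_altSum, ← altSum_add]
  simp only [ContinuousAlternatingMap.add_apply, mul_add]

theorem wedge_smul_left {p q : ℕ} (c : ℝ) (a : Alt n p) (b : Alt n q) (v : Fin (p + q) → E n) :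
    wedge (c • a) b v = c * wedge a b v := by
  refine mul_left_cancel₀ (factorial_mul_ne_zero p q) ?_
  rw [mul_left_comm, wedge_eq_altSum, wedge_eq_altSum, ← altSum_mul]
  simp only [ContinuousAlternatingMap.smul_apply, smul_eq_mul, mul_assoc]

theorem wedge_smul_right {p q : ℕ} (c : ℝ) (a : Alt n p) (b : Alt n q) (v : Fin (p + q) → E n) :
    wedge a (c • b) v = c * wedge a b v := by
  refine mul_left_cancel₀ (factorial_mul_ne_zero p q) ?_
  rw [mul_left_comm, wedge_eq_altSum, wedge_eq_altSum, ← altSum_mul]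
  simp only [ContinuousAlternatingMap.smul_apply, smul_eq_mul, mul_left_comm c]

theorem wedge_comp {p q : ℕ} (a : Alt n p) (b : Alt n q) (M : E n →L[ℝ] E n)
    (v : Fin (p + q) → E n) :
    wedge (a.compContinuousLinearMap M) (b.compContinuousLinearMap M) v =
      wedge a b (fun i => M (v i)) := by
  refine mul_left_cancel₀ (factorial_mul_ne_zero p q) ?_
  rw [wedge_eq_altSum, wedge_eq_altSum]
  rfl

/-- The value of the top-degree form `a ∧ b` on the standard basis, as a bilinear map. -/
def topWedge {p q : ℕ} (h : p + q = n) : Alt n p →ₗ[ℝ] Alt n q →ₗ[ℝ] ℝ :=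
  LinearMap.mk₂ ℝ (fun a b => wedge a b (basisTuple (Fin.cast h)))
    (fun _ _ _ => wedge_add_left _ _ _ _) (fun _ _ _ => wedge_smul_left _ _ _ _)
    (fun _ _ _ => wedge_add_right _ _ _ _) (fun _ _ _ => wedge_smul_right _ _ _ _)

theorem topWedge_apply {p q : ℕ} (h : p + q = n) (a : Alt n p) (b : Alt n q) :
    topWedge h a b = wedge a b (basisTuple (Fin.cast h)) := rfl

theorem topWedge_comp {p q : ℕ} (h : p + q = n) (a : Alt n p) (b : Alt n q)
    (M : E n →L[ℝ] E n) :
    topWedge h (a.compContinuousLinearMap M) (b.compContinuousLinearMap M) =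
      LinearMap.det (M : E n →ₗ[ℝ] E n) * topWedge h a b := by
  rw [topWedge_apply, topWedge_apply, wedge_comp, ← alternatingMap_comp_top]
  rfl

/-- The standard labelling of the coordinates by the arguments of two forms. -/
def splitEquiv {p q : ℕ} (h : p + q = n) : Fin p ⊕ Fin q ≃ Fin n :=
  finSumFinEquiv.trans (finCongr h)

theorem topWedge_eq_altSum {p q : ℕ} (h : p + q = n) (a : Alt n p) (b : Alt n q) :
    (p.factorial * q.factorial : ℝ) * topWedge h a b =
      altSum (fun w : Fin p ⊕ Fin q → E n => a (w ∘ Sum.inl) * b (w ∘ Sum.inr))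
        ((basisTuple id : Fin n → E n) ∘ splitEquiv h) := by
  rw [topWedge_apply, wedge_eq_altSum]
  rfl

variable {n : ℕ}

/-! ### Nondegeneracy of the wedge pairing -/

/-- A bijection extending an injective multi-index. -/
theorem exists_equiv_extending {p q : ℕ} (h : p + q = n) {I : Fin p → Fin n}
    (hI : Function.Injective I) : ∃ e : Fin p ⊕ Fin q ≃ Fin n, ∀ i, e (Sum.inl i) = I i := by
  classical
  have hc : Fintype.card (Fin q) = Fintype.card ((Set.range I)ᶜ : Set (Fin n)) := by
    rw [Fintype.card_compl_set, Fintype.card_fin, Fintype.card_fin, Set.card_range_of_injective hI,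
      Fintype.card_fin]
    omega
  refine ⟨((Equiv.ofInjective I hI).sumCongr (Fintype.equivOfCardEq hc)).trans
    (Equiv.Set.sumCompl (Set.range I)), fun i => ?_⟩
  simp

/-- The monomial form `dx_{J 0} ∧ … ∧ dx_{J (q-1)}`. -/
def coordForm {q : ℕ} (J : Fin q → Fin n) : Alt n q :=
  toAlt (MultilinearMap.alternatization
    ((MultilinearMap.mkPiAlgebra ℝ (Fin q) ℝ).compLinearMap
      fun j => (EuclideanSpace.proj (J j) : E n →L[ℝ] ℝ).toLinearMap))

theorem coordForm_apply {q : ℕ} (J : Fin q → Fin n) (v : Fin q → E n) :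
    coordForm J v = altSum (fun w : Fin q → E n => ∏ j, w j (J j)) v := by
  rw [coordForm, toAlt_apply, MultilinearMap.alternatization_apply, altSum]
  refine Finset.sum_congr rfl fun σ _ => ?_
  rw [Units.smul_def, zsmul_eq_mul]
  simp

/-- If `a` has a nonzero component on the indices `I`, its product with the monomial in the
complementary indices isolates that component. -/
theorem exists_topWedge_ne_zero {p q : ℕ} (h : p + q = n) {a : Alt n p} (ha : a ≠ 0) :
    ∃ b : Alt n q, topWedge h a b ≠ 0 := by
  classical
  obtain ⟨I, hI⟩ : ∃ I : Fin p → Fin n, a (basisTuple I) ≠ 0 := by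
    by_contra! hc
    exact ha (Alt.ext_basisTuple hc)
  obtain ⟨e, he⟩ := exists_equiv_extending h
    (HomogeneousLieGroup.injective_of_apply_ne_zero (f := a.toAlternatingMap) hI)
  refine ⟨coordForm fun j => e (Sum.inr j), fun h0 => ?_⟩
  have h1 := topWedge_eq_altSum h a (coordForm fun j => e (Sum.inr j))
  simp only [coordForm_apply] at h1
  rw [h0, mul_zero, altSum_altSum_inr a (fun w : Fin q → E n => ∏ j, w j (e (Sum.inr j))),
    eq_comm, mul_eq_zero] at h1
  have h2 := h1.resolve_left (Nat.cast_ne_zero.2 (Nat.factorial_ne_zero _))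
  obtain ⟨ε, hε, h3⟩ := altSum_relabel (X := E n) e (splitEquiv h) (Equiv.refl _)
  replace h3 := h3
    (fun w : Fin p ⊕ Fin q → E n => a (w ∘ Sum.inl) * ∏ j, (w ∘ Sum.inr) j (e (Sum.inr j)))
    (basisTuple id)
  have h4 := mul_eq_zero.1 (h3.symm.trans h2)
  replace h4 := h4.resolve_left (by rintro rfl; simp at hε)
  rw [altSum] at h4
  -- The product of coordinates forces `σ` to fix the second block pointwise. Then `σ` permutes only
  -- the first block and its sign cancels the one produced by `a`, so all surviving terms are equal
  -- and cannot cancel.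
  have h5 : ∀ σ : Equiv.Perm (Fin p ⊕ Fin q), ((Equiv.Perm.sign σ : ℤ) : ℝ) *
      (a (((basisTuple id ∘ e) ∘ σ) ∘ Sum.inl) *
        ∏ j, (((basisTuple id ∘ e) ∘ σ) ∘ Sum.inr) j (e (Sum.inr j))) =
      if ∀ j, σ (Sum.inr j) = Sum.inr j then a (basisTuple I) else 0 := by
    intro σ
    split_ifs with hσ
    · have hr : σ ∈ (Equiv.Perm.sumCongrHom (Fin p) (Fin q)).range := by
        refine Equiv.Perm.mem_sumCongrHom_range_of_perm_mapsTo_inl ?_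
        rintro _ ⟨i, rfl⟩
        rcases hx : σ (Sum.inl i) with i' | j
        · exact ⟨i', rfl⟩
        · exact absurd (σ.injective (hx.trans (hσ j).symm)) (by simp)
      obtain ⟨⟨τ, τ'⟩, rfl⟩ := hr
      have hτ' : τ' = 1 := by
        ext j
        have := hσ j
        simp only [Equiv.Perm.sumCongrHom_apply, Equiv.Perm.sumCongr_apply, Sum.map_inr,
          Sum.inr.injEq] at this
        rw [this]; rfl
      subst hτ'
      have hp : (((basisTuple id ∘ e) ∘ (Equiv.Perm.sumCongrHom (Fin p) (Fin q)) (τ, 1)) ∘ Sum.inl)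
          = basisTuple I ∘ τ := by
        funext i
        simp [basisTuple, he]
      have hprod : ∏ j, (((basisTuple id ∘ e) ∘ (Equiv.Perm.sumCongrHom (Fin p) (Fin q)) (τ, 1)) ∘
          Sum.inr) j (e (Sum.inr j)) = (1 : ℝ) := by
        refine Finset.prod_eq_one fun j _ => ?_
        simp [basisTuple]
      have ha : a (basisTuple I ∘ τ) = Equiv.Perm.sign τ • a (basisTuple I) :=
        a.toAlternatingMap.map_perm _ _
      rw [hp, hprod, mul_one, ha, Units.smul_def, zsmul_eq_mul, ← mul_assoc]
      simp only [Equiv.Perm.sumCongrHom_apply, Equiv.Perm.sign_sumCongr, Equiv.Perm.sign_one,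
        mul_one]
      rw [sign_cast_mul_self, one_mul]
    · push Not at hσ
      obtain ⟨j, hj⟩ := hσ
      rw [Finset.prod_eq_zero (Finset.mem_univ j), mul_zero, mul_zero]
      simp only [basisTuple, Function.comp_apply, id]
      rw [PiLp.single_apply, if_neg]
      intro h'
      exact hj (e.injective h').symm
  rw [Finset.sum_congr rfl fun σ _ => h5 σ, ← Finset.sum_filter, Finset.sum_const, nsmul_eq_mul,
    mul_eq_zero] at h4
  refine h4.elim (fun h6 => ?_) hI
  rw [Nat.cast_eq_zero, Finset.card_eq_zero] at h6
  have : (1 : Equiv.Perm (Fin p ⊕ Fin q)) ∈ (∅ : Finset (Equiv.Perm (Fin p ⊕ Fin q))) := by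
    rw [← h6]; simp
  simp at this

theorem topWedge_injective {p q : ℕ} (h : p + q = n) :
    Function.Injective (topWedge h : Alt n p →ₗ[ℝ] Alt n q →ₗ[ℝ] ℝ) := by
  rw [injective_iff_map_eq_zero]
  intro a ha
  by_contra h0
  obtain ⟨b, hb⟩ := exists_topWedge_ne_zero h h0
  exact hb (by rw [ha]; rfl)

/-- Injectivity for `(p, q)` and for `(q, p)` bounds each dimension by the other, so an injective
map between spaces of equal dimension is obtained. -/
theorem topWedge_surjective {p q : ℕ} (h : p + q = n) :
    Function.Surjective (topWedge h : Alt n p →ₗ[ℝ] Alt n q →ₗ[ℝ] ℝ) := by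
  have h1 := LinearMap.finrank_le_finrank_of_injective (topWedge_injective h)
  have h2 := LinearMap.finrank_le_finrank_of_injective (topWedge_injective (p := q) (q := p)
    (by omega : q + p = n))
  have hd : ∀ k, Module.finrank ℝ (Alt n k →ₗ[ℝ] ℝ) = Module.finrank ℝ (Alt n k) :=
    fun k => Subspace.dual_finrank_eq
  rw [hd] at h1 h2
  refine (LinearMap.injective_iff_surjective_of_finrank_eq_finrank ?_).1 (topWedge_injective h)
  rw [hd]
  exact le_antisymm h1 h2

namespace HomogeneousLieGroup

variable (G : HomogeneousLieGroup n)

/-! ### Weights and the wedge pairing -/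

/-- In each term of the antisymmetrization the arguments of `a` and `b` partition the coordinates,
so their weights add up to exactly `T`. -/
theorem topWedge_eq_zero_of_GE {p q : ℕ} (h : p + q = n) {a : Alt n p} {b : Alt n q} {v w : ℝ}
    (ha : a ∈ G.weightSpaceGE p v) (hb : b ∈ G.weightSpaceGE q w) (hvw : G.homDim < v + w) :
    topWedge h a b = 0 := by
  refine (mul_eq_zero.1 ?_).resolve_left (factorial_mul_ne_zero p q)
  rw [topWedge_eq_altSum, altSum]
  refine Finset.sum_eq_zero fun σ _ => ?_
  rw [mul_eq_zero]
  right
  by_contra h0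
  rw [mul_eq_zero, not_or] at h0
  let f : Fin p ⊕ Fin q ≃ Fin n := σ.trans (splitEquiv h)
  have h1 := G.mem_weightSpaceGE_iff.1 ha (fun i => f (Sum.inl i)) h0.1
  have h2 := G.mem_weightSpaceGE_iff.1 hb (fun i => f (Sum.inr i)) h0.2
  have h3 : G.mwt (fun i => f (Sum.inl i)) + G.mwt (fun i => f (Sum.inr i)) = G.homDim := by
    rw [mwt, mwt, homDim, ← Fintype.sum_sum_type (fun x => G.wt (f x))]
    exact f.sum_comp G.wt
  linarith

theorem det_dil (s : ℝ) : LinearMap.det (G.dil s : E n →ₗ[ℝ] E n) = Real.exp (s * G.homDim) := by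
  have h1 := alternatingMap_comp_top (k := n) rfl
    ((EuclideanSpace.basisFun (Fin n) ℝ).toBasis.det) (G.dil s : E n →ₗ[ℝ] E n)
  have h2 := G.comp_dil_basisTuple s ((EuclideanSpace.basisFun (Fin n) ℝ).toBasis.det)
    (Fin.cast rfl)
  have h3 : (basisTuple (Fin.cast rfl) : Fin n → E n) =
      (EuclideanSpace.basisFun (Fin n) ℝ).toBasis := by
    funext i; simp [basisTuple]
  have h4 : G.mwt (Fin.cast rfl : Fin n → Fin n) = G.homDim := rfl
  rw [h3, Module.Basis.det_self, h4, mul_one] at h2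
  rw [h3, Module.Basis.det_self, mul_one] at h1
  rw [← h1, ← h2]
  rfl

/-- Under `h_1` the product scales by `e^{v+w}` as a product and by the determinant `e^T` as a top
form. -/
theorem topWedge_of_weights {p q : ℕ} (h : p + q = n) {a : Alt n p} {b : Alt n q} {v w : ℝ}
    (ha : a ∈ G.weightSpace p v) (hb : b ∈ G.weightSpace q w) (hvw : v + w ≠ G.homDim) :
    topWedge h a b = 0 := by
  have h1 := topWedge_comp h a b (G.dil 1)
  rw [ha 1, hb 1, det_dil, map_smul, map_smul, LinearMap.smul_apply, smul_eq_mul, smul_eq_mul,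
    ← _root_.mul_assoc, ← Real.exp_add] at h1
  by_contra h0
  have h2 := Real.exp_injective (mul_right_cancel₀ h0 h1)
  exact hvw (by linarith)

theorem topWedge_proj {p q : ℕ} (h : p + q = n) {a : Alt n p} {v : ℝ}
    (ha : a ∈ G.weightSpace p v) (b : Alt n q) :
    topWedge h a (G.proj q (G.homDim - v) b) = topWedge h a b := by
  conv_rhs => rw [← G.sum_proj b, map_sum]
  by_cases hw : G.homDim - v ∈ G.weightFinset q
  · rw [Finset.sum_eq_single _ _ fun h' => absurd hw h']
    intro w _ hne
    exact G.topWedge_of_weights h ha (G.proj_mem w b) fun h' => hne (by linarith)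
  · rw [G.proj_eq_zero_of_notMem hw, LinearMap.zero_apply, map_zero, Finset.sum_eq_zero]
    intro w hw'
    refine G.topWedge_of_weights h ha (G.proj_mem w b) fun h' => hw ?_
    rwa [show G.homDim - v = w by linarith]

/-! ### The Lie algebra differential and the wedge pairing -/

/-- The covariant part of the Lie algebra differential. -/
def d₀Aux {k : ℕ} (φ : Alt n k) : E n →L[ℝ] Alt n k :=
  (φ.fderivCompContinuousLinearMap (ContinuousLinearMap.id ℝ (E n))).comp
    (fderiv ℝ G.leftDiffInv 0)

theorem d₀_eq {k : ℕ} (φ : Alt n k) :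
    G.d₀ k φ = ContinuousAlternatingMap.alternatizeUncurryFin (G.d₀Aux φ) := by
  have hQ : DifferentiableAt ℝ G.leftDiffInv 0 := G.contDiff_leftDiffInv.differentiable (by simp) 0
  have h4 := fderiv_continuousAlternatingMapCompContinuousLinearMap
    (differentiableAt_const (𝕜 := ℝ) (x := (0 : E n)) φ) hQ
  change extDeriv (G.leftInvariant φ) 0 = _
  have h5 : fderiv ℝ (G.leftInvariant φ) 0 = _ := h4
  rw [extDeriv, h5, leftDiffInv_zero]
  simp only [fderiv_fun_const, Pi.zero_apply, ContinuousLinearMap.comp_zero, zero_add]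
  rfl

theorem d₀Aux_apply {k : ℕ} (φ : Alt n k) (x : E n) (v : Fin k → E n) :
    G.d₀Aux φ x v = ∑ j, φ (Function.update v j (fderiv ℝ G.leftDiffInv 0 x (v j))) := by
  rw [d₀Aux, ContinuousLinearMap.comp_apply,
    ContinuousAlternatingMap.fderivCompContinuousLinearMap_apply]
  refine Finset.sum_congr rfl fun j _ => ?_
  congr 1
  funext i
  by_cases h : i = j
  · subst h; simp
  · simp [h]

/-- `d₀Aux · x` replaces one argument at a time by its image under a fixed endomorphism, hence acts
as a derivation: the replaced argument belongs to either `a` or `b`. -/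
theorem d₀Aux_wedge {p q : ℕ} (a : Alt n p) (b : Alt n q) (x : E n) (v : Fin (p + q) → E n) :
    G.d₀Aux (toAlt (wedge a b)) x v =
      wedge (G.d₀Aux a x) b v + wedge a (G.d₀Aux b x) v := by
  refine mul_left_cancel₀ (factorial_mul_ne_zero p q) ?_
  rw [mul_add, wedge_eq_altSum, wedge_eq_altSum, d₀Aux_apply, Finset.mul_sum, ← altSum_add]
  set M := fderiv ℝ G.leftDiffInv 0 x
  simp only [toAlt_apply, wedge_eq_altSum]
  set F := fun w : Fin p ⊕ Fin q → E n => a (w ∘ Sum.inl) * b (w ∘ Sum.inr) with hF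
  have h1 : (fun w : Fin p ⊕ Fin q → E n => (G.d₀Aux a x) (w ∘ Sum.inl) * b (w ∘ Sum.inr) +
      a (w ∘ Sum.inl) * (G.d₀Aux b x) (w ∘ Sum.inr)) =
      fun w => ∑ j, F (Function.update w j (M (w j))) := by
    funext w
    rw [Fintype.sum_sum_type, d₀Aux_apply, d₀Aux_apply, Finset.sum_mul, Finset.mul_sum]
    simp only [hF, Function.comp_apply]
    congr 1
    · refine Finset.sum_congr rfl fun j _ => ?_
      rw [Function.update_comp_eq_of_injective _ Sum.inl_injective]
      congr 2
    · refine Finset.sum_congr rfl fun j _ => ?_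
      rw [Function.update_comp_eq_of_injective _ Sum.inr_injective]
      congr 2
  rw [h1, ← finSumFinEquiv.sum_comp]
  simp only [altSum, Finset.mul_sum]
  rw [Finset.sum_comm]
  refine Finset.sum_congr rfl fun σ _ => ?_
  rw [← Equiv.sum_comp σ]
  refine Finset.sum_congr rfl fun j _ => ?_
  congr 2
  rw [Function.update_comp_eq_of_injective _ finSumFinEquiv.injective,
    Function.update_comp_eq_of_injective _ σ.injective]
  rfl

/-- Unimodularity, forced by the weights: `d₀` preserves weight, top forms have weight `T`, and
forms of degree `n - 1` have weights `T - d_i < T`. -/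
theorem d₀_eq_zero_of_corank_one {r : ℕ} (h : r + 1 = n) (c : Alt n r) : G.d₀ r c = 0 := by
  have hT : ∀ {w : ℝ} {φ : Alt n (r + 1)}, φ ∈ G.weightSpace (r + 1) w → φ ≠ 0 → w = G.homDim := by
    intro w φ hφ h0
    by_contra hw
    refine h0 (Alt.ext_basisTuple fun I => ?_)
    by_contra hI
    rw [← G.mem_weightSpace_iff.1 hφ I hI] at hw
    refine hw (G.mwt_of_bijective ((Fintype.bijective_iff_injective_and_card I).2
      ⟨injective_of_apply_ne_zero (f := φ.toAlternatingMap) hI, by simp [h]⟩))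
  rw [← G.sum_proj c, map_sum]
  refine Finset.sum_eq_zero fun w _ => ?_
  by_contra h0
  have hw := hT (G.d₀_mem_weightSpace (G.proj_mem w c)) h0
  refine h0 ?_
  have hc : G.proj r w c = 0 := by
    refine Alt.ext_basisTuple fun I => ?_
    by_contra hI
    have h1 := G.mem_weightSpace_iff.1 (G.proj_mem w c) I hI
    obtain ⟨e, he⟩ := exists_equiv_extending (q := 1) h
      (injective_of_apply_ne_zero (f := (G.proj r w c).toAlternatingMap) hI)
    have h2 : G.homDim = G.mwt I + G.wt (e (Sum.inr 0)) := by
      rw [homDim, ← e.sum_comp, Fintype.sum_sum_type]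
      simp [he, mwt]
    linarith [G.wt_pos (e (Sum.inr 0))]
  rw [hc, map_zero]

theorem factorial_smul_alternatizeUncurryFin {k : ℕ} (A : E n →L[ℝ] Alt n k)
    (v : Fin (k + 1) → E n) :
    (k.factorial : ℝ) * ContinuousAlternatingMap.alternatizeUncurryFin A v =
      altSum (fun w : Fin (k + 1) → E n => A (w 0) (fun j => w j.succ)) v := by
  rw [altSum_fin_succ, ContinuousAlternatingMap.alternatizeUncurryFin_apply, Finset.mul_sum]
  refine Finset.sum_congr rfl fun i _ => ?_
  have := altSum_of_alternating (A (v i)).toAlternatingMap (i.removeNth v)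
  rw [Fintype.card_fin] at this
  simp only [Fin.cons_zero, Fin.cons_succ]
  rw [show altSum (fun w : Fin k → E n => (A (v i)) fun j => w j) (i.removeNth v) = _ from this,
    zsmul_eq_mul, mul_left_comm]
  simp

theorem topWedge_alternatizeUncurryFin_left {p q : ℕ} (h : p + 1 + q = n) (A : E n →L[ℝ] Alt n p)
    (b : Alt n q) :
    (p.factorial * q.factorial : ℝ) *
        topWedge h (ContinuousAlternatingMap.alternatizeUncurryFin A) b =
      altSum (fun w : Fin (p + 1) ⊕ Fin q → E n =>
        A (w (Sum.inl 0)) (fun j => w (Sum.inl j.succ)) * b (w ∘ Sum.inr))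
        ((basisTuple id : Fin n → E n) ∘ splitEquiv h) := by
  have h1 := topWedge_eq_altSum h (ContinuousAlternatingMap.alternatizeUncurryFin A) b
  have h2 := altSum_altSum_inl (fun w : Fin (p + 1) → E n => A (w 0) (fun j => w j.succ))
    (fun w : Fin q → E n => b w) ((basisTuple id : Fin n → E n) ∘ splitEquiv h)
  simp only [← factorial_smul_alternatizeUncurryFin, _root_.mul_assoc] at h2
  rw [altSum_mul, ← h1, Fintype.card_fin] at h2
  have h3 : ((p + 1).factorial : ℝ) ≠ 0 := Nat.cast_ne_zero.2 (Nat.factorial_ne_zero _)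
  refine mul_left_cancel₀ h3 (Eq.trans ?_ h2)
  ring

theorem topWedge_alternatizeUncurryFin_right {p q : ℕ} (h : p + (q + 1) = n) (a : Alt n p)
    (A : E n →L[ℝ] Alt n q) :
    (p.factorial * q.factorial : ℝ) *
        topWedge h a (ContinuousAlternatingMap.alternatizeUncurryFin A) =
      altSum (fun w : Fin p ⊕ Fin (q + 1) → E n =>
        a (w ∘ Sum.inl) * A (w (Sum.inr 0)) (fun j => w (Sum.inr j.succ)))
        ((basisTuple id : Fin n → E n) ∘ splitEquiv h) := by
  have h1 := topWedge_eq_altSum h a (ContinuousAlternatingMap.alternatizeUncurryFin A)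
  have h2 := altSum_altSum_inr (fun w : Fin p → E n => a w)
    (fun w : Fin (q + 1) → E n => A (w 0) (fun j => w j.succ))
    ((basisTuple id : Fin n → E n) ∘ splitEquiv h)
  simp only [← factorial_smul_alternatizeUncurryFin, mul_left_comm (a _)] at h2
  rw [altSum_mul, ← h1, Fintype.card_fin] at h2
  have h3 : ((q + 1).factorial : ℝ) ≠ 0 := Nat.cast_ne_zero.2 (Nat.factorial_ne_zero _)
  refine mul_left_cancel₀ h3 (Eq.trans ?_ h2)
  ring

/-- Antisymmetrization of `x ↦ A x ∧ b`. -/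
theorem sum_wedge_removeNth {p q : ℕ} (v : Fin (p + q + 1) → E n)
    (a : E n → Alt n p) (b : E n → Alt n q) :
    (p.factorial * q.factorial : ℝ) * ∑ i : Fin (p + q + 1), (-1 : ℝ) ^ (i : ℕ) *
        wedge (a (v i)) (b (v i)) (i.removeNth v) =
      altSum (fun w : Fin (p + q + 1) → E n =>
        a (w 0) (fun j => w (Fin.castAdd q j).succ) *
          b (w 0) (fun j => w (Fin.natAdd p j).succ)) v := by
  rw [altSum_fin_succ, Finset.mul_sum]
  refine Finset.sum_congr rfl fun i _ => ?_
  rw [mul_left_comm, wedge_eq_altSum]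
  congr 1
  rw [altSum_reindex finSumFinEquiv]
  simp only [Fin.cons_zero, Fin.cons_succ]
  congr 1
  funext w
  congr 2
  · funext j; simp
  · funext j; simp

/-- The integration-by-parts formula for the Lie algebra differential. -/
theorem topWedge_d₀ {p q : ℕ} (h : p + 1 + q = n) (h' : p + (q + 1) = n) :
    ∃ ε : ℝ, ε * ε = 1 ∧ ∀ (a : Alt n p) (b : Alt n q),
      topWedge h (G.d₀ p a) b = ε * topWedge h' a (G.d₀ q b) := by
  have h0 : p + q + 1 = n := by omega
  -- The `p + q + 1` arguments consist of a distinguished one, numbered `0`, along which the frame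
  -- is differentiated, then those of `a`, then those of `b`. In `g₁` the distinguished argument
  -- becomes the first slot of `d₀ a`; in `g₂` below, the first slot of `d₀ b`.
  let g₁ : Fin (p + q + 1) ≃ Fin (p + 1) ⊕ Fin q :=
    (finCongr (by omega : p + q + 1 = p + 1 + q)).trans finSumFinEquiv.symm
  have hg₁ : g₁ 0 = Sum.inl 0 ∧ (∀ j : Fin p, g₁ (Fin.castAdd q j).succ = Sum.inl j.succ) ∧
      ∀ j : Fin q, g₁ (Fin.natAdd p j).succ = Sum.inr j := by
    refine ⟨?_, fun j => ?_, fun j => ?_⟩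
    all_goals
      simp only [g₁, Equiv.trans_apply]
      rw [Equiv.symm_apply_eq]
      apply Fin.ext
      simp
    omega
  let f₂ : Fin p ⊕ Fin (q + 1) → Fin (p + q + 1) :=
    Sum.elim (fun j => (Fin.castAdd q j).succ)
      (Fin.cons 0 (fun j : Fin q => (Fin.natAdd p j).succ))
  have hf₂ : Function.Bijective f₂ := by
    refine (Fintype.bijective_iff_injective_and_card f₂).2 ⟨?_, by simp; omega⟩
    rintro (i | i) (j | j) hij
    · simp only [f₂, Sum.elim_inl, Fin.ext_iff, Fin.val_succ, Fin.val_castAdd] at hij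
      exact congrArg Sum.inl (Fin.ext (by omega))
    · exfalso
      induction j using Fin.cases with
      | zero => simp [f₂, Fin.ext_iff] at hij
      | succ j => simp [f₂, Fin.ext_iff] at hij; omega
    · exfalso
      induction i using Fin.cases with
      | zero => simp [f₂, Fin.ext_iff] at hij
      | succ j => simp [f₂, Fin.ext_iff] at hij; omega
    · congr 1
      induction i using Fin.cases with
      | zero =>
        induction j using Fin.cases with
        | zero => rfl
        | succ j => simp [f₂, Fin.ext_iff] at hij
      | succ i =>
        induction j using Fin.cases with
        | zero => simp [f₂, Fin.ext_iff] at hij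
        | succ j =>
          simp [f₂, Fin.ext_iff] at hij
          exact congrArg Fin.succ (Fin.ext hij)
  let g₂ : Fin (p + q + 1) ≃ Fin p ⊕ Fin (q + 1) := (Equiv.ofBijective f₂ hf₂).symm
  have hg₂ : g₂ 0 = Sum.inr 0 ∧ (∀ j : Fin p, g₂ (Fin.castAdd q j).succ = Sum.inl j) ∧
      ∀ j : Fin q, g₂ (Fin.natAdd p j).succ = Sum.inr j.succ := by
    refine ⟨?_, fun j => ?_, fun j => ?_⟩
    all_goals
      change (Equiv.ofBijective f₂ hf₂).symm _ = _
      rw [Equiv.symm_apply_eq]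
      rfl
  obtain ⟨ε₁, hε₁, H₁⟩ := altSum_relabel (X := E n) (finCongr h0) (splitEquiv h) g₁
  obtain ⟨ε₂, hε₂, H₂⟩ := altSum_relabel (X := E n) (finCongr h0) (splitEquiv h') g₂
  refine ⟨-(ε₁ * ε₂), ?_, fun a b => ?_⟩
  · linear_combination ε₂ * ε₂ * hε₁ + hε₂
  have K₁ := H₁ (fun w : Fin (p + q + 1) → E n =>
    G.d₀Aux a (w 0) (fun j => w (Fin.castAdd q j).succ) * b (fun j => w (Fin.natAdd p j).succ))
    (basisTuple id)
  have K₂ := H₂ (fun w : Fin (p + q + 1) → E n =>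
    a (fun j => w (Fin.castAdd q j).succ) * G.d₀Aux b (w 0) (fun j => w (Fin.natAdd p j).succ))
    (basisTuple id)
  simp only [Function.comp_apply, hg₁.1, hg₁.2.1, hg₁.2.2] at K₁
  simp only [Function.comp_apply, hg₂.1, hg₂.2.1, hg₂.2.2] at K₂
  have L₁ := topWedge_alternatizeUncurryFin_left h (G.d₀Aux a) b
  have L₂ := topWedge_alternatizeUncurryFin_right h' a (G.d₀Aux b)
  rw [← d₀_eq] at L₁ L₂
  have M₁ := sum_wedge_removeNth ((basisTuple id : Fin n → E n) ∘ finCongr h0)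
    (fun x => G.d₀Aux a x) (fun _ => b)
  have M₂ := sum_wedge_removeNth ((basisTuple id : Fin n → E n) ∘ finCongr h0)
    (fun _ => a) (fun x => G.d₀Aux b x)
  -- Since `a ∧ b` has degree `n - 1`, its differential vanishes; the derivation rule turns this
  -- into the cancellation of the two antisymmetrized sums. Only the square of the resulting sign
  -- matters later.
  have hz := congrArg (fun φ => φ ((basisTuple id : Fin n → E n) ∘ finCongr h0))
    (G.d₀_eq_zero_of_corank_one h0 (toAlt (wedge a b)))
  simp only [d₀_eq, ContinuousAlternatingMap.alternatizeUncurryFin_apply, d₀Aux_wedge] at hz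
  have hz' : (∑ i : Fin (p + q + 1), (-1 : ℝ) ^ (i : ℕ) *
      wedge (G.d₀Aux a (((basisTuple id : Fin n → E n) ∘ finCongr h0) i)) b
        (i.removeNth ((basisTuple id : Fin n → E n) ∘ finCongr h0))) +
      ∑ i : Fin (p + q + 1), (-1 : ℝ) ^ (i : ℕ) *
      wedge a (G.d₀Aux b (((basisTuple id : Fin n → E n) ∘ finCongr h0) i))
        (i.removeNth ((basisTuple id : Fin n → E n) ∘ finCongr h0)) = 0 := by
    rw [← Finset.sum_add_distrib]
    refine Eq.trans (Finset.sum_congr rfl fun i _ => ?_) hz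
    rw [zsmul_eq_mul]
    push_cast
    ring
  refine mul_left_cancel₀ (factorial_mul_ne_zero p q) ?_
  have L₁' := L₁.trans K₁
  have L₂' := L₂.trans K₂
  rw [← M₁] at L₁'
  rw [← M₂] at L₂'
  rw [mul_left_comm, L₁', L₂']
  linear_combination (p.factorial * q.factorial : ℝ) * ε₁ * hz' +
    ε₁ * (p.factorial * q.factorial : ℝ) * (∑ i : Fin (p + q + 1), (-1 : ℝ) ^ (i : ℕ) *
      wedge a (G.d₀Aux b (((basisTuple id : Fin n → E n) ∘ finCongr h0) i))
        (i.removeNth ((basisTuple id : Fin n → E n) ∘ finCongr h0))) * hε₂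

/-! ### Weighted Poincaré duality for Lie algebra cohomology -/

theorem mem_coboundaries_of_d₀_eq {k : ℕ} {w : ℝ} {φ : Alt n (k + 1)} {η : Alt n k}
    (hφ : φ ∈ G.weightSpace (k + 1) w) (h : φ = G.d₀ k η) : φ ∈ G.coboundaries (k + 1) w := by
  refine ⟨G.proj k w η, G.proj_mem _ _, ?_⟩
  rw [d₀_proj, ← h, G.proj_of_mem hφ]

theorem mem_cohomologyWeights_iff {k : ℕ} {w : ℝ} :
    w ∈ G.cohomologyWeights k ↔ ∃ φ ∈ G.cocycles k w, φ ∉ G.coboundaries k w := by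
  change G.cohomology k w ≠ ⊥ ↔ _
  rw [cohomology, Ne, ← LinearMap.le_ker_iff_map, Submodule.ker_mkQ, SetLike.not_le_iff_exists]

theorem cohomologyWeights_subset_weights (k : ℕ) : G.cohomologyWeights k ⊆ G.weights k := by
  intro w hw
  obtain ⟨φ, hφ, h0⟩ := G.mem_cohomologyWeights_iff.1 hw
  exact G.mem_weights_iff.2 ⟨φ, hφ.1, fun h => h0 (h ▸ Submodule.zero_mem _)⟩

theorem finite_cohomologyWeights (k : ℕ) : (G.cohomologyWeights k).Finite :=
  (G.finite_weights k).subset (G.cohomologyWeights_subset_weights k)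

/-- Poincaré duality: a cocycle that is not a coboundary pairs nontrivially with some cocycle of
complementary degree and weight. -/
theorem exists_dual_cocycle {p q : ℕ} (h : p + 1 + q = n) {w : ℝ} {φ : Alt n (p + 1)}
    (hφ : φ ∈ G.weightSpace (p + 1) w) (hφ' : φ ∉ G.coboundaries (p + 1) w) :
    ∃ ψ ∈ G.cocycles q (G.homDim - w), topWedge h φ ψ ≠ 0 := by
  by_contra! hc
  have h' : p + (q + 1) = n := by omega
  obtain ⟨ε, hε, hd⟩ := G.topWedge_d₀ h h'
  -- Only the part of weight `T - w` of a cocycle pairs with `φ`, so `φ` pairs to zero with all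
  -- cocycles. The pairing with `φ` then factors through `d₀`, the factor is the product with some
  -- `η`, and integration by parts identifies `φ` with `d₀ η` up to sign.
  have h1 : topWedge h φ ∈ (LinearMap.ker (G.d₀ q)).dualAnnihilator := by
    rw [Submodule.mem_dualAnnihilator]
    intro ψ hψ
    rw [← G.topWedge_proj h hφ]
    refine hc _ ⟨G.proj_mem _ _, ?_⟩
    change G.d₀ q _ = 0
    rw [d₀_proj, LinearMap.mem_ker.1 hψ, map_zero]
  rw [← LinearMap.range_dualMap_eq_dualAnnihilator_ker] at h1
  obtain ⟨m, hm⟩ := h1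
  obtain ⟨η, hη⟩ := topWedge_surjective h' m
  refine hφ' (G.mem_coboundaries_of_d₀_eq hφ (η := ε • η) ?_)
  apply topWedge_injective h
  refine LinearMap.ext fun ψ => ?_
  rw [map_smul, map_smul, LinearMap.smul_apply, hd, smul_eq_mul, ← _root_.mul_assoc, hε, one_mul,
    hη, ← hm]
  rfl

/-- Poincaré duality for the weights of the cohomology. -/
theorem mem_cohomologyWeights_dual {a b : ℕ} (h : a + b + 1 = n) {v : ℝ}
    (hv : v ∈ G.cohomologyWeights (b + 1)) : G.homDim - v ∈ G.cohomologyWeights a := by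
  obtain ⟨φ, hφ, hφ'⟩ := G.mem_cohomologyWeights_iff.1 hv
  obtain ⟨ψ, hψ, h0⟩ := G.exists_dual_cocycle (by omega : b + 1 + a = n) hφ.1 hφ'
  refine G.mem_cohomologyWeights_iff.2 ⟨ψ, hψ, fun hc => h0 ?_⟩
  cases a with
  | zero =>
    rw [show ψ = 0 from hc, map_zero]
  | succ a =>
    obtain ⟨η, -, rfl⟩ := hc
    obtain ⟨ε, hε, hd⟩ := G.topWedge_d₀ (by omega : b + 1 + 1 + a = n)
      (by omega : b + 1 + (a + 1) = n)
    have h1 := hd φ η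
    rw [LinearMap.mem_ker.1 hφ.2, map_zero, LinearMap.zero_apply, eq_comm, mul_eq_zero] at h1
    exact h1.resolve_left (by rintro rfl; simp at hε)

/-- Nonzero forms of a given weight have partners of complementary weight. -/
theorem mem_weights_dual {p q : ℕ} (h : p + q = n) {w : ℝ} (hw : w ∈ G.weights p) :
    G.homDim - w ∈ G.weights q := by
  obtain ⟨φ, hφ, h0⟩ := G.mem_weights_iff.1 hw
  obtain ⟨ψ, hψ⟩ := exists_topWedge_ne_zero h h0
  rw [← G.topWedge_proj h hφ] at hψ
  exact G.mem_weights_iff.2 ⟨_, G.proj_mem _ _, fun h1 => hψ (by rw [h1, map_zero])⟩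

/-- Removing one index from a multi-index of a weight. -/
theorem exists_sub_mem_weights {k : ℕ} {w : ℝ} (hw : w ∈ G.weights (k + 1)) :
    ∃ i, w - G.wt i ∈ G.weights k := by
  obtain ⟨φ, hφ, h0⟩ := G.mem_weights_iff.1 hw
  obtain ⟨I, hI⟩ : ∃ I : Fin (k + 1) → Fin n, φ (basisTuple I) ≠ 0 := by
    by_contra! hc
    exact h0 (Alt.ext_basisTuple hc)
  have h1 : φ.curryLeft (basisTuple I 0) (basisTuple (Fin.tail I)) ≠ 0 := by
    rw [ContinuousAlternatingMap.curryLeft_apply_apply]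
    convert! hI
    funext j
    refine Fin.cases rfl (fun j => rfl) j
  refine ⟨I 0, ?_⟩
  have h2 := G.mem_weights_of_apply_ne_zero h1
  have h3 := G.mem_weightSpace_iff.1 hφ I hI
  rw [G.mwt_eq_add_removeNth I 0] at h3
  have h4 : (0 : Fin (k + 1)).removeNth I = Fin.tail I := by
    funext j; simp [Fin.removeNth, Fin.tail]
  rw [h4] at h3
  rwa [← h3, add_sub_cancel_left]

end HomogeneousLieGroup

variable {n : ℕ}

/-! ### Exterior derivatives of smooth forms on open sets -/

theorem differentiableAt_of_contDiffOn {k : ℕ} {α : Form n k} {U : Set (E n)} (hU : IsOpen U)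
    (hα : ContDiffOn ℝ ∞ α U) {x : E n} (hx : x ∈ U) : DifferentiableAt ℝ α x :=
  (hα.contDiffAt (hU.mem_nhds hx)).differentiableAt (by simp)

theorem contDiffOn_extDeriv {k : ℕ} {α : Form n k} {U : Set (E n)} (hU : IsOpen U)
    (hα : ContDiffOn ℝ ∞ α U) : ContDiffOn ℝ ∞ (extDeriv α) U :=
  (ContinuousAlternatingMap.alternatizeUncurryFinCLM ℝ (E n) ℝ).contDiff.comp_contDiffOn
    (hα.fderiv_of_isOpen hU (by exact right_eq_inf.mp rfl))

theorem extDeriv_sub_apply {k : ℕ} {α β : Form n k} {x : E n} (hα : DifferentiableAt ℝ α x)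
    (hβ : DifferentiableAt ℝ β x) : extDeriv (α - β) x = extDeriv α x - extDeriv β x := by
  have h : extDeriv (α - β + β) x = extDeriv (α - β) x + extDeriv β x :=
    extDeriv_add (hα.sub hβ) hβ
  rw [sub_add_cancel] at h
  rw [h, add_sub_cancel_right]

theorem extDeriv_extDeriv_on {k : ℕ} {α : Form n k} {U : Set (E n)} (hU : IsOpen U)
    (hα : ContDiffOn ℝ ∞ α U) {x : E n} (hx : x ∈ U) : extDeriv (extDeriv α) x = 0 :=
  extDeriv_extDeriv_apply (hα.contDiffAt (hU.mem_nhds hx))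
    HomogeneousLieGroup.minSmoothness_two_le

theorem extDeriv_eq_of_eqOn {k : ℕ} {α β : Form n k} {U : Set (E n)} (hU : IsOpen U)
    (h : ∀ x ∈ U, α x = β x) {x : E n} (hx : x ∈ U) : extDeriv α x = extDeriv β x :=
  Filter.EventuallyEq.extDeriv_eq (Filter.eventuallyEq_of_mem (hU.mem_nhds hx) h)

theorem extDeriv_zero_apply {k : ℕ} (x : E n) : extDeriv (0 : Form n k) x = 0 := by
  have := extDeriv_smul (𝕜 := ℝ) (x := x) (0 : ℝ) (0 : Form n k)
  simpa using this

theorem exists_linearMap_quasiInverse {V W : Type*} [AddCommGroup V] [Module ℝ V]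
    [AddCommGroup W] [Module ℝ W] (f : V →ₗ[ℝ] W) : ∃ g : W →ₗ[ℝ] V, ∀ v, f (g (f v)) = f v := by
  obtain ⟨g, hg⟩ := f.rangeRestrict.exists_rightInverse_of_surjective f.range_rangeRestrict
  obtain ⟨g', hg'⟩ := LinearMap.exists_extend g
  refine ⟨g', fun v => ?_⟩
  have h1 : g' (f v) = g (f.rangeRestrict v) := congrArg (fun l => l (f.rangeRestrict v)) hg'
  rw [h1]
  exact congrArg (fun l => ((l (f.rangeRestrict v) : LinearMap.range f) : W)) hg

namespace HomogeneousLieGroup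

variable (G : HomogeneousLieGroup n)

/-! ### Partial inverses of the Lie algebra differential -/

/-- `δ` is a dilation-invariant right inverse of the Lie algebra differential on the cocycles
with weights in `A`, and vanishes on the other weights. -/
structure IsPartialInverse {k : ℕ} (δ : Alt n (k + 1) →ₗ[ℝ] Alt n k) (A : Set ℝ) : Prop where
  dil : ∀ (s : ℝ) (φ : Alt n (k + 1)), δ (φ.compContinuousLinearMap (G.dil s)) =
    (δ φ).compContinuousLinearMap (G.dil s)
  d₀_apply : ∀ v ∈ A, ∀ φ ∈ G.weightSpace (k + 1) v, G.d₀ (k + 1) φ = 0 → G.d₀ k (δ φ) = φ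
  apply_eq_zero : ∀ v ∉ A, ∀ φ ∈ G.weightSpace (k + 1) v, δ φ = 0

/-- A linear quasi-inverse of `d₀` is compressed to each weight in `A` separately, which makes it
equivariant. On a weight without cohomology every cocycle is exact, so the quasi-inverse recovers a
primitive. -/
theorem exists_isPartialInverse (k : ℕ) (A : Set ℝ)
    (hA : ∀ v ∈ A, v ∉ G.cohomologyWeights (k + 1)) :
    ∃ δ : Alt n (k + 1) →ₗ[ℝ] Alt n k, G.IsPartialInverse δ A := by
  classical
  obtain ⟨δ', hδ'⟩ := exists_linearMap_quasiInverse (G.d₀ k)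
  let δ : Alt n (k + 1) →ₗ[ℝ] Alt n k := ∑ v ∈ G.weightFinset (k + 1),
    if v ∈ A then (G.proj k v).comp (δ'.comp (G.proj (k + 1) v)) else 0
  have hδ : ∀ {v : ℝ} {φ : Alt n (k + 1)}, φ ∈ G.weightSpace (k + 1) v →
      δ φ = if v ∈ A then G.proj k v (δ' φ) else 0 := by
    intro v φ hφ
    simp only [δ, LinearMap.sum_apply]
    by_cases hv : v ∈ G.weightFinset (k + 1)
    · rw [Finset.sum_eq_single v _ fun h => absurd hv h]
      · split_ifs
        · simp [G.proj_of_mem hφ]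
        · rfl
      · intro w _ hwv
        split_ifs
        · simp [G.proj_of_mem_of_ne hφ hwv]
        · rfl
    · have h0 : φ = 0 := by
        rw [← G.proj_of_mem hφ, G.proj_eq_zero_of_notMem hv, LinearMap.zero_apply]
      simp [h0]
  refine ⟨δ, ⟨fun s φ => ?_, fun v hv φ hφ h0 => ?_, fun v hv φ hφ => ?_⟩⟩
  · conv_lhs => rw [← G.sum_proj φ]
    conv_rhs => rw [← G.sum_proj φ]
    change δ (G.dilPull _ s _) = G.dilPull _ s _
    simp only [map_sum]
    refine Finset.sum_congr rfl fun v _ => ?_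
    rw [dilPull_apply, dilPull_apply, G.proj_mem v φ s, map_smul, hδ (G.proj_mem v φ)]
    split_ifs
    · exact (G.proj_mem v (δ' _) s).symm
    · rw [smul_zero]; rfl
  · rw [hδ hφ, if_pos hv, d₀_proj]
    have h1 : φ ∈ G.coboundaries (k + 1) v := by
      by_contra hc
      exact hA v hv (G.mem_cohomologyWeights_iff.2 ⟨φ, ⟨hφ, h0⟩, hc⟩)
    obtain ⟨η, -, rfl⟩ := h1
    rw [hδ', G.proj_of_mem hφ]
  · rw [hδ hφ, if_neg hv]

/-- A linear map of coefficients, acting on forms through the left-invariant frame. -/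
def frameMap {k l : ℕ} (δ : Alt n k →ₗ[ℝ] Alt n l) (β : Form n k) : Form n l :=
  G.ofFrame fun x => δ (G.toFrame β x)

theorem toFrame_frameMap {k l : ℕ} (δ : Alt n k →ₗ[ℝ] Alt n l) (β : Form n k) (x : E n) :
    G.toFrame (G.frameMap δ β) x = δ (G.toFrame β x) :=
  congrFun (G.toFrame_ofFrame _) x

theorem toFrame_eq_zero_iff {k : ℕ} {β : Form n k} {x : E n} :
    G.toFrame β x = 0 ↔ β x = 0 := by
  constructor
  · intro h
    have h1 := congrFun (G.ofFrame_toFrame β) x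
    rw [← h1, ofFrame, h]
    rfl
  · intro h
    rw [toFrame, h]
    rfl

theorem frameMap_apply_eq_zero {k l : ℕ} (δ : Alt n k →ₗ[ℝ] Alt n l) {β : Form n k} {x : E n}
    (h : δ (G.toFrame β x) = 0) : G.frameMap δ β x = 0 := by
  rw [← toFrame_eq_zero_iff, toFrame_frameMap, h]

theorem contDiffOn_frameMap {k l : ℕ} (δ : Alt n k →ₗ[ℝ] Alt n l) {β : Form n k} {U : Set (E n)}
    (h : ContDiffOn ℝ ∞ β U) : ContDiffOn ℝ ∞ (G.frameMap δ β) U :=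
  G.contDiffOn_ofFrame
    ((LinearMap.toContinuousLinearMap δ).contDiff.comp_contDiffOn (G.contDiffOn_toFrame h))

/-! ### Raising the weight of closed forms -/

section Lift

variable {k : ℕ} (δ : Alt n (k + 1) →ₗ[ℝ] Alt n k)

/-- One step of the weight-raising procedure. -/
def liftStep (β : Form n (k + 1)) : Form n (k + 1) := β - extDeriv (G.frameMap δ β)

/-- The primitive of the form removed by `m` steps of the weight-raising procedure. -/
def liftCorr (m : ℕ) (β : Form n (k + 1)) : Form n k :=
  ∑ j ∈ Finset.range m, G.frameMap δ ((G.liftStep δ)^[j] β)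

variable {U : Set (E n)} {δ}

theorem contDiffOn_liftStep (hU : IsOpen U) {β : Form n (k + 1)} (h : ContDiffOn ℝ ∞ β U) :
    ContDiffOn ℝ ∞ (G.liftStep δ β) U :=
  h.sub (contDiffOn_extDeriv hU (G.contDiffOn_frameMap δ h))

theorem contDiffOn_liftStep_iterate (hU : IsOpen U) {β : Form n (k + 1)}
    (h : ContDiffOn ℝ ∞ β U) (m : ℕ) : ContDiffOn ℝ ∞ ((G.liftStep δ)^[m] β) U := by
  induction m with
  | zero => exact h
  | succ m ih => rw [Function.iterate_succ_apply']; exact G.contDiffOn_liftStep hU ih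

theorem contDiffOn_liftCorr (hU : IsOpen U) {β : Form n (k + 1)}
    (h : ContDiffOn ℝ ∞ β U) (m : ℕ) : ContDiffOn ℝ ∞ (G.liftCorr δ m β) U := by
  have : G.liftCorr δ m β = fun x => ∑ j ∈ Finset.range m,
      G.frameMap δ ((G.liftStep δ)^[j] β) x := by
    funext x; simp [liftCorr]
  rw [this]
  exact ContDiffOn.sum fun j _ => G.contDiffOn_frameMap δ (G.contDiffOn_liftStep_iterate hU h j)

theorem liftCorr_succ (m : ℕ) (β : Form n (k + 1)) :
    G.liftCorr δ (m + 1) β = G.liftCorr δ m β + G.frameMap δ ((G.liftStep δ)^[m] β) :=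
  Finset.sum_range_succ _ _

theorem liftStep_iterate_eq (hU : IsOpen U) {β : Form n (k + 1)} (h : ContDiffOn ℝ ∞ β U)
    (m : ℕ) {x : E n} (hx : x ∈ U) :
    (G.liftStep δ)^[m] β x = β x - extDeriv (G.liftCorr δ m β) x := by
  induction m with
  | zero =>
    change β x = β x - extDeriv (0 : Form n k) x
    rw [extDeriv_zero_apply, sub_zero]
  | succ m ih =>
    rw [Function.iterate_succ_apply', liftCorr_succ, extDeriv_add
      (differentiableAt_of_contDiffOn hU (G.contDiffOn_liftCorr hU h m) hx)
      (differentiableAt_of_contDiffOn hU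
        (G.contDiffOn_frameMap δ (G.contDiffOn_liftStep_iterate hU h m)) hx), ← sub_sub, ← ih]
    rfl

theorem extDeriv_liftStep_iterate (hU : IsOpen U) {β : Form n (k + 1)} (h : ContDiffOn ℝ ∞ β U)
    (hc : ∀ x ∈ U, extDeriv β x = 0) (m : ℕ) {x : E n} (hx : x ∈ U) :
    extDeriv ((G.liftStep δ)^[m] β) x = 0 := by
  have hs := G.contDiffOn_liftCorr (δ := δ) hU h m
  rw [extDeriv_eq_of_eqOn hU (β := β - extDeriv (G.liftCorr δ m β))
    (fun y hy => G.liftStep_iterate_eq hU h m hy) hx,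
    extDeriv_sub_apply (differentiableAt_of_contDiffOn hU h hx)
      (differentiableAt_of_contDiffOn hU (contDiffOn_extDeriv hU hs) hx),
    hc x hx, extDeriv_extDeriv_on hU hs hx, sub_zero]

theorem IsPartialInverse.mem_GE {A : Set ℝ} (hδ : G.IsPartialInverse δ A) {w : ℝ}
    {φ : Alt n (k + 1)} (h : φ ∈ G.weightSpaceGE (k + 1) w) : δ φ ∈ G.weightSpaceGE k w := by
  refine G.mem_weightSpaceGE_of_proj fun v hv => ?_
  rw [← G.proj_comm δ hδ.dil, G.proj_eq_zero_of_mem_GE h hv, map_zero]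

theorem toFrame_extDeriv_mem_GE (hU : IsOpen U) {α : Form n k} {w : ℝ} (hn : 0 < n)
    (hα : ContDiffOn ℝ ∞ α U) (hw : ∀ x ∈ U, G.toFrame α x ∈ G.weightSpaceGE k w) {x : E n}
    (hx : x ∈ U) : G.toFrame (extDeriv α) x ∈ G.weightSpaceGE (k + 1) w := by
  have h1 := G.toFrame_extDeriv_sub_mem (differentiableAt_of_contDiffOn hU hα hx)
    (Filter.eventually_of_mem (hU.mem_nhds hx) hw)
  have h2 := G.weightSpaceGE_antitone (by linarith [G.minWt_pos hn] : w ≤ w + G.minWt) h1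
  simpa using Submodule.add_mem _ h2 (G.d₀_mem_weightSpaceGE (hw x hx))

theorem toFrame_sub {l : ℕ} (α β : Form n l) (x : E n) :
    G.toFrame (α - β) x = G.toFrame α x - G.toFrame β x := rfl

theorem toFrame_liftStep_iterate_mem_GE {A : Set ℝ} (hδ : G.IsPartialInverse δ A) (hU : IsOpen U)
    (hn : 0 < n) {β : Form n (k + 1)} {w : ℝ} (h : ContDiffOn ℝ ∞ β U)
    (hw : ∀ x ∈ U, G.toFrame β x ∈ G.weightSpaceGE (k + 1) w) (m : ℕ) :
    ∀ x ∈ U, G.toFrame ((G.liftStep δ)^[m] β) x ∈ G.weightSpaceGE (k + 1) w := by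
  induction m with
  | zero => exact hw
  | succ m ih =>
    intro x hx
    rw [Function.iterate_succ_apply', liftStep, toFrame_sub]
    refine Submodule.sub_mem _ (ih x hx) (G.toFrame_extDeriv_mem_GE hU hn
      (G.contDiffOn_frameMap δ (G.contDiffOn_liftStep_iterate hU h m)) (fun y hy => ?_) hx)
    rw [toFrame_frameMap]
    exact hδ.mem_GE G (ih y hy)

theorem toFrame_sum {l : ℕ} {ι : Type*} (s : Finset ι) (α : ι → Form n l) (x : E n) :
    G.toFrame (∑ i ∈ s, α i) x = ∑ i ∈ s, G.toFrame (α i) x := by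
  rw [toFrame, Finset.sum_apply]
  exact map_sum (ContinuousAlternatingMap.compContinuousLinearMapₗ (G.leftDiff x)) _ _

theorem toFrame_liftCorr_mem_GE {A : Set ℝ} (hδ : G.IsPartialInverse δ A) (hU : IsOpen U)
    (hn : 0 < n) {β : Form n (k + 1)} {w : ℝ} (h : ContDiffOn ℝ ∞ β U)
    (hw : ∀ x ∈ U, G.toFrame β x ∈ G.weightSpaceGE (k + 1) w) (m : ℕ) {x : E n} (hx : x ∈ U) :
    G.toFrame (G.liftCorr δ m β) x ∈ G.weightSpaceGE k w := by
  rw [liftCorr, toFrame_sum]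
  refine Submodule.sum_mem _ fun j _ => ?_
  rw [toFrame_frameMap]
  exact hδ.mem_GE G (G.toFrame_liftStep_iterate_mem_GE hδ hU hn h hw j x hx)

/-- A form in the kernel of `δ` is fixed by the procedure. -/
theorem liftStep_iterate_eq_self (hU : IsOpen U) {β : Form n (k + 1)}
    (hβ : ∀ x ∈ U, δ (G.toFrame β x) = 0) (m : ℕ) : ∀ x ∈ U, (G.liftStep δ)^[m] β x = β x := by
  induction m with
  | zero => exact fun _ _ => rfl
  | succ m ih =>
    intro x hx
    have h0 : ∀ y ∈ U, G.frameMap δ ((G.liftStep δ)^[m] β) y = (0 : Form n k) y := by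
      intro y hy
      refine G.frameMap_apply_eq_zero δ ?_
      rw [toFrame, ih y hy]
      exact hβ y hy
    rw [Function.iterate_succ_apply', liftStep, Pi.sub_apply, ih x hx,
      extDeriv_eq_of_eqOn hU h0 hx, extDeriv_zero_apply, sub_zero]

/-- The correction is a differential operator applied to `β`, so it cannot enlarge supports; this
later provides a compactly supported primitive. -/
theorem liftCorr_eq_zero (hU : IsOpen U) {β : Form n (k + 1)}
    (hβ : ∀ x ∈ U, β x = 0) (m : ℕ) {x : E n} (hx : x ∈ U) : G.liftCorr δ m β x = 0 := by
  rw [liftCorr, Finset.sum_apply]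
  refine Finset.sum_eq_zero fun j _ => G.frameMap_apply_eq_zero δ ?_
  rw [G.toFrame_eq_zero_iff.2, map_zero]
  rw [G.liftStep_iterate_eq_self hU (fun y hy => ?_) j x hx, hβ x hx]
  rw [G.toFrame_eq_zero_iff.2 (hβ y hy), map_zero]

/-- The weight-raising procedure makes the weight of a closed form at least `w`, if there is no
cohomology of weight less than `w`. -/
theorem toFrame_liftStep_iterate_mem {w : ℝ} (hδ : G.IsPartialInverse δ (Set.Iio w))
    (hU : IsOpen U) (hn : 0 < n) {β : Form n (k + 1)} (h : ContDiffOn ℝ ∞ β U)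
    (hc : ∀ x ∈ U, extDeriv β x = 0) {x : E n} (hx : x ∈ U) :
    G.toFrame ((G.liftStep δ)^[(G.weightFinset (k + 1)).card + 1] β) x ∈
      G.weightSpaceGE (k + 1) w := by
  classical
  set W := G.weightFinset (k + 1)
  -- Each step clears one more weight from below: after `m` steps a weight `v < w` is gone once
  -- fewer than `m` weights lie below it. Hence the `+ 1` in the number of iterations.
  have key : ∀ m : ℕ, ∀ v < w, (W.filter (· < v)).card < m →
      ∀ x ∈ U, G.proj (k + 1) v (G.toFrame ((G.liftStep δ)^[m] β) x) = 0 := by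
    intro m
    induction m with
    | zero => intro v _ hm; exact absurd hm (Nat.not_lt_zero _)
    | succ m ih =>
      intro v hv hm x hx
      set β' := (G.liftStep δ)^[m] β with hβ'
      have hsm : ContDiffOn ℝ ∞ β' U := G.contDiffOn_liftStep_iterate hU h m
      have hGE : ∀ y ∈ U, G.toFrame β' y ∈ G.weightSpaceGE (k + 1) v := by
        intro y hy
        refine G.mem_weightSpaceGE_of_proj fun v' hv' => ?_
        by_cases hW : v' ∈ W
        · refine ih v' (hv'.trans hv) (lt_of_lt_of_le (Finset.card_lt_card ?_)
            (Nat.le_of_lt_succ hm)) y hy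
          rw [Finset.ssubset_iff_of_subset]
          · exact ⟨v', by simp [hW, hv'], by simp⟩
          · intro z hz
            simp only [Finset.mem_filter] at hz ⊢
            exact ⟨hz.1, hz.2.trans hv'⟩
        · rw [G.proj_eq_zero_of_notMem hW, LinearMap.zero_apply]
      have hlt : v < v + G.minWt := by linarith [G.minWt_pos hn]
      -- All weights below `v` being absent, the weight `v` part of `d β' = 0` involves only `d₀` of
      -- the leading coefficient.
      have hcl : G.d₀ (k + 1) (G.proj (k + 1) v (G.toFrame β' x)) = 0 := by
        have h1 := G.toFrame_extDeriv_sub_mem (differentiableAt_of_contDiffOn hU hsm hx)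
          (Filter.eventually_of_mem (hU.mem_nhds hx) hGE)
        rw [G.toFrame_eq_zero_iff.2 (G.extDeriv_liftStep_iterate hU h hc m hx), zero_sub] at h1
        have h2 := G.proj_eq_zero_of_mem_GE h1 hlt
        rw [map_neg, neg_eq_zero] at h2
        rw [d₀_proj, h2]
      -- Likewise the weight `v` part of the subtracted exact form is `d₀ δ` of the leading
      -- coefficient, that is, the coefficient itself.
      have h3 := G.toFrame_extDeriv_sub_mem (differentiableAt_of_contDiffOn hU
          (G.contDiffOn_frameMap δ hsm) hx)
          (Filter.eventually_of_mem (hU.mem_nhds hx) fun y hy => by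
            rw [toFrame_frameMap]; exact hδ.mem_GE G (hGE y hy))
      have h4 := G.proj_eq_zero_of_mem_GE h3 hlt
      rw [map_sub, sub_eq_zero, toFrame_frameMap, ← d₀_proj, ← G.proj_comm δ hδ.dil,
        hδ.d₀_apply v hv _ (G.proj_mem _ _) hcl] at h4
      rw [Function.iterate_succ_apply', ← hβ', liftStep, toFrame_sub, map_sub, h4, sub_self]
  refine G.mem_weightSpaceGE_of_proj fun v hv => key _ v hv ?_ x hx
  exact Nat.lt_succ_of_le (Finset.card_filter_le _ _)

end Lift

/-! ### Homogeneity -/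

theorem isOpen_compl_zero : IsOpen ({0}ᶜ : Set (E n)) := isOpen_compl_singleton

theorem dil_ne_zero {s : ℝ} {x : E n} (hx : x ≠ 0) : G.dil s x ≠ 0 := by
  intro h
  refine hx ?_
  ext i
  have h1 := congrArg (fun y : E n => y i) h
  simp only [dil, diagMap_apply, PiLp.zero_apply, mul_eq_zero, Real.exp_ne_zero, false_or] at h1
  exact h1

variable {G}

theorem IsHomogeneous.sub {k : ℕ} {lam : ℝ} {α β : Form n k} (hα : G.IsHomogeneous lam α)
    (hβ : G.IsHomogeneous lam β) : G.IsHomogeneous lam (α - β) := by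
  refine ⟨hα.1.sub hβ.1, fun s x hx => ?_⟩
  change G.dilPull k s (α _ - β _) = _
  rw [map_sub, dilPull_apply, dilPull_apply, hα.2 s x hx, hβ.2 s x hx, Pi.sub_apply, smul_sub]

theorem IsHomogeneous.extDeriv {k : ℕ} {lam : ℝ} {α : Form n k} (hα : G.IsHomogeneous lam α) :
    G.IsHomogeneous lam (extDeriv α) := by
  refine ⟨contDiffOn_extDeriv isOpen_compl_zero hα.1, fun s x hx => ?_⟩
  have h1 := extDeriv_pullback (f := G.dil s) (x := x)
    (differentiableAt_of_contDiffOn isOpen_compl_zero hα.1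
      (show G.dil s x ∈ ({0}ᶜ : Set (E n)) from G.dil_ne_zero hx))
    (G.dil s).contDiff.contDiffAt minSmoothness_two_le
  rw [(G.dil s).fderiv] at h1
  rw [← h1, ← _root_.extDeriv_smul]
  refine extDeriv_eq_of_eqOn isOpen_compl_zero (fun y hy => ?_) hx
  rw [(G.dil s).fderiv]
  exact hα.2 s y hy

theorem IsHomogeneous.frameMap {k l : ℕ} {lam : ℝ} {β : Form n k} {δ : Alt n k →ₗ[ℝ] Alt n l}
    (hδ : ∀ (s : ℝ) (φ : Alt n k), δ (φ.compContinuousLinearMap (G.dil s)) =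
      (δ φ).compContinuousLinearMap (G.dil s))
    (hβ : G.IsHomogeneous lam β) : G.IsHomogeneous lam (G.frameMap δ β) := by
  refine ⟨G.contDiffOn_frameMap δ hβ.1, fun s x hx => ?_⟩
  rw [HomogeneousLieGroup.frameMap, ofFrame, comp_comp_alt, leftDiffInv_dil, ← comp_comp_alt, ← hδ,
    toFrame, comp_comp_alt, leftDiff_dil, ← comp_comp_alt, hβ.2 s x hx]
  change (δ (Real.exp (s * lam) • (β x).compContinuousLinearMap _)).compContinuousLinearMap _ = _
  rw [map_smul]
  rfl

theorem IsHomogeneous.liftStep_iterate {k : ℕ} {lam : ℝ} {β : Form n (k + 1)}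
    {δ : Alt n (k + 1) →ₗ[ℝ] Alt n k} {A : Set ℝ} (hδ : G.IsPartialInverse δ A)
    (hβ : G.IsHomogeneous lam β) (m : ℕ) : G.IsHomogeneous lam ((G.liftStep δ)^[m] β) := by
  induction m with
  | zero => exact hβ
  | succ m ih =>
    rw [Function.iterate_succ_apply']
    exact ih.sub (ih.frameMap hδ.dil).extDeriv

theorem isHomogeneous_zero {k : ℕ} (lam : ℝ) : G.IsHomogeneous lam (0 : Form n k) :=
  ⟨contDiffOn_const, fun s x _ => by ext v; simp⟩

theorem IsHomogeneous.add {k : ℕ} {lam : ℝ} {α β : Form n k} (hα : G.IsHomogeneous lam α)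
    (hβ : G.IsHomogeneous lam β) : G.IsHomogeneous lam (α + β) := by
  have := hα.sub ((isHomogeneous_zero lam).sub hβ)
  simpa using this

theorem IsHomogeneous.liftCorr {k : ℕ} {lam : ℝ} {β : Form n (k + 1)}
    {δ : Alt n (k + 1) →ₗ[ℝ] Alt n k} {A : Set ℝ} (hδ : G.IsPartialInverse δ A)
    (hβ : G.IsHomogeneous lam β) (m : ℕ) : G.IsHomogeneous lam (G.liftCorr δ m β) := by
  induction m with
  | zero => exact isHomogeneous_zero lam
  | succ m ih =>
    rw [liftCorr_succ]
    exact ih.add ((hβ.liftStep_iterate hδ m).frameMap hδ.dil)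

end HomogeneousLieGroup

variable {n : ℕ}

/-! ### Non-vanishing of cohomology -/

theorem alt_succ_eq_zero (φ : Alt n (n + 1)) : φ = 0 := by
  refine Alt.ext_basisTuple fun I => ?_
  have h : ¬ Function.Injective I := fun hI => by
    simpa using Fintype.card_le_of_injective I hI
  refine φ.toAlternatingMap.map_eq_zero_of_not_injective _ fun hinj => h fun i j hij => hinj ?_
  simp [basisTuple, hij]

/-- Stokes' theorem for compactly supported forms on a Euclidean space. -/
theorem integral_extDeriv_eq_zero {j : ℕ} {γ : Form (j + 1) j} (hγ : ContDiff ℝ ∞ γ)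
    (hc : HasCompactSupport γ) (v : Fin (j + 1) → E (j + 1)) :
    ∫ x, extDeriv γ x v = 0 := by
  have hd : Differentiable ℝ γ := hγ.differentiable (by simp)
  have hs : ∀ i : Fin (j + 1), ContDiff ℝ ∞ (fun x => γ x (i.removeNth v)) := fun i =>
    contDiffOn_univ.1 (contDiffOn_alt_apply (contDiffOn_univ.2 hγ) fun _ => contDiffOn_const)
  have hcs : ∀ i : Fin (j + 1), HasCompactSupport (fun x => γ x (i.removeNth v)) := fun i =>
    hc.comp_left (g := fun φ : Alt (j + 1) j => φ (i.removeNth v)) rfl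
  have hcd : ∀ i : Fin (j + 1),
      Continuous fun x => fderiv ℝ (fun y => γ y (i.removeNth v)) x (v i) := fun i =>
    ((hs i).continuous_fderiv (by simp)).clm_apply continuous_const
  have hint : ∀ i : Fin (j + 1), MeasureTheory.Integrable
      (fun x => fderiv ℝ (fun y => γ y (i.removeNth v)) x (v i)) := fun i =>
    (hcd i).integrable_of_hasCompactSupport ((hcs i).fderiv_apply ℝ (v i))
  have h0 : ∀ i : Fin (j + 1), ∫ x, fderiv ℝ (fun y => γ y (i.removeNth v)) x (v i) = 0 := by
    intro i
    have := integral_mul_fderiv_eq_neg_fderiv_mul_of_integrable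
      (f := fun _ : E (j + 1) => (1 : ℝ)) (g := fun y => γ y (i.removeNth v)) (v := v i)
      (μ := MeasureTheory.volume) (by simp) (by simpa using hint i)
      (by simpa using (hs i).continuous.integrable_of_hasCompactSupport (hcs i))
      (fun _ _ => differentiableAt_const _) (fun x _ => (hs i).differentiable (by simp) x)
    simpa using this
  have h1 : ∀ x, extDeriv γ x v = ∑ i : Fin (j + 1),
      (-1 : ℝ) ^ i.val * fderiv ℝ (fun y => γ y (i.removeNth v)) x (v i) := by
    intro x
    rw [extDeriv_apply (hd x) v]
    simp [zsmul_eq_mul]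
  simp_rw [h1]
  rw [MeasureTheory.integral_finsetSum _ fun i _ => (hint i).const_mul _]
  exact Finset.sum_eq_zero fun i _ => by rw [MeasureTheory.integral_const_mul, h0 i, mul_zero]

namespace HomogeneousLieGroup

variable (G : HomogeneousLieGroup n)

theorem exists_weightSpaceGE_eq_bot (k : ℕ) : ∃ w, ∀ φ ∈ G.weightSpaceGE k w, φ = 0 := by
  obtain ⟨w, hw⟩ := (G.weightFinset k).bddAbove
  refine ⟨w + 1, fun φ hφ => ?_⟩
  rw [← G.sum_proj φ]
  exact Finset.sum_eq_zero fun v hv => G.proj_eq_zero_of_mem_GE hφ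
    (by linarith [hw (Finset.mem_coe.2 hv)])

/-- Without cohomology in degree `j + 1`, weight raising kills every closed form completely and
yields a primitive by a local operator. For a bump top form on `ℝ^{j+1}`, pulled back to `ℝⁿ`,
restricting this primitive to a coordinate subspace gives a compactly supported primitive, although
the bump has positive integral. -/
theorem cohomologyWeights_succ_nonempty {j : ℕ} (hj : j + 1 ≤ n) :
    (G.cohomologyWeights (j + 1)).Nonempty := by
  by_contra hne
  rw [Set.not_nonempty_iff_eq_empty] at hne
  -- With `w` above all weights, raising the weight to `w` means reaching zero.
  obtain ⟨w, hw⟩ := G.exists_weightSpaceGE_eq_bot (j + 1)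
  obtain ⟨δ, hδ⟩ := G.exists_isPartialInverse j (Set.Iio w) (by simp [hne])
  let π : E n →L[ℝ] E (j + 1) :=
    ((EuclideanSpace.equiv (Fin (j + 1)) ℝ).symm : (Fin (j + 1) → ℝ) →L[ℝ] E (j + 1)).comp
      (ContinuousLinearMap.pi fun i => EuclideanSpace.proj (Fin.castLE hj i))
  let ι : E (j + 1) →L[ℝ] E n :=
    ∑ i, (EuclideanSpace.proj i : E (j + 1) →L[ℝ] ℝ).smulRight
      (EuclideanSpace.single (Fin.castLE hj i) (1 : ℝ))
  have hπι : ∀ y, π (ι y) = y := by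
    intro y
    ext i
    simp [π, ι, _root_.sum_apply, PiLp.single_apply]
  have hπι' : π.comp ι = ContinuousLinearMap.id ℝ _ := ContinuousLinearMap.ext hπι
  let f : ContDiffBump (0 : E (j + 1)) := default
  let D : Alt (j + 1) (j + 1) := toAlt (EuclideanSpace.basisFun (Fin (j + 1)) ℝ).toBasis.det
  let β₀ : Form (j + 1) (j + 1) := fun y => f y • D
  have hβ₀ : ContDiff ℝ ∞ β₀ := f.contDiff.smul contDiff_const
  let β : Form n (j + 1) := fun x => (β₀ (π x)).compContinuousLinearMap π
  have hβ : ContDiffOn ℝ ∞ β Set.univ :=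
    contDiffOn_alt_comp (contDiffOn_univ.2 (hβ₀.comp π.contDiff)) contDiffOn_const
  have hdβ : ∀ x ∈ Set.univ, extDeriv β x = 0 := by
    intro x _
    have h1 := extDeriv_pullback (f := π) (x := x)
      (show DifferentiableAt ℝ β₀ (π x) from hβ₀.differentiable (by simp) _)
      π.contDiff.contDiffAt minSmoothness_two_le
    rw [alt_succ_eq_zero (extDeriv β₀ (π x))] at h1
    simp only [π.fderiv] at h1
    refine h1.trans ?_
    ext v; simp
  set m := (G.weightFinset (j + 1)).card + 1
  set γ := G.liftCorr δ m β
  have hγ : ContDiff ℝ ∞ γ := contDiffOn_univ.1 (G.contDiffOn_liftCorr isOpen_univ hβ m)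
  have hγβ : ∀ x, extDeriv γ x = β x := by
    intro x
    have h1 := hw _ (G.toFrame_liftStep_iterate_mem hδ isOpen_univ (by omega) hβ hdβ
      (Set.mem_univ x))
    rw [toFrame_eq_zero_iff, G.liftStep_iterate_eq isOpen_univ hβ m (Set.mem_univ x)] at h1
    exact (sub_eq_zero.1 h1).symm
  let γ₀ : Form (j + 1) j := fun y => (γ (ι y)).compContinuousLinearMap ι
  have hγ₀ : ContDiff ℝ ∞ γ₀ := contDiffOn_univ.1
    (contDiffOn_alt_comp (contDiffOn_univ.2 (hγ.comp ι.contDiff)) contDiffOn_const)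
  have hdγ₀ : ∀ y, extDeriv γ₀ y = β₀ y := by
    intro y
    have h1 := extDeriv_pullback (f := ι) (x := y)
      (show DifferentiableAt ℝ γ (ι y) from hγ.differentiable (by simp) _)
      ι.contDiff.contDiffAt minSmoothness_two_le
    simp only [ι.fderiv] at h1
    refine h1.trans ?_
    rw [hγβ]
    change ((β₀ (π (ι y))).compContinuousLinearMap π).compContinuousLinearMap ι = _
    rw [hπι]
    ext v
    change β₀ y (fun i => π (ι (v i))) = _
    simp_rw [hπι]
  -- The form `β` has noncompact support in `ℝⁿ`, but locality makes `γ` vanish over the complement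
  -- of the support of `f`, and `ι` is a section of `π`.
  have hcs : HasCompactSupport γ₀ := by
    refine HasCompactSupport.intro (K := tsupport f) f.hasCompactSupport fun y hy => ?_
    have hU : IsOpen (π ⁻¹' (tsupport f)ᶜ) :=
      (isClosed_tsupport _).isOpen_compl.preimage π.continuous
    have h1 : γ (ι y) = 0 := by
      refine G.liftCorr_eq_zero hU (fun x hx => ?_) m (show ι y ∈ _ from ?_)
      · have h2 : f (π x) = 0 := image_eq_zero_of_notMem_tsupport hx
        change (f (π x) • D).compContinuousLinearMap π = 0
        rw [h2, zero_smul]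
        ext v; simp
      · change π (ι y) ∈ (tsupport f)ᶜ
        rwa [hπι]
    change (γ (ι y)).compContinuousLinearMap ι = 0
    rw [h1]
    ext v; simp
  have h0 := integral_extDeriv_eq_zero hγ₀ hcs (EuclideanSpace.basisFun (Fin (j + 1)) ℝ).toBasis
  have h1 : ∀ y, extDeriv γ₀ y (EuclideanSpace.basisFun (Fin (j + 1)) ℝ).toBasis = f y := by
    intro y
    rw [hdγ₀]
    change f y • (EuclideanSpace.basisFun (Fin (j + 1)) ℝ).toBasis.det _ = _
    rw [Module.Basis.det_self, smul_eq_mul, mul_one]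
  simp_rw [h1] at h0
  exact (f.integral_pos (μ := MeasureTheory.volume)).ne' h0

theorem zero_mem_cohomologyWeights_zero : 0 ∈ G.cohomologyWeights 0 := by
  let φ : Alt n 0 := ContinuousAlternatingMap.constOfIsEmpty ℝ (E n) (Fin 0) (1 : ℝ)
  refine G.mem_cohomologyWeights_iff.2 ⟨φ, ⟨fun s => ?_, ?_⟩, fun h => ?_⟩
  · ext v
    simp [φ]
  · have h1 : G.leftInvariant φ = fun _ => φ := by
      funext x
      ext v
      simp [leftInvariant, φ]
    change _root_.extDeriv (G.leftInvariant φ) 0 = 0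
    rw [h1]
    change ContinuousAlternatingMap.alternatizeUncurryFinCLM ℝ (E n) ℝ (fderiv ℝ _ 0) = 0
    rw [fderiv_const_apply, map_zero]
  · have h1 : φ = 0 := h
    have := congrArg (fun f : Alt n 0 => f 0) h1
    simp [φ] at this

theorem cohomologyWeights_nonempty {k : ℕ} (hk : k ≤ n) : (G.cohomologyWeights k).Nonempty := by
  cases k with
  | zero => exact ⟨0, G.zero_mem_cohomologyWeights_zero⟩
  | succ j => exact G.cohomologyWeights_succ_nonempty hk

theorem wMin_mem {k : ℕ} (hk : k ≤ n) : G.wMin k ∈ G.cohomologyWeights k :=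
  (G.cohomologyWeights_nonempty hk).csInf_mem (G.finite_cohomologyWeights k)

theorem wMax_mem {k : ℕ} (hk : k ≤ n) : G.wMax k ∈ G.cohomologyWeights k :=
  (G.cohomologyWeights_nonempty hk).csSup_mem (G.finite_cohomologyWeights k)

theorem notMem_cohomologyWeights_of_lt_wMin {k : ℕ} {v : ℝ} (h : v < G.wMin k) :
    v ∉ G.cohomologyWeights k :=
  notMem_of_lt_csInf h (G.finite_cohomologyWeights k).bddBelow

theorem notMem_cohomologyWeights_of_wMax_lt {k : ℕ} {v : ℝ} (h : G.wMax k < v) :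
    v ∉ G.cohomologyWeights k :=
  notMem_of_csSup_lt h (G.finite_cohomologyWeights k).bddAbove

end HomogeneousLieGroup

namespace HomogeneousLieGroup

variable {n : ℕ} (G : HomogeneousLieGroup n)

/-! ### The flow of the dilations -/

theorem dil_apply (s : ℝ) (x : E n) (i : Fin n) : G.dil s x i = Real.exp (s * G.wt i) * x i :=
  diagMap_apply _ _ _

theorem xi_apply (x : E n) (i : Fin n) : G.xi x i = G.wt i * x i := diagMap_apply _ _ _

theorem dil_zero (x : E n) : G.dil 0 x = x := by
  ext i
  simp [dil_apply]

theorem hasDerivAt_dil (x : E n) : HasDerivAt (fun s => G.dil s x) (G.xi x) 0 := by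
  have h1 : HasDerivAt (fun s : ℝ => ∑ i, (Real.exp (s * G.wt i) * x i) •
      EuclideanSpace.single i (1 : ℝ))
      (∑ i, (G.wt i * x i) • EuclideanSpace.single i (1 : ℝ)) 0 := by
    refine HasDerivAt.fun_sum fun i _ => HasDerivAt.smul_const ?_ _
    have h2 := (((hasDerivAt_id (0 : ℝ)).mul_const (G.wt i)).exp).mul_const (x i)
    simpa using h2
  convert h1 using 1
  · funext s
    ext j
    simp [dil_apply, Pi.single_apply]
  · ext j
    simp [xi_apply, Pi.single_apply]

variable {G} in
/-- The Lie derivative of a homogeneous form along the generator of the dilations. -/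
theorem IsHomogeneous.lieDeriv {k : ℕ} {lam : ℝ} {θ : Form n k} (h : G.IsHomogeneous lam θ)
    {x : E n} (hx : x ≠ 0) (v : Fin k → E n) :
    fderiv ℝ θ x (G.xi x) v + ∑ i, θ x (Function.update v i (G.xi (v i))) = lam * θ x v := by
  have hd : DifferentiableAt ℝ θ (G.dil 0 x) := by
    rw [dil_zero]
    exact differentiableAt_of_contDiffOn isOpen_compl_zero h.1 hx
  have h1 : HasDerivAt (fun s => θ (G.dil s x)) (fderiv ℝ θ (G.dil 0 x) (G.xi x)) 0 :=
    hd.hasFDerivAt.comp_hasDerivAt 0 (G.hasDerivAt_dil x)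
  have h2 := fderiv_continuousAlternatingMap_apply_apply (𝕜 := ℝ) (f := fun s => θ (G.dil s x))
    (g := fun i s => G.dil s (v i)) h1.differentiableAt
    (fun i => (G.hasDerivAt_dil (v i)).differentiableAt) 1
  have h3 : ∀ s, θ (G.dil s x) (fun i => G.dil s (v i)) = Real.exp (s * lam) * θ x v := fun s =>
    congrArg (fun f => f v) (h.2 s x hx)
  have h4 : HasDerivAt (fun s => Real.exp (s * lam) * θ x v) (lam * θ x v) 0 := by
    simpa using (((hasDerivAt_id (0 : ℝ)).mul_const lam).exp).mul_const (θ x v)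
  simp_rw [h3, fderiv_apply_one_eq_deriv, h4.deriv, h1.deriv, (G.hasDerivAt_dil _).deriv,
    dil_zero] at h2
  exact h2.symm

/-- Contraction of a form with the generator of the dilations. -/
def contract {k : ℕ} (θ : Form n (k + 1)) : Form n k := fun x => (θ x).curryLeft (G.xi x)

variable {G}

theorem contDiffOn_contract {k : ℕ} {θ : Form n (k + 1)} {U : Set (E n)}
    (h : ContDiffOn ℝ ∞ θ U) : ContDiffOn ℝ ∞ (G.contract θ) U := by
  refine contDiffOn_alt fun I => contDiffOn_alt_apply
    (v := fun j x => (Matrix.vecCons (G.xi x) (basisTuple I) : Fin (k + 1) → E n) j) h fun j => ?_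
  refine Fin.cases ?_ (fun j => ?_) j
  · exact (diagMap G.wt).contDiff.contDiffOn
  · exact contDiffOn_const

theorem IsHomogeneous.contract {k : ℕ} {lam : ℝ} {θ : Form n (k + 1)}
    (h : G.IsHomogeneous lam θ) : G.IsHomogeneous lam (G.contract θ) := by
  refine ⟨contDiffOn_contract h.1, fun s x hx => ?_⟩
  ext v
  have h1 := congrArg (fun f => f (Matrix.vecCons (G.xi x) v)) (h.2 s x hx)
  refine Eq.trans ?_ h1
  change θ (G.dil s x) (Matrix.vecCons (G.xi (G.dil s x)) _) =
    θ (G.dil s x) (fun i => G.dil s (Matrix.vecCons (G.xi x) v i))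
  congr 1
  funext i
  refine Fin.cases ?_ (fun j => rfl) i
  ext j
  simp only [Matrix.cons_val_zero, dil_apply, xi_apply]
  ring

/-- Cartan's formula for closed homogeneous forms. -/
theorem IsHomogeneous.extDeriv_contract {k : ℕ} {lam : ℝ} {θ : Form n (k + 1)}
    (h : G.IsHomogeneous lam θ) {x : E n} (hx : x ≠ 0) (hc : _root_.extDeriv θ x = 0) :
    _root_.extDeriv (G.contract θ) x = lam • θ x := by
  have hd : DifferentiableAt ℝ θ x := differentiableAt_of_contDiffOn isOpen_compl_zero h.1 hx
  ext v
  rw [extDeriv_apply (differentiableAt_of_contDiffOn isOpen_compl_zero h.contract.1 hx),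
    ContinuousAlternatingMap.smul_apply, smul_eq_mul, ← h.lieDeriv hx v]
  have h1 : ∀ i : Fin (k + 1), (-1) ^ (i : ℕ) •
      fderiv ℝ (fun y => G.contract θ y (i.removeNth v)) x (v i) =
      (-1) ^ (i : ℕ) • fderiv ℝ θ x (v i) (Matrix.vecCons (G.xi x) (i.removeNth v)) +
        θ x (Function.update v i (G.xi (v i))) := by
    intro i
    have h2 := fderiv_continuousAlternatingMap_apply_apply (𝕜 := ℝ) (f := θ) (x := x)
      (g := fun j y => (Matrix.vecCons (G.xi y) (i.removeNth v) : Fin (k + 1) → E n) j) hd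
      (fun j => by
        refine Fin.cases ?_ (fun j => ?_) j
        · exact (diagMap G.wt).differentiableAt
        · exact differentiableAt_const _) (v i)
    have h3 : fderiv ℝ (fun y => G.contract θ y (i.removeNth v)) x (v i) =
      fderiv ℝ θ x (v i) (Matrix.vecCons (G.xi x) (i.removeNth v)) +
        θ x (Matrix.vecCons (G.xi (v i)) (i.removeNth v)) := by
      refine h2.trans ?_
      congr 1
      rw [Fin.sum_univ_succ, Finset.sum_eq_zero, add_zero]
      · congr 1
        have h4 : fderiv ℝ (fun y => G.xi y) x (v i) = G.xi (v i) := by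
          change fderiv ℝ (diagMap G.wt) x (v i) = _
          rw [(diagMap G.wt).fderiv]
          rfl
        funext j
        refine Fin.cases ?_ (fun j => ?_) j
        · simpa using h4
        · simp
      · intro j _
        have h4 : fderiv ℝ (fun y => (Matrix.vecCons (G.xi y) (i.removeNth v) :
            Fin (k + 1) → E n) j.succ) x (v i) = 0 := by
          simp
        rw [h4]
        exact (θ x).toMultilinearMap.map_update_zero _ _
    rw [h3, smul_add]
    congr 1
    -- Moving the first argument back to position `i` absorbs the sign `(-1)^i`; these terms form
    -- the algebraic part of the Lie derivative.
    rw [← ContinuousAlternatingMap.map_insertNth, Fin.insertNth_removeNth]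
  rw [Finset.sum_congr rfl fun i _ => h1 i, Finset.sum_add_distrib]
  congr 1
  -- The contraction with `ξ` of `dθ = 0`: its leading term is the derivative of `θ` along `ξ`, and
  -- the others match the remaining sum.
  have h5 := congrArg (fun f => f (Matrix.vecCons (G.xi x) v)) hc
  change ContinuousAlternatingMap.alternatizeUncurryFin (fderiv ℝ θ x) _ = 0 at h5
  rw [ContinuousAlternatingMap.alternatizeUncurryFin_apply, Fin.sum_univ_succ] at h5
  have h6 : ∀ i : Fin (k + 1), (i.succ).removeNth (Matrix.vecCons (G.xi x) v) =
      Matrix.vecCons (G.xi x) (i.removeNth v) := by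
    intro i
    funext j
    refine Fin.cases ?_ (fun j => ?_) j
    · simp [Fin.removeNth]
    · simp [Fin.removeNth]
  simp only [h6, Fin.val_succ, pow_succ, mul_neg, mul_one, neg_smul, Finset.sum_neg_distrib,
    Matrix.cons_val_succ, Fin.val_zero, pow_zero, one_smul, Matrix.cons_val_zero] at h5
  rw [add_neg_eq_zero] at h5
  rw [← h5]
  rfl

theorem isHomogeneous_leftInvariant {k : ℕ} {w : ℝ} {φ : Alt n k} (h : φ ∈ G.weightSpace k w) :
    G.IsHomogeneous w (G.leftInvariant φ) := by
  refine ⟨G.contDiffOn_leftInvariant φ _, fun s x _ => ?_⟩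
  rw [leftInvariant_eq_ofFrame, ofFrame, comp_comp_alt, leftDiffInv_dil, ← comp_comp_alt, h s]
  rfl

theorem extDeriv_leftInvariant {k : ℕ} {φ : Alt n k} (h : G.d₀ k φ = 0) (x : E n) :
    _root_.extDeriv (G.leftInvariant φ) x = 0 := by
  rw [← G.toFrame_eq_zero_iff, G.toFrame_extDeriv (G.differentiable_leftInvariant φ x)]
  simp only [toFrame_leftInvariant, h, zero_add]
  change ContinuousAlternatingMap.alternatizeUncurryFinCLM ℝ (E n) ℝ (fderiv ℝ _ 0) = 0
  rw [fderiv_const_apply, map_zero]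

/-! ### A logarithmic gauge -/

variable (G)

/-- The squared Euclidean norm of `h_s x`. -/
def dilNormSq (p : E n × ℝ) : ℝ := ∑ i, Real.exp (2 * p.2 * G.wt i) * p.1 i ^ 2

theorem contDiff_dilNormSq : ContDiff ℝ ∞ G.dilNormSq := by
  unfold dilNormSq
  refine ContDiff.sum fun i _ => ?_
  have h : ContDiff ℝ ∞ fun p : E n × ℝ => p.1 i :=
    (EuclideanSpace.proj i : E n →L[ℝ] ℝ).contDiff.comp contDiff_fst
  exact (((contDiff_const.mul contDiff_snd).mul contDiff_const).exp).mul (h.pow 2)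

theorem dilNormSq_dil (s t : ℝ) (x : E n) :
    G.dilNormSq (G.dil s x, t) = G.dilNormSq (x, t + s) := by
  refine Finset.sum_congr rfl fun i _ => ?_
  simp only [dil_apply, mul_pow]
  rw [← _root_.mul_assoc, ← Real.exp_nat_mul, ← Real.exp_add]
  congr 2
  push_cast
  ring

theorem exists_coord_ne_zero {x : E n} (hx : x ≠ 0) : ∃ i, x i ≠ 0 := by
  by_contra! h
  exact hx (by ext i; simpa using h i)

theorem sum_mul_sq_pos {c : Fin n → ℝ} (hc : ∀ i, 0 < c i) {x : E n} (hx : x ≠ 0) :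
    0 < ∑ i, c i * x i ^ 2 := by
  obtain ⟨i, hi⟩ := exists_coord_ne_zero hx
  exact Finset.sum_pos' (fun j _ => mul_nonneg (hc j).le (sq_nonneg _))
    ⟨i, Finset.mem_univ i, mul_pos (hc i) (by positivity)⟩

theorem strictMono_dilNormSq {x : E n} (hx : x ≠ 0) : StrictMono fun t => G.dilNormSq (x, t) := by
  intro s t hst
  obtain ⟨i, hi⟩ := exists_coord_ne_zero hx
  have h : ∀ j, Real.exp (2 * s * G.wt j) < Real.exp (2 * t * G.wt j) := fun j =>
    Real.exp_lt_exp.2 (by nlinarith [G.wt_pos j])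
  refine Finset.sum_lt_sum (fun j _ => mul_le_mul_of_nonneg_right (h j).le (sq_nonneg _))
    ⟨i, Finset.mem_univ i, mul_lt_mul_of_pos_right (h i) (by positivity)⟩

theorem exists_dilNormSq_eq_one {x : E n} (hx : x ≠ 0) : ∃ t, G.dilNormSq (x, t) = 1 := by
  obtain ⟨i, hi⟩ := exists_coord_ne_zero hx
  have hcont : Continuous fun t => G.dilNormSq (x, t) :=
    G.contDiff_dilNormSq.continuous.comp (by fun_prop)
  have hbot : Filter.Tendsto (fun t => G.dilNormSq (x, t)) Filter.atBot (nhds 0) := by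
    have h1 : ∀ j ∈ Finset.univ, Filter.Tendsto
        (fun t => Real.exp (2 * t * G.wt j) * x j ^ 2) Filter.atBot (nhds 0) := by
      intro j _
      rw [← MulZeroClass.zero_mul (x j ^ 2)]
      refine Filter.Tendsto.mul_const _ (Real.tendsto_exp_atBot.comp ?_)
      exact (Filter.tendsto_id.const_mul_atBot two_pos).atBot_mul_const (G.wt_pos j)
    simpa [dilNormSq] using tendsto_finsetSum _ h1
  have htop : Filter.Tendsto (fun t => G.dilNormSq (x, t)) Filter.atTop Filter.atTop := by
    refine Filter.tendsto_atTop_mono (f := fun t => Real.exp (2 * t * G.wt i) * x i ^ 2)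
      (fun t => Finset.single_le_sum (f := fun i => Real.exp (2 * t * G.wt i) * x i ^ 2)
        (fun j _ => by positivity) (Finset.mem_univ i)) ?_
    refine Filter.Tendsto.atTop_mul_const (by positivity) (Real.tendsto_exp_atTop.comp ?_)
    exact (Filter.tendsto_id.const_mul_atTop two_pos).atTop_mul_const (G.wt_pos i)
  obtain ⟨a, ha⟩ := (hbot.eventually (gt_mem_nhds (show (0 : ℝ) < 1 by norm_num))).exists
  obtain ⟨b, hb⟩ := (htop.eventually (Filter.eventually_gt_atTop 1)).exists
  exact mem_range_of_exists_le_of_exists_ge hcont ⟨a, ha.le⟩ ⟨b, hb.le⟩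

/-- There is a smooth function `ρ` on the complement of the origin with `ρ (h_s x) = ρ x + s`. -/
theorem exists_logGauge : ∃ ρ : E n → ℝ, ContDiffOn ℝ ∞ ρ {0}ᶜ ∧
    ∀ (s : ℝ) (x : E n), x ≠ 0 → ρ (G.dil s x) = ρ x + s := by
  classical
  choose! t ht using fun (x : E n) (hx : x ≠ 0) => G.exists_dilNormSq_eq_one hx
  -- Here `t x` is the unique time at which the dilation orbit of `x` meets the unit sphere;
  -- starting from `h_s x` shortens it by `s`.
  refine ⟨fun x => -t x, ?_, fun s x hx => ?_⟩
  · intro x hx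
    refine ContDiffAt.contDiffWithinAt (ContDiffAt.neg ?_)
    have hx' : x ≠ 0 := hx
    have hcd : ContDiffAt ℝ ∞ G.dilNormSq (x, t x) := G.contDiff_dilNormSq.contDiffAt
    have hpos : 0 < ∑ i, (2 * G.wt i * Real.exp (2 * t x * G.wt i)) * x i ^ 2 :=
      sum_mul_sq_pos (fun i => by have := G.wt_pos i; positivity) hx'
    have hder : fderiv ℝ G.dilNormSq (x, t x) (0, 1) =
        ∑ i, (2 * G.wt i * Real.exp (2 * t x * G.wt i)) * x i ^ 2 := by
      have h1 : HasDerivAt (fun r : ℝ => (x, r)) ((0 : E n), (1 : ℝ)) (t x) :=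
        (hasDerivAt_const _ _).prodMk (hasDerivAt_id _)
      have h2 := (hcd.differentiableAt (by simp)).hasFDerivAt.comp_hasDerivAt (t x) h1
      refine h2.unique ?_
      change HasDerivAt (fun r : ℝ => ∑ i, Real.exp (2 * r * G.wt i) * x i ^ 2) _ (t x)
      refine HasDerivAt.fun_sum fun i _ => HasDerivAt.mul_const ?_ _
      have h3 := (((hasDerivAt_id (t x)).const_mul 2).mul_const (G.wt i)).exp
      refine HasDerivAt.congr_deriv h3 ?_
      simp only [id]
      ring
    -- The derivative in time is positive because all weights are, so the implicit function theorem
    -- applies; strict monotonicity identifies its solution with `t`.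
    have hinv : (fderiv ℝ G.dilNormSq (x, t x) ∘L .inr ℝ (E n) ℝ).IsInvertible := by
      refine ⟨ContinuousLinearEquiv.unitsEquivAut ℝ (Units.mk0 _ (hder ▸ hpos.ne')),
        ContinuousLinearMap.ext_ring ?_⟩
      simp
    have hne : (∞ : ℕ∞ω) ≠ 0 := by simp
    refine (hcd.contDiffAt_implicitFunction hne hinv).congr_of_eventuallyEq ?_
    filter_upwards [hcd.eventually_apply_implicitFunction hne hinv,
      isOpen_compl_zero.mem_nhds hx] with y hy hy0
    refine (G.strictMono_dilNormSq (show y ≠ 0 from hy0)).injective ?_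
    rw [hy, ht y hy0, ht x hx']
  · have h1 := ht (G.dil s x) (G.dil_ne_zero hx)
    rw [dilNormSq_dil] at h1
    have h2 : t (G.dil s x) + s = t x := (G.strictMono_dilNormSq hx).injective
      (show G.dilNormSq _ = G.dilNormSq _ by rw [h1, ht x hx])
    linarith

end HomogeneousLieGroup

variable {n : ℕ}

/-! ### Families of forms depending polynomially on a parameter, up to an exponential factor -/

theorem alternatizeUncurryFin_eq {k : ℕ} (A : E n →L[ℝ] Alt n k) :
    ContinuousAlternatingMap.alternatizeUncurryFin A =
      ContinuousAlternatingMap.alternatizeUncurryFinCLM ℝ (E n) ℝ A := rfl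

theorem extDeriv_function_smul {k : ℕ} {g : E n → ℝ} {α : Form n k} {x : E n}
    (hg : DifferentiableAt ℝ g x) (hα : DifferentiableAt ℝ α x) :
    extDeriv (fun y => g y • α y) x = g x • extDeriv α x +
      ContinuousAlternatingMap.alternatizeUncurryFin ((fderiv ℝ g x).smulRight (α x)) := by
  rw [extDeriv, extDeriv, fderiv_fun_smul hg hα]
  simp only [alternatizeUncurryFin_eq, map_add, map_smul]

/-- Families of the form `e^{μ ρ} (c₀ + μ c₁ + … + μᴺ c_N)` with smooth forms `cᵢ` on the complement
of the origin. -/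
inductive ExpPoly (ρ : E n → ℝ) (k : ℕ) : (ℝ → Form n k) → Prop
  | base (c : Form n k) (hc : ContDiffOn ℝ ∞ c {0}ᶜ) :
      ExpPoly ρ k fun μ x => Real.exp (μ * ρ x) • c x
  | add (F F' : ℝ → Form n k) (hF : ExpPoly ρ k F) (hF' : ExpPoly ρ k F') :
      ExpPoly ρ k fun μ => F μ + F' μ
  | smul (F : ℝ → Form n k) (hF : ExpPoly ρ k F) : ExpPoly ρ k fun μ => μ • F μ
  | congr (F F' : ℝ → Form n k) (hF : ExpPoly ρ k F) (h : ∀ μ, ∀ x ≠ 0, F' μ x = F μ x) :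
      ExpPoly ρ k F'

namespace ExpPoly

variable {ρ : E n → ℝ} {k : ℕ} {F F' : ℝ → Form n k}

theorem contDiffOn (hρ : ContDiffOn ℝ ∞ ρ {0}ᶜ) (hF : ExpPoly ρ k F) (μ : ℝ) :
    ContDiffOn ℝ ∞ (F μ) {0}ᶜ := by
  induction hF with
  | base c hc => exact ((contDiffOn_const.mul hρ).exp).smul hc
  | add F F' _ _ ih ih' => exact ih.add ih'
  | smul F _ ih => exact contDiffOn_const.smul ih
  | congr F F' _ h ih => exact ih.congr fun x hx => h μ x hx

theorem extDeriv (hρ : ContDiffOn ℝ ∞ ρ {0}ᶜ) (hF : ExpPoly ρ k F) :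
    ExpPoly ρ (k + 1) fun μ => _root_.extDeriv (F μ) := by
  have hU := HomogeneousLieGroup.isOpen_compl_zero (n := n)
  induction hF with
  | base c hc =>
    have h0 : ContDiffOn ℝ ∞ (fun x => (fderiv ℝ ρ x).smulRight (c x)) {0}ᶜ :=
      (hρ.fderiv_of_isOpen hU (by exact right_eq_inf.mp rfl)).smulRight hc
    have hA : ContDiff ℝ ∞
        (ContinuousAlternatingMap.alternatizeUncurryFinCLM (n := k) ℝ (E n) ℝ) :=
      ContinuousLinearMap.contDiff _
    have h1 : ContDiffOn ℝ ∞ (fun x => ContinuousAlternatingMap.alternatizeUncurryFin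
        ((fderiv ℝ ρ x).smulRight (c x))) {0}ᶜ := hA.comp_contDiffOn h0
    refine congr _ _ (add _ _ (base _ (contDiffOn_extDeriv hU hc)) (smul _ (base _ h1)))
      fun μ x hx => ?_
    have hρx : DifferentiableAt ℝ ρ x :=
      (hρ.contDiffAt (hU.mem_nhds hx)).differentiableAt (by simp)
    rw [extDeriv_function_smul ((hρx.const_mul μ).exp)
      (differentiableAt_of_contDiffOn hU hc hx)]
    congr 1
    have h2 : fderiv ℝ (fun y => Real.exp (μ * ρ y)) x =
        (Real.exp (μ * ρ x) * μ) • fderiv ℝ ρ x := by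
      rw [fderiv_exp (hρx.const_mul μ), fderiv_const_mul hρx, smul_smul]
    have h3 : (fderiv ℝ (fun y => Real.exp (μ * ρ y)) x).smulRight (c x) =
        (Real.exp (μ * ρ x) * μ) • (fderiv ℝ ρ x).smulRight (c x) := by
      rw [h2]
      ext v w
      simp [_root_.mul_assoc]
    rw [h3, alternatizeUncurryFin_eq, map_smul, mul_comm, mul_smul]
    rfl
  | add F F' hF hF' ih ih' =>
    exact congr _ _ (add _ _ ih ih') fun μ x hx => extDeriv_add
      (differentiableAt_of_contDiffOn hU (hF.contDiffOn hρ μ) hx)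
      (differentiableAt_of_contDiffOn hU (hF'.contDiffOn hρ μ) hx)
  | smul F hF ih =>
    exact congr _ _ (smul _ ih) fun μ x _ => extDeriv_smul μ (F μ)
  | congr F F' _ h ih =>
    exact congr _ _ ih fun μ x hx => extDeriv_eq_of_eqOn hU (fun y hy => h μ y hy) hx

theorem map {l : ℕ} (T : Form n k → Form n l)
    (hT : ∀ c, ContDiffOn ℝ ∞ c {0}ᶜ → ContDiffOn ℝ ∞ (T c) {0}ᶜ)
    (hL : ∀ x, ∃ L : Alt n k →ₗ[ℝ] Alt n l, ∀ α : Form n k, T α x = L (α x))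
    (hF : ExpPoly ρ k F) : ExpPoly ρ l fun μ => T (F μ) := by
  choose L hL using hL
  induction hF with
  | base c hc =>
    exact congr _ _ (base _ (hT c hc)) fun μ x _ => by rw [hL, hL, map_smul]
  | add F F' _ _ ih ih' =>
    refine congr _ _ (add _ _ ih ih') fun μ x _ => ?_
    change T (F μ + F' μ) x = T (F μ) x + T (F' μ) x
    rw [hL, hL, hL, Pi.add_apply, map_add]
  | smul F _ ih =>
    refine congr _ _ (smul _ ih) fun μ x _ => ?_
    change T (μ • F μ) x = μ • T (F μ) x
    rw [hL, hL, Pi.smul_apply, map_smul]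
  | congr F F' _ h ih => exact congr _ _ ih fun μ x hx => by rw [hL, hL, h μ x hx]

theorem sub (hF : ExpPoly ρ k F) (hF' : ExpPoly ρ k F') : ExpPoly ρ k fun μ => F μ - F' μ := by
  have h1 : ExpPoly ρ k fun μ => -F' μ :=
    hF'.map (fun α => -α) (fun _ hc => hc.neg) fun _ => ⟨-LinearMap.id, fun _ => rfl⟩
  exact congr _ _ (add _ _ hF h1) fun μ x _ => by rw [sub_eq_add_neg]

theorem frameMap (G : HomogeneousLieGroup n) {l : ℕ} (δ : Alt n k →ₗ[ℝ] Alt n l)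
    (hF : ExpPoly ρ k F) : ExpPoly ρ l fun μ => G.frameMap δ (F μ) :=
  hF.map _ (fun _ hc => G.contDiffOn_frameMap δ hc) fun x =>
    ⟨(ContinuousAlternatingMap.compContinuousLinearMapₗ (G.leftDiffInv x)).comp
      (δ.comp (ContinuousAlternatingMap.compContinuousLinearMapₗ (G.leftDiff x))), fun _ => rfl⟩

theorem liftStep_iterate (G : HomogeneousLieGroup n) (hρ : ContDiffOn ℝ ∞ ρ {0}ᶜ)
    {F : ℝ → Form n (k + 1)} (δ : Alt n (k + 1) →ₗ[ℝ] Alt n k) (hF : ExpPoly ρ (k + 1) F) (m : ℕ) :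
    ExpPoly ρ (k + 1) fun μ => (G.liftStep δ)^[m] (F μ) := by
  induction m with
  | zero => exact hF
  | succ m ih =>
    simp only [Function.iterate_succ_apply']
    exact ih.sub ((ih.frameMap G δ).extDeriv hρ)

/-- The reason for `ExpPoly`: the class is stable under `d` (each derivative of `e^{μρ}` costs a
factor `μ`) and under fibrewise linear maps, hence under weight raising, yet its pointwise values
have few zeros in `μ`. -/
theorem exists_polynomial (hF : ExpPoly ρ k F) {x : E n} (hx : x ≠ 0) (L : Alt n k →ₗ[ℝ] ℝ) :
    ∃ p : Polynomial ℝ, ∀ μ, L (F μ x) = Real.exp (μ * ρ x) * p.eval μ := by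
  induction hF with
  | base c hc => exact ⟨Polynomial.C (L (c x)), fun μ => by simp⟩
  | add F F' _ _ ih ih' =>
    obtain ⟨p, hp⟩ := ih
    obtain ⟨p', hp'⟩ := ih'
    refine ⟨p + p', fun μ => ?_⟩
    change L (F μ x + F' μ x) = _
    rw [map_add, hp, hp', Polynomial.eval_add, mul_add]
  | smul F _ ih =>
    obtain ⟨p, hp⟩ := ih
    refine ⟨Polynomial.X * p, fun μ => ?_⟩
    change L (μ • F μ x) = _
    rw [map_smul, hp, Polynomial.eval_mul, Polynomial.eval_X, smul_eq_mul]
    ring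
  | congr F F' _ h ih =>
    obtain ⟨p, hp⟩ := ih
    exact ⟨p, fun μ => by rw [h μ x hx, hp]⟩

/-- If the value at `μ = 0` of a linear functional of the family at `x` does not vanish, then it
vanishes for finitely many `μ` only. -/
theorem finite_zeros (hF : ExpPoly ρ k F) {x : E n} (hx : x ≠ 0) (L : Alt n k →ₗ[ℝ] ℝ)
    (h0 : L (F 0 x) ≠ 0) : {μ | L (F μ x) = 0}.Finite := by
  obtain ⟨p, hp⟩ := hF.exists_polynomial hx L
  have hp0 : p ≠ 0 := by
    rintro rfl
    exact h0 (by rw [hp, Polynomial.eval_zero, mul_zero])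
  refine (p.roots.toFinset.finite_toSet).subset fun μ hμ => ?_
  rw [Set.mem_ofPred_eq, hp, mul_eq_zero] at hμ
  simpa [hp0, Polynomial.IsRoot] using hμ.resolve_left (Real.exp_ne_zero _)

end ExpPoly

/-! ### Functions times forms, and the integral over the sphere -/

theorem contDiffOn_topWedge {p q : ℕ} (h : p + q = n) {α : Form n p} {β : Form n q}
    {U : Set (E n)} (hα : ContDiffOn ℝ ∞ α U) (hβ : ContDiffOn ℝ ∞ β U) :
    ContDiffOn ℝ ∞ (fun x => topWedge h (α x) (β x)) U := by
  have h1 : ∀ x, topWedge h (α x) (β x) = (p.factorial * q.factorial : ℝ)⁻¹ *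
      altSum (fun w : Fin p ⊕ Fin q → E n => α x (w ∘ Sum.inl) * β x (w ∘ Sum.inr))
        ((basisTuple id : Fin n → E n) ∘ splitEquiv h) := fun x => by
    rw [← topWedge_eq_altSum, inv_mul_cancel_left₀ (factorial_mul_ne_zero p q)]
  simp only [h1, altSum]
  exact contDiffOn_const.mul (ContDiffOn.sum fun σ _ => contDiffOn_const.mul
    ((contDiffOn_alt_apply hα fun _ => contDiffOn_const).mul
      (contDiffOn_alt_apply hβ fun _ => contDiffOn_const)))

theorem alternatingMap_update_basisTuple {f : E n [⋀^Fin n]→ₗ[ℝ] ℝ} (i : Fin n) (y : E n) :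
    f (Function.update (basisTuple id) i y) = y i * f (basisTuple id) := by
  have h1 : y = ∑ j, y j • (basisTuple id : Fin n → E n) j := by
    ext l
    simp [basisTuple, Pi.single_apply]
  conv_lhs => rw [h1]
  rw [f.map_update_sum, Finset.sum_eq_single i]
  · rw [f.map_update_smul, Function.update_eq_self, smul_eq_mul]
  · intro j _ hj
    rw [f.map_update_smul, f.map_update_self _ hj.symm, smul_zero]
  · simp

namespace HomogeneousLieGroup

variable {G : HomogeneousLieGroup n}

/-- Contracting a top form with `ξ` gives the flux form of a multiple of `ξ`, whose radial component
is `∑ d_i x_i²`. The positivity of this factor off the origin expresses the transversality of `ξ` to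
spheres. -/
theorem sum_curryLeft_xi {r : ℕ} (hr : r + 1 = n) (f : E n [⋀^Fin (r + 1)]→ₗ[ℝ] ℝ) (x : E n) :
    (∑ i : Fin (r + 1), (-1 : ℝ) ^ (i : ℕ) * x (Fin.cast hr i) *
      f.curryLeft (G.xi x)
        (fun j : Fin r => EuclideanSpace.single (Fin.cast hr (i.succAbove j)) (1 : ℝ))) =
      f (basisTuple (Fin.cast hr)) * ∑ i, G.wt i * x i ^ 2 := by
  subst hr
  rw [Finset.mul_sum]
  refine Finset.sum_congr rfl fun i _ => ?_
  have h1 : f.curryLeft (G.xi x)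
      (fun j : Fin r => EuclideanSpace.single (Fin.cast rfl (i.succAbove j)) (1 : ℝ)) =
      (-1 : ℝ) ^ (i : ℕ) * (G.wt i * x i * f (basisTuple id)) := by
    rw [← xi_apply, ← alternatingMap_update_basisTuple]
    change f (Matrix.vecCons (G.xi x) (i.removeNth (basisTuple id))) = _
    rw [← f.neg_one_pow_smul_map_insertNth i, Fin.insertNth_removeNth, zsmul_eq_mul]
    push_cast
    rfl
  rw [h1]
  have h2 : ((-1 : ℝ) ^ (i : ℕ)) * (-1) ^ (i : ℕ) = 1 := by
    rw [← mul_pow]; simp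
  change (-1 : ℝ) ^ (i : ℕ) * x i * _ = f (basisTuple id) * _
  linear_combination (x i * (G.wt i * x i * f (basisTuple id))) * h2

theorem pairing_eq {a b : ℕ} (hn : a + b + 1 = n) (h : a + 1 + b = n) (β : Form n (a + 1))
    (β' : Form n b) : G.pairing (Nat.add_right_comm a 1 b) hn β β' =
      ∫ x : Metric.sphere (0 : E n) 1, topWedge h (β x) (β' x) * ∑ i, G.wt i * (x : E n) i ^ 2
        ∂(MeasureTheory.volume : MeasureTheory.Measure (E n)).toSphere := by
  rw [pairing, sphereIntegral]
  refine MeasureTheory.integral_congr_ae (Filter.Eventually.of_forall fun x => ?_)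
  exact sum_curryLeft_xi hn _ _

theorem IsHomogeneous.smul {k : ℕ} {lam ν : ℝ} {g : E n → ℝ} {α : Form n k}
    (hg : ContDiffOn ℝ ∞ g {0}ᶜ)
    (hg' : ∀ (s : ℝ) (x : E n), x ≠ 0 → g (G.dil s x) = Real.exp (s * ν) * g x)
    (hα : G.IsHomogeneous lam α) : G.IsHomogeneous (ν + lam) fun x => g x • α x := by
  refine ⟨hg.smul hα.1, fun s x hx => ?_⟩
  change G.dilPull k s (g _ • α _) = _
  rw [map_smul, dilPull_apply, hα.2 s x hx, hg' s x hx, smul_smul, smul_smul, mul_add,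
    Real.exp_add]
  congr 1
  ring

theorem IsHomogeneous.topWedge {p q : ℕ} (h : p + q = n) {lam ν : ℝ} {α : Form n p} {β : Form n q}
    (hα : G.IsHomogeneous lam α) (hβ : G.IsHomogeneous ν β) (s : ℝ) {x : E n} (hx : x ≠ 0) :
    topWedge h (α (G.dil s x)) (β (G.dil s x)) =
      Real.exp (s * (lam + ν - G.homDim)) * topWedge h (α x) (β x) := by
  have h1 := topWedge_comp h (α (G.dil s x)) (β (G.dil s x)) (G.dil s)
  rw [hα.2 s x hx, hβ.2 s x hx, det_dil, map_smul, map_smul, LinearMap.smul_apply, smul_eq_mul,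
    smul_eq_mul] at h1
  refine mul_left_cancel₀ (Real.exp_ne_zero (s * G.homDim)) ?_
  rw [← h1, ← _root_.mul_assoc, ← _root_.mul_assoc, ← Real.exp_add, ← Real.exp_add]
  congr 2
  ring

end HomogeneousLieGroup

namespace HomogeneousLieGroup

variable {n : ℕ} (G : HomogeneousLieGroup n)

/-! ### Pairs of forms with non-zero pairing -/

theorem weight_pos {k : ℕ} {w : ℝ} (hw : w ∈ G.weights (k + 1)) : 0 < w := by
  obtain ⟨φ, hφ, h0⟩ := G.mem_weights_iff.1 hw
  obtain ⟨I, hI⟩ : ∃ I : Fin (k + 1) → Fin n, φ (basisTuple I) ≠ 0 := by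
    by_contra! hc
    exact h0 (Alt.ext_basisTuple hc)
  rw [← G.mem_weightSpace_iff.1 hφ I hI]
  exact Finset.sum_pos (fun j _ => G.wt_pos _) Finset.univ_nonempty

theorem topWedge_toFrame {p q : ℕ} (h : p + q = n) (α : Form n p) (β : Form n q) (x : E n) :
    topWedge h (G.toFrame α x) (G.toFrame β x) =
      LinearMap.det (G.leftDiff x : E n →ₗ[ℝ] E n) * topWedge h (α x) (β x) :=
  topWedge_comp h _ _ _

theorem det_leftDiff_ne_zero (x : E n) : LinearMap.det (G.leftDiff x : E n →ₗ[ℝ] E n) ≠ 0 := by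
  have h1 : (G.leftDiffInv x : E n →ₗ[ℝ] E n) ∘ₗ (G.leftDiff x : E n →ₗ[ℝ] E n) =
      LinearMap.id := congrArg ContinuousLinearMap.toLinearMap (G.leftDiffInv_comp_leftDiff x)
  have h2 := congrArg LinearMap.det h1
  rw [LinearMap.det_comp, LinearMap.det_id] at h2
  exact right_ne_zero_of_mul (h2 ▸ one_ne_zero)

/-- For all but finitely many degrees there is a homogeneous form whose differential has weight at
least `wMin` and pairs non-trivially with a fixed left-invariant cocycle. -/
theorem exists_form_weight_wMin {a b : ℕ} (h : a + 1 + b = n) :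
    ∃ ψ ∈ G.cocycles b (G.homDim - G.wMin (a + 1)), ∃ Z : Set ℝ, Z.Finite ∧ ∀ lam ∉ Z,
      ∃ α : Form n a, G.IsHomogeneous lam α ∧ G.HasWeightGE (G.wMin (a + 1)) (extDeriv α) ∧
        ∃ x : E n, ‖x‖ = 1 ∧ topWedge h (extDeriv α x) (G.leftInvariant ψ x) ≠ 0 := by
  set u := G.wMin (a + 1)
  have hmem := G.wMin_mem (k := a + 1) (by omega)
  -- Cartan's formula provides a primitive only after division by the degree `u`.
  have hu0 : u ≠ 0 := (G.weight_pos (G.cohomologyWeights_subset_weights _ hmem)).ne'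
  obtain ⟨φ, hφ, hφ'⟩ := G.mem_cohomologyWeights_iff.1 hmem
  obtain ⟨ψ, hψ, hφψ⟩ := G.exists_dual_cocycle h hφ.1 hφ'
  obtain ⟨ρ, hρ, hρs⟩ := G.exists_logGauge
  obtain ⟨δ, hδ⟩ := G.exists_isPartialInverse a (Set.Iio u)
    fun v hv => G.notMem_cohomologyWeights_of_lt_wMin hv
  set m := (G.weightFinset (a + 1)).card + 1
  have hU := isOpen_compl_zero (n := n)
  have hΦ := isHomogeneous_leftInvariant hφ.1
  set α₀ : Form n a := fun x => u⁻¹ • G.contract (G.leftInvariant φ) x with hα₀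
  have hα₀s : ContDiffOn ℝ ∞ α₀ {0}ᶜ := hΦ.contract.1.const_smul u⁻¹
  let F : ℝ → Form n a := fun μ x => Real.exp (μ * ρ x) • α₀ x
  have hF : ExpPoly ρ a F := ExpPoly.base α₀ hα₀s
  have hdF := hF.extDeriv hρ
  have hdF0 : ∀ x ∈ ({0}ᶜ : Set (E n)), _root_.extDeriv (F 0) x = G.leftInvariant φ x := by
    intro x hx
    have h1 : F 0 = u⁻¹ • G.contract (G.leftInvariant φ) := by
      funext x
      simp [F, hα₀]
    rw [h1, _root_.extDeriv_smul, hΦ.extDeriv_contract hx (extDeriv_leftInvariant hφ.2 x),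
      smul_smul, inv_mul_cancel₀ hu0, one_smul]
  have hc := hdF.liftStep_iterate G hρ δ m
  let x₁ : E n := EuclideanSpace.single ⟨0, by omega⟩ 1
  have hx₁ : ‖x₁‖ = 1 := by simp [x₁]
  have hx₁0 : x₁ ≠ 0 := by
    intro h0
    simp [h0] at hx₁
  -- At `μ = 0` the differential is the left-invariant form of `φ`, of weight exactly `u`. As `δ`
  -- vanishes on that weight, the procedure leaves it fixed and the product with `ψ` stays nonzero.
  have hfin := hc.finite_zeros hx₁0 ((topWedge h).flip (G.leftInvariant ψ x₁)) (by
    rw [G.liftStep_iterate_eq_self hU (fun x hx => ?_) m x₁ hx₁0, hdF0 x₁ hx₁0]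
    · intro h0
      have h1 := G.topWedge_toFrame h (G.leftInvariant φ) (G.leftInvariant ψ) x₁
      rw [toFrame_leftInvariant, toFrame_leftInvariant] at h1
      rw [LinearMap.flip_apply] at h0
      rw [h0, MulZeroClass.mul_zero] at h1
      exact hφψ h1
    · rw [toFrame, hdF0 x hx]
      change δ (G.toFrame (G.leftInvariant φ) x) = 0
      rw [toFrame_leftInvariant]
      exact hδ.apply_eq_zero u (lt_irrefl u) φ hφ.1)
  refine ⟨ψ, hψ, _, hfin.image fun μ => μ + u, fun lam hlam => ?_⟩
  set μ := lam - u
  have hFμ : G.IsHomogeneous lam (F μ) := by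
    have h1 := IsHomogeneous.smul (G := G) (g := fun x => Real.exp (μ * ρ x) * u⁻¹) (ν := μ)
      (((contDiffOn_const.mul hρ).exp).mul contDiffOn_const) (fun s x hx => by
        rw [hρs s x hx, mul_add, Real.exp_add, mul_comm s μ]; ring) hΦ.contract
    rw [show μ + G.wMin (a + 1) = lam from sub_add_cancel _ _] at h1
    convert h1 using 1
    funext x
    simp only [F, hα₀, smul_smul]
  have hβ := hFμ.extDeriv
  have hcl : ∀ x ∈ ({0}ᶜ : Set (E n)), _root_.extDeriv (_root_.extDeriv (F μ)) x = 0 :=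
    fun x hx => extDeriv_extDeriv_on hU hFμ.1 hx
  have hdα : ∀ x ∈ ({0}ᶜ : Set (E n)),
      _root_.extDeriv (F μ - G.liftCorr δ m (_root_.extDeriv (F μ))) x =
        (G.liftStep δ)^[m] (_root_.extDeriv (F μ)) x := by
    intro x hx
    rw [G.liftStep_iterate_eq hU hβ.1 m hx]
    exact extDeriv_sub_apply (differentiableAt_of_contDiffOn hU hFμ.1 hx)
      (differentiableAt_of_contDiffOn hU (G.contDiffOn_liftCorr hU hβ.1 m) hx)
  refine ⟨F μ - G.liftCorr δ m (_root_.extDeriv (F μ)), hFμ.sub (hβ.liftCorr hδ m), ?_,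
    x₁, hx₁, ?_⟩
  · intro x hx
    rw [hdα x hx]
    exact G.toFrame_liftStep_iterate_mem hδ hU (by omega) hβ.1 hcl hx
  · rw [hdα x₁ hx₁0]
    exact fun h0 => hlam ⟨μ, h0, sub_add_cancel _ _⟩

/-- A form pairing non-trivially with a given closed form of weight at least `wMin`. -/
theorem exists_dual_form {a b : ℕ} (hn : a + b + 1 = n) (h : a + 1 + b = n) {u : ℝ} {ψ : Alt n b}
    (hψ : ψ ∈ G.cocycles b (G.homDim - u)) {lam : ℝ} {α : Form n a} (hα : G.IsHomogeneous lam α)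
    (hw : G.HasWeightGE u (extDeriv α)) {x₁ : E n} (hx₁ : ‖x₁‖ = 1)
    (hne : topWedge h (extDeriv α x₁) (G.leftInvariant ψ x₁) ≠ 0) :
    ∃ α' : Form n b, G.IsHomogeneous (-lam) α' ∧
      G.HasWeightGE (G.homDim - u + G.minWt) (extDeriv α') ∧
      G.HasWeightGE (G.homDim - G.wMax a) (extDeriv α') ∧
      G.pairing (Nat.add_right_comm a 1 b) hn (extDeriv α) α' ≠ 0 := by
  obtain ⟨ρ, hρ, hρs⟩ := G.exists_logGauge
  -- By duality a cohomology weight `v` of degree `b + 1` gives the weight `T - v ≤ wMax a` in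
  -- degree `a`.
  obtain ⟨δ, hδ⟩ := G.exists_isPartialInverse b (Set.Iio (G.homDim - G.wMax a)) (by
    intro v hv hv'
    refine G.notMem_cohomologyWeights_of_wMax_lt ?_ (G.mem_cohomologyWeights_dual hn hv')
    rw [Set.mem_Iio] at hv
    linarith)
  set m := (G.weightFinset (b + 1)).card + 1
  have hn0 : 0 < n := by omega
  have hU := isOpen_compl_zero (n := n)
  have hc := hα.extDeriv
  have hΨ := isHomogeneous_leftInvariant hψ.1
  -- The coefficient `f` has degree `λ - u`, while `g` must have degree `u - T - λ` for `g ψ` to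
  -- have degree `-λ`; `κ` is the difference.
  let κ := 2 * u - G.homDim - 2 * lam
  let f : E n → ℝ := fun x => topWedge h (_root_.extDeriv α x) (G.leftInvariant ψ x)
  let g : E n → ℝ := fun x => Real.exp (κ * ρ x) * f x
  have hf : ContDiffOn ℝ ∞ f {0}ᶜ := contDiffOn_topWedge h hc.1 hΨ.1
  have hg : ContDiffOn ℝ ∞ g {0}ᶜ := ((contDiffOn_const.mul hρ).exp).mul hf
  let β : Form n b := fun x => g x • G.leftInvariant ψ x
  have hβ : G.IsHomogeneous (-lam) β := by
    have h1 := IsHomogeneous.smul (G := G) (ν := u - G.homDim - lam) hg (fun s x hx => by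
      change Real.exp (κ * ρ (G.dil s x)) * topWedge h _ _ = _
      rw [hc.topWedge h hΨ s hx, hρs s x hx, ← _root_.mul_assoc, ← Real.exp_add]
      change _ = _ * (Real.exp (κ * ρ x) * f x)
      rw [← _root_.mul_assoc, ← Real.exp_add]
      congr 2
      simp only [κ]
      ring) hΨ
    rwa [show u - G.homDim - lam + (G.homDim - u) = -lam by ring] at h1
  have hβf : ∀ x, G.toFrame β x = g x • ψ := fun x => by
    rw [← G.toFrame_leftInvariant ψ x]; rfl
  have hβw : ∀ x ∈ ({0}ᶜ : Set (E n)), G.toFrame β x ∈ G.weightSpaceGE b (G.homDim - u) :=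
    fun x _ => by
      rw [hβf]
      exact Submodule.smul_mem _ _ (G.weightSpace_le_weightSpaceGE le_rfl hψ.1)
  -- Since `ψ` is a cocycle, the algebraic part of `dβ` vanishes and only terms gaining `minWt`
  -- remain.
  have hdβ : ∀ x ∈ ({0}ᶜ : Set (E n)),
      G.toFrame (_root_.extDeriv β) x ∈ G.weightSpaceGE (b + 1) (G.homDim - u + G.minWt) := by
    intro x hx
    have h1 := G.toFrame_extDeriv_sub_mem (differentiableAt_of_contDiffOn hU hβ.1 hx)
      (Filter.eventually_of_mem (hU.mem_nhds hx) hβw)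
    rwa [hβf, map_smul, show G.d₀ b ψ = 0 from hψ.2, smul_zero, sub_zero] at h1
  have hdβs := hβ.extDeriv
  have hcl : ∀ x ∈ ({0}ᶜ : Set (E n)), _root_.extDeriv (_root_.extDeriv β) x = 0 :=
    fun x hx => extDeriv_extDeriv_on hU hβ.1 hx
  set γ := G.liftCorr δ m (_root_.extDeriv β)
  have hdα' : ∀ x ∈ ({0}ᶜ : Set (E n)),
      _root_.extDeriv (β - γ) x = (G.liftStep δ)^[m] (_root_.extDeriv β) x := by
    intro x hx
    rw [G.liftStep_iterate_eq hU hdβs.1 m hx]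
    exact extDeriv_sub_apply (differentiableAt_of_contDiffOn hU hβ.1 hx)
      (differentiableAt_of_contDiffOn hU (G.contDiffOn_liftCorr hU hdβs.1 m) hx)
  refine ⟨β - γ, hβ.sub (hdβs.liftCorr hδ m), fun x hx => ?_, fun x hx => ?_, ?_⟩
  · rw [hdα' x hx]
    exact G.toFrame_liftStep_iterate_mem_GE hδ hU hn0 hdβs.1 hdβ m x hx
  · rw [hdα' x hx]
    exact G.toFrame_liftStep_iterate_mem hδ hU hn0 hdβs.1 hcl hx
  · have hval : ∀ x : E n, x ≠ 0 → topWedge h (_root_.extDeriv α x) ((β - γ) x) =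
        Real.exp (κ * ρ x) * f x ^ 2 := by
      intro x hx
      -- The weights add up to at least `u + (T - u + minWt) > T`, so the correction does not affect
      -- the pairing.
      have h1 : topWedge h (_root_.extDeriv α x) (γ x) = 0 := by
        have h2 := G.topWedge_toFrame h (_root_.extDeriv α) γ x
        rw [G.topWedge_eq_zero_of_GE h
          (show G.toFrame (_root_.extDeriv α) x ∈ _ from hw x hx)
          (G.toFrame_liftCorr_mem_GE hδ hU hn0 hdβs.1 hdβ m hx)
          (by linarith [G.minWt_pos hn0]), eq_comm, mul_eq_zero] at h2
        exact h2.resolve_left (G.det_leftDiff_ne_zero x)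
      rw [Pi.sub_apply, map_sub, h1, sub_zero, map_smul]
      change Real.exp (κ * ρ x) * f x * f x = _
      ring
    have hx0 : ∀ x : Metric.sphere (0 : E n) 1, (x : E n) ≠ 0 := fun x =>
      ne_zero_of_mem_unit_sphere x
    rw [G.pairing_eq hn h]
    let q : E n → ℝ := fun x => Real.exp (κ * ρ x) * f x ^ 2 * ∑ i, G.wt i * x i ^ 2
    have hq : ContinuousOn q {0}ᶜ :=
      ((((contDiffOn_const.mul hρ).exp).mul (hf.pow 2)).continuousOn).mul
        (Continuous.continuousOn (by fun_prop))
    have hq' : Continuous fun x : Metric.sphere (0 : E n) 1 => q x :=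
      hq.comp_continuous continuous_subtype_val fun x => hx0 x
    have hnn : ∀ x : E n, 0 ≤ q x := fun x => mul_nonneg (by positivity)
      (Finset.sum_nonneg fun i _ => mul_nonneg (G.wt_pos i).le (sq_nonneg _))
    have hx₁0 : x₁ ≠ 0 := by
      rintro rfl
      simp at hx₁
    have hpos := hq'.integral_pos_of_hasCompactSupport_nonneg_nonzero
      (μ := (MeasureTheory.volume : MeasureTheory.Measure (E n)).toSphere)
      (HasCompactSupport.of_compactSpace _) (fun x => hnn x)
      (x := ⟨x₁, by simpa using hx₁⟩)
      (mul_ne_zero (mul_ne_zero (Real.exp_ne_zero _) (pow_ne_zero 2 hne))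
        (sum_mul_sq_pos G.wt_pos hx₁0).ne')
    refine ne_of_gt (lt_of_lt_of_eq hpos ?_)
    refine MeasureTheory.integral_congr_ae (Filter.Eventually.of_forall fun x => ?_)
    change _ = topWedge h _ _ * _
    rw [hval x (hx0 x)]

/-! ### The numerical invariant -/

theorem finite_wsSet (k : ℕ) : (G.wsSet k).Finite := by
  refine (((G.finite_weights k).prod ((G.finite_weights (n - k + 1)))).image
    fun p => p.1 + p.2 - G.homDim).subset ?_
  rintro t ⟨a, b, rfl, hn, w, hw, w', hw', rfl, -⟩
  have hb : n - (a + 1) + 1 = b + 1 := by omega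
  exact ⟨(w, w'), ⟨hw, by rwa [hb]⟩, rfl⟩

/-- The forms constructed have weights at least `u` and `M`. As `M` need not be a weight of `Λ^{b+1}
𝔤*`, it is rounded up to the next one, `w'`, which does not change the space of forms of weight `≥
M`. -/
theorem exists_le_mem_wsSet {k : ℕ} (hk : 1 ≤ k) (hkn : k ≤ n) :
    ∃ t ∈ G.wsSet k, max G.minWt (G.wMin k - G.wMax (k - 1)) ≤ t := by
  obtain ⟨a, rfl⟩ : ∃ a, k = a + 1 := ⟨k - 1, by omega⟩
  obtain ⟨b, hn⟩ : ∃ b, a + b + 1 = n := ⟨n - (a + 1), by omega⟩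
  have h : a + 1 + b = n := by omega
  rw [Nat.add_sub_cancel]
  set u := G.wMin (a + 1)
  set M := max (G.homDim - u + G.minWt) (G.homDim - G.wMax a) with hM
  have hu : u ∈ G.weights (a + 1) := G.cohomologyWeights_subset_weights _ (G.wMin_mem hkn)
  -- For the first term of `M`, removing an index `i` from a multi-index of weight `u` and dualizing
  -- gives the weight `T - u + d_i`; for the second, `T - wMax a` is itself dual to a weight.
  have hex : ((G.weights (b + 1)) ∩ Set.Ici M).Nonempty := by
    rcases max_choice (G.homDim - u + G.minWt) (G.homDim - G.wMax a) with h1 | h1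
    · obtain ⟨i, hi⟩ := G.exists_sub_mem_weights hu
      refine ⟨_, G.mem_weights_dual (q := b + 1) (by omega) hi, ?_⟩
      rw [Set.mem_Ici, hM, h1]
      linarith [G.minWt_le i]
    · exact ⟨_, G.mem_weights_dual (q := b + 1) (by omega)
        (G.cohomologyWeights_subset_weights _ (G.wMax_mem (k := a) (by omega))), h1.le⟩
  have hfin : ((G.weights (b + 1)) ∩ Set.Ici M).Finite := (G.finite_weights _).inter_of_left _
  set w' := sInf ((G.weights (b + 1)) ∩ Set.Ici M)
  obtain ⟨hw', hMw'⟩ : w' ∈ (G.weights (b + 1)) ∩ Set.Ici M := hex.csInf_mem hfin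
  have hGE : ∀ φ ∈ G.weightSpaceGE (b + 1) M, φ ∈ G.weightSpaceGE (b + 1) w' := by
    refine fun φ hφ => G.mem_weightSpaceGE_of_proj fun v hv => ?_
    rcases lt_or_ge v M with hvM | hvM
    · exact G.proj_eq_zero_of_mem_GE hφ hvM
    · by_contra h0
      exact notMem_of_lt_csInf hv hfin.bddBelow
        ⟨G.mem_weights_iff.2 ⟨_, G.proj_mem _ _, h0⟩, hvM⟩
  obtain ⟨ψ, hψ, Z, hZ, hZ'⟩ := G.exists_form_weight_wMin h
  refine ⟨u + w' - G.homDim, ⟨a, b, rfl, hn, u, hu, w', hw', rfl, ?_⟩, ?_⟩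
  · refine (hZ.countable.dense_compl ℝ).mono fun lam hlam => ?_
    obtain ⟨α, hα, hαw, x, hx, hne⟩ := hZ' lam hlam
    obtain ⟨α', hα', h1, h2, h3⟩ := G.exists_dual_form hn h hψ hα hαw hx hne
    refine ⟨α, α', hα, hα', hαw, fun x hx => hGE _ ?_, h3⟩
    rcases max_choice (G.homDim - u + G.minWt) (G.homDim - G.wMax a) with h4 | h4
    · rw [hM, h4]
      exact h1 x hx
    · rw [hM, h4]
      exact h2 x hx
  · rw [Set.mem_Ici, hM, max_le_iff] at hMw'
    exact max_le (by linarith) (by linarith)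

theorem isGreatest_ws {k : ℕ} (hk : 1 ≤ k) (hkn : k ≤ n) : IsGreatest (G.wsSet k) (G.ws k) := by
  obtain ⟨t, ht, -⟩ := G.exists_le_mem_wsSet hk hkn
  exact ⟨Set.Nonempty.csSup_mem ⟨t, ht⟩ (G.finite_wsSet k),
    fun s hs => le_csSup (G.finite_wsSet k).bddAbove hs⟩

end HomogeneousLieGroup

end HomGroup

end

theorem mainTheorem4 {n : ℕ} (G : HomGroup.HomogeneousLieGroup n) (k : ℕ)
    (hk : 1 ≤ k) (hkn : k ≤ n) :
    IsGreatest (G.wsSet k) (G.ws k) ∧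
      max (⨅ i, G.wt i) (G.wMin k - G.wMax (k - 1)) ≤ G.ws k ∧
      ((∀ i, 1 ≤ G.wt i) → max 1 (G.wMin k - G.wMax (k - 1)) ≤ G.ws k) := by
  have hws := G.isGreatest_ws hk hkn
  obtain ⟨t, ht, hle⟩ := G.exists_le_mem_wsSet hk hkn
  have h1 : max (⨅ i, G.wt i) (G.wMin k - G.wMax (k - 1)) ≤ G.ws k := hle.trans (hws.2 ht)
  have : Nonempty (Fin n) := ⟨⟨0, by omega⟩⟩
  exact ⟨hws, h1, fun hwt => (max_le_max (le_ciInf hwt) le_rfl).trans h1⟩
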